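/- **Setting.** Let $M\subset\mathbb R^N$ be an embedded $C^\infty$ submanifold and $f:M\to M$ a $C^\infty$ diffeomorphism. Assume that $f$ and $f^{-1}$ are given together with extensions that are $C^\infty$ around every point of $M$; derivatives and norms below are those of the extensions. Let $\Lambda\subset M$ be compact with $f(\Lambda)=\Lambda$, and let $$T_xM=E^c_1(x)\oplus E^u_1(x)\oplus E^s_1(x)\qquad(x\in\Lambda)$$ be a splitting. Write $E^{sc}_1=E^s_1\oplus E^c_1$ and $E^{uc}_1=E^u_1\oplus E^c_1$. For a subset $S$ let $T^0S=S$ and $T^{k+1}S=T(T^kS)$, the set of pairs $(\xi,v)$ with $\xi\in T^kS$ and $v$ tangent to $T^kS$ at $\xi$; the foot point of $\xi=(\dots((x,v_1),v_2)\dots,v_k)\in T^kS$ is $x$. Let $f_0=f$ and $f_k(\xi,v)=(f_{k-1}(\xi),Df_{k-1}(\xi)v)$ be the jet maps. Fix $i\ge1$. For $x\in\Lambda$ let $W^{sc}(x),W^{uc}(x)\subset M$ contain $x$, be $C^i$ submanifolds near $x$, and satisfy $T_xW^{sc}(x)=E_1^{sc}(x)$ and $T_xW^{uc}(x)=E_1^{uc}(x)$,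 with derivatives up to order $i$ at $x$ bounded uniformly in $x\in\Lambda$. Let them be locally invariant: $f$ maps a neighbourhood of $x$ in $W^{sc}(x)$ into $W^{sc}(f(x))$, and $f^{-1}$ maps a neighbourhood of $x$ in $W^{uc}(x)$ into $W^{uc}(f^{-1}(x))$. Let $W^c(x)$ be the center manifold through $x$, i.e. $W^c(x)=W^{uc}(x)\cap W^{sc}(x)$ near $x$ (the leaf of $\Lambda$ through $x$, when $\Lambda$ is laminated by its center manifolds). **Theorem B.1.** 1. (Jet splitting.) For every $\xi\in T^{i-1}W^c(x)$ with foot point $x\in\Lambda$ there is a splitting $T_\xi(T^{i-1}M)=E^c_i\oplus E^u_i\oplus E^s_i$ such that $E_i^u\oplus E_i^c=E^{uc}_i(\xi):=T_\xi(T^{i-1}W^{uc}(x))$, $E_i^s\oplus E_i^c=E^{sc}_i(\xi):=T_\xi(T^{i-1}W^{sc}(x))$ and $E^{uc}_i(\xi)\cap E^{sc}_i(\xi)=E^c_i=T_\xi(T^{i-1}W^c(x))$. Moreover, at the points $\xi$ with foot point $x\in\Lambda$, the map $f_{i-1}$ carries $T^{i-1}W^{sc}(x)$ into $T^{i-1}W^{sc}(f(x))$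 and $Df_{i-1}(\xi)$ carries $E_i^{sc}(\xi)$ into $E_i^{sc}(f_{i-1}(\xi))$; the same holds for $W^{uc}$, $E_i^{uc}$ and $f^{-1}$. 2. (Center-stable distribution.) Suppose $0<\lambda^{sc}_+<\lambda^u_+$ and that for some $C>0$ $$\|Df^n(x)v\|\le C(\lambda_+^{sc})^n\|v\|\ \ (v\in E_1^{sc}(x)),\qquad \|Df^n(x)v\|\ge C^{-1}(\lambda_+^u)^n\|v\|\ \ (v\in E_1^u(x))$$ for all $x\in\Lambda$ and $n\in\mathbb N$. Suppose that $E^u_1$ is not zero at every point of $\Lambda$, that $(\lambda_+^{sc})^{i+1}<\lambda_+^u$ in case $i\ge2$, and that $\|f\|_{C^{i+3}}\ge1$, where $\|f\|_{C^k}=\sup_{x\in\Lambda}\max_{0\le j\le k}\|D^jf(x)\|$. Put $$b_i^+=3^{4i}\,(i+1)!\,2^{(i+2)(i+3)/2}\,\|f\|_{C^{i+3}}^{\,i+3},\qquad \varphi_i^{sc}=\frac{\ln\lambda_+^u-\ln\lambda_+^{sc}}{\ln b_i^+-\ln\lambda_+^{sc}} .$$ Then $E_i^{sc}$ is Hölder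 continuous with exponent $\varphi_i^{sc}$: there is a constant $C'$ such that $\mathrm{dist}(E_i^{sc}(\xi),E_i^{sc}(\eta))\le C'\|\xi-\eta\|^{\varphi_i^{sc}}$ for all $\xi\in T^{i-1}W^{sc}(x)$ and $\eta\in T^{i-1}W^{sc}(y)$ with foot points $x,y\in\Lambda$ all of whose velocities have norm at most $1$ (in particular for such $\xi,\eta$ in $T^{i-1}W^c(x)$, $T^{i-1}W^c(y)$). Here $\mathrm{dist}(A,B)$ is the larger of $\max_{v\in A,\|v\|=1}\mathrm{dist}(v,B)$ and $\max_{w\in B,\|w\|=1}\mathrm{dist}(w,A)$. 3. (Center-unstable distribution.) Likewise, suppose $0<\lambda^{uc}_-<\lambda^s_-$ and that for some $C>0$ one has $\|Df^{-n}(x)v\|\le C(\lambda_-^{uc})^n\|v\|$ on $E_1^{uc}$ and $\|Df^{-n}(x)v\|\ge C^{-1}(\lambda_-^s)^n\|v\|$ on $E_1^s$ for all $x\in\Lambda$, $n\in\mathbb N$. Suppose that $E_1^s$ is not zero at every point of $\Lambda$, $(\lambda_-^{uc})^{i+1}<\lambda_-^s$ in case $i\ge2$, and $\|f^{-1}\|_{C^{i+3}}\ge1$.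 Then, with $b_i^-$ defined like $b_i^+$ from $\|f^{-1}\|_{C^{i+3}}$, the distribution $E_i^{uc}$ is Hölder continuous, in the same sense with $W^{uc}$ in place of $W^{sc}$, with exponent $$\varphi_i^{uc}=\frac{\ln\lambda_-^s-\ln\lambda_-^{uc}}{\ln b_i^--\ln\lambda_-^{uc}} .$$ -/

import Mathlib

open Set Filter Topology
open scoped ContDiff

noncomputable section

/-- The iterated tangent space `T^k V = T(T(⋯ T V))` of a vector space `V`:
`T^0 V = V`, `T^(k+1) V = T^k V × T^k V`, an element `(x, v)` being a point `x` of `T^k V` and a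
velocity `v` at this point. It carries the maximum norm of the components. -/
def JetSpace (V : Type*) : ℕ → Type _
  | 0 => V
  | k + 1 => JetSpace V k × JetSpace V k

instance JetSpace.instNormedAddCommGroup (V : Type*) [NormedAddCommGroup V] :
    (k : ℕ) → NormedAddCommGroup (JetSpace V k)
  | 0 => inferInstanceAs (NormedAddCommGroup V)
  | k + 1 =>
    letI := JetSpace.instNormedAddCommGroup V k
    inferInstanceAs (NormedAddCommGroup (JetSpace V k × JetSpace V k))

instance JetSpace.instNormedSpace (V : Type*) [NormedAddCommGroup V] [NormedSpace ℝ V] :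
    (k : ℕ) → NormedSpace ℝ (JetSpace V k)
  | 0 => inferInstanceAs (NormedSpace ℝ V)
  | k + 1 =>
    letI := JetSpace.instNormedSpace V k
    inferInstanceAs (NormedSpace ℝ (JetSpace V k × JetSpace V k))

/-- The foot point in `V` of an element of `T^k V`. -/
def jetBase {V : Type*} : (k : ℕ) → JetSpace V k → V
  | 0, x => x
  | k + 1, p => jetBase k p.1

/-- All the velocities occurring in an element `(⋯((x, v₁), v₂)⋯, v_k)` of `T^k V` have norm at
most one. -/
def VelocitiesLeOne {V : Type*} [NormedAddCommGroup V] : (k : ℕ) → JetSpace V k → Prop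
  | 0, _ => True
  | k + 1, p => VelocitiesLeOne k p.1 ∧ ‖p.2‖ ≤ 1

/-- The jet maps of `f`: `f_0 = f` and `f_(k+1) (x, v) = (f_k x, D f_k (x) v)`. -/
def jetMap {V : Type*} [NormedAddCommGroup V] [NormedSpace ℝ V] (f : V → V) :
    (k : ℕ) → JetSpace V k → JetSpace V k
  | 0, x => f x
  | k + 1, p => (jetMap f k p.1, fderiv ℝ (jetMap f k) p.1 p.2)

/-- The iterated tangent bundle `T^k S ⊆ T^k V` of a subset `S` of `V`: `T^0 S = S`, and
`T^(k+1) S` consists of the points of `T^k S` together with the vectors tangent to `T^k S`. -/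
def jetSet {V : Type*} [NormedAddCommGroup V] [NormedSpace ℝ V] (S : Set V) :
    (k : ℕ) → Set (JetSpace V k)
  | 0 => S
  | k + 1 => {p : JetSpace V k × JetSpace V k |
      p.1 ∈ jetSet S k ∧ p.2 ∈ tangentConeAt ℝ (jetSet S k) p.1}

/-- The tangent space of `S` at `x`. The tangent cone of a `C^1` submanifold is already a linear
subspace; the span only serves to give it the type of a subspace. -/
def tangentSpaceOf {V : Type*} [NormedAddCommGroup V] [NormedSpace ℝ V] (S : Set V) (x : V) :
    Submodule ℝ V :=
  Submodule.span ℝ (tangentConeAt ℝ S x)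

/-- `Φ` is a `C^n` change of coordinates of `V` near `x` which carries `S` to the linear
subspace `A`. -/
structure Flattens {V : Type*} [NormedAddCommGroup V] [NormedSpace ℝ V] (n : WithTop ℕ∞)
    (Φ : OpenPartialHomeomorph V V) (S : Set V) (x : V) (A : Submodule ℝ V) : Prop where
  mem_source : x ∈ Φ.source
  contDiffOn : ContDiffOn ℝ n Φ Φ.source
  contDiffOn_symm : ContDiffOn ℝ n Φ.symm Φ.target
  mem_iff : ∀ y ∈ Φ.source, y ∈ S ↔ Φ y ∈ A

/-- `S` is an embedded `C^n` submanifold (without boundary) of `V`. -/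
def IsEmbeddedSubmanifold {V : Type*} [NormedAddCommGroup V] [NormedSpace ℝ V] (n : WithTop ℕ∞)
    (S : Set V) : Prop :=
  ∀ x ∈ S, ∃ (Φ : OpenPartialHomeomorph V V) (A : Submodule ℝ V), Flattens n Φ S x A

/-- `f` restricts to a `C^∞` diffeomorphism of the submanifold `M`, with inverse `g`. Both maps
are given together with extensions that are smooth around every point of `M`; the values of
the extensions far from `M` are irrelevant. -/
structure IsDiffeoOf {V : Type*} [NormedAddCommGroup V] [NormedSpace ℝ V] (M : Set V)
    (f g : V → V) : Prop where
  mapsTo : MapsTo f M M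
  mapsTo_inv : MapsTo g M M
  invOn : InvOn g f M M
  contDiffAt : ∀ x ∈ M, ContDiffAt ℝ ∞ f x
  contDiffAt_inv : ∀ x ∈ M, ContDiffAt ℝ ∞ g x

/-- `T` is the direct sum of its subspaces `A`, `B` and `C`. -/
def IsSplitting {V : Type*} [AddCommGroup V] [Module ℝ V] (T A B C : Submodule ℝ V) : Prop :=
  A ⊔ B ⊔ C = T ∧ iSupIndep ![A, B, C]

/-- `‖D h^n (x) v‖ ≤ C l^n ‖v‖` for `v ∈ A x` and `‖D h^n (x) v‖ ≥ C⁻¹ m^n ‖v‖` for `v ∈ B x`, with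
a constant `C` that does not depend on `x ∈ Λ`, `n` and `v`. -/
def HasRates {V : Type*} [NormedAddCommGroup V] [NormedSpace ℝ V] (h : V → V) (Λ : Set V)
    (A B : V → Submodule ℝ V) (l m : ℝ) : Prop :=
  ∃ C : ℝ, 0 < C ∧ ∀ x ∈ Λ, ∀ n : ℕ,
    (∀ v ∈ A x, ‖fderiv ℝ h^[n] x v‖ ≤ C * l ^ n * ‖v‖) ∧
    (∀ v ∈ B x, C⁻¹ * m ^ n * ‖v‖ ≤ ‖fderiv ℝ h^[n] x v‖)

/-- `W x`, `x ∈ Λ`, is a family of `C^n` submanifolds of `M` passing through the points of `Λ` in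
the direction of the distribution `A`, with derivatives up to order `n` bounded uniformly in
`x`, and locally invariant under `h`: the image under `h` of the germ of `W x` at `x` lies in
`W (h x)`. -/
structure IsInvariantLeafFamily {V : Type*} [NormedAddCommGroup V] [NormedSpace ℝ V] (n : ℕ)
    (M Λ : Set V) (h : V → V) (A : V → Submodule ℝ V) (W : V → Set V) : Prop where
  mem : ∀ x ∈ Λ, x ∈ W x
  subset : ∀ x ∈ Λ, W x ⊆ M
  tangent : ∀ x ∈ Λ, tangentSpaceOf (W x) x = A x
  smooth : ∃ K : ℝ, ∀ x ∈ Λ, ∃ (Φ : OpenPartialHomeomorph V V) (B : Submodule ℝ V),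
    Flattens n Φ (W x) x B ∧ ∀ j : ℕ, 1 ≤ j → j ≤ n →
      ‖iteratedFDeriv ℝ j Φ x‖ ≤ K ∧ ‖iteratedFDeriv ℝ j Φ.symm (Φ x)‖ ≤ K
  invariant : ∀ x ∈ Λ, ∀ᶠ y in 𝓝 x, y ∈ W x → h y ∈ W (h x)

/-- The `C^k` norm of `f` on `Λ`: the supremum over `Λ` of the norms of the derivatives of order
`0, …, k`. -/
def cNorm {V : Type*} [NormedAddCommGroup V] [NormedSpace ℝ V] (k : ℕ) (f : V → V) (Λ : Set V) :
    ℝ :=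
  ⨆ x : Λ, ⨆ j : Fin (k + 1), ‖iteratedFDeriv ℝ (j : ℕ) f (x : V)‖

/-- The constant `b_i = 3^(4i) (i+1)! 2^((i+2)(i+3)/2) ‖f‖_{C^(i+3)}^(i+3)`. -/
def bConst {V : Type*} [NormedAddCommGroup V] [NormedSpace ℝ V] (i : ℕ) (f : V → V)
    (Λ : Set V) : ℝ :=
  3 ^ (4 * i) * ((i + 1).factorial : ℝ) * 2 ^ ((i + 2) * (i + 3) / 2) *
    cNorm (i + 3) f Λ ^ (i + 3)

/-- The Hölder exponent `(ln m - ln l) / (ln b - ln l)`. -/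
def holderExponent (l m b : ℝ) : ℝ :=
  (Real.log m - Real.log l) / (Real.log b - Real.log l)

/-- The distance of two linear subspaces: the larger one of
`max {dist (v, B) | v ∈ A, ‖v‖ = 1}` and `max {dist (w, A) | w ∈ B, ‖w‖ = 1}`. -/
def subspaceDist {V : Type*} [NormedAddCommGroup V] [NormedSpace ℝ V] (A B : Submodule ℝ V) : ℝ :=
  max (⨆ v : {v : V // v ∈ A ∧ ‖v‖ = 1}, Metric.infDist (v : V) (B : Set V))
    (⨆ w : {w : V // w ∈ B ∧ ‖w‖ = 1}, Metric.infDist (w : V) (A : Set V))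

/-- The distribution `ξ ↦ T_ξ (T^k (W x))`, where `ξ` is an element of `T^k (W x)` with foot point
`x ∈ Λ`, is Hölder continuous with exponent `φ` on the set of all such `ξ` whose velocities have
norm at most one. -/
def IsHolderJetDistribution {V : Type*} [NormedAddCommGroup V] [NormedSpace ℝ V] (k : ℕ)
    (Λ : Set V) (W : V → Set V) (φ : ℝ) : Prop :=
  ∃ C : ℝ, ∀ x ∈ Λ, ∀ y ∈ Λ, ∀ ξ ∈ jetSet (W x) k, ∀ η ∈ jetSet (W y) k,
    jetBase k ξ = x → jetBase k η = y → VelocitiesLeOne k ξ → VelocitiesLeOne k η →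
    subspaceDist (tangentSpaceOf (jetSet (W x) k) ξ) (tangentSpaceOf (jetSet (W y) k) η) ≤
      C * ‖ξ - η‖ ^ φ

end

/-! Rescaling the parameters of a jet by `t` (`jetScale`) preserves every bundle `T^k S`, and it
brings jets with velocities at most one as close as desired to the zero jets at their foot points.
So Hölder continuity needs proof only at jets with small velocities
(`isHolderJetDistribution_of_smallJets`), and there the jet map may be replaced by `jetStep`, the
jet map followed by the rescaling with `t = σ⁻¹`. At a zero jet the jet map linearises to the
derivative of the base map on every component (`fderiv_jetMap_jetLift`). Hence near zero jets
`jetStep` inherits, up to an arbitrarily small loss, the norm bound of that derivative, its upper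
rate `l` along the leaves and, up to the factor `σ⁻ᵏ`, its lower rate on the quotient of `TM` by the
leaf directions. If `l ≤ σ`, velocities do not grow, so orbits of small jets stay small.

The main estimate is `exists_gap_le_rpow`. Let `v` be tangent to the jets of a leaf at `ξ`, and let
`δ = ‖ξ - η‖`. Project `v` to a vector `z` tangent to `T^k M` at `η`, and transport both vectors.
The image of `v` is at most `l ^ n ‖v‖`, and the two images differ by `O((D' σ) ^ n δ ‖v‖)`, where
`D'` exceeds the norm of the derivative. With `κ = D' σ / l`, the image of `z` is thus `O(l ^ n
‖v‖)` as long as `κ ^ n δ` stays bounded. Modulo the tangent space of the leaf jets, however, `z` is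
expanded by at least `m ^ n`, so its distance to that space at `η` is `O((l / m) ^ n ‖v‖)`. If `l κ
^ φ ≤ m`, the largest admissible `n` gives `O(δ ^ φ ‖v‖)`.

Two facts bring the hypotheses into this form. The complement `E^u` is not assumed invariant, so the
lower rate on it must be converted into one on the quotient; a large iterate then absorbs all
constants (`IsRateCocycle.exists_one_step`), and the exponent is unchanged because every rate
becomes an `N`-th power. `exists_scaling` chooses `σ`; the constant `b` enters only through the
inequality of `pow_mul_lt_bConst`.

The splitting comes from one chart that flattens `M`, both leaves and their intersection
simultaneously (`IsSplitting.exists_flattens`): in it all jet bundles are linear. Throughout,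
tangent spaces of jets of a submanifold are the fixed spaces of the derivatives of the jet maps of a
local retraction, which replaces parametrisations. -/

noncomputable section

/-! ### The derivative of a tangent map -/

section JetCalculus

variable {X : Type*} [NormedAddCommGroup X] [NormedSpace ℝ X]

lemma contDiffAt_tangentMap {F : X → X} {m : ℕ} {p : X × X}
    (h : ContDiffAt ℝ (m + 1 : ℕ) F p.1) :
    ContDiffAt ℝ m (fun p : X × X => (F p.1, fderiv ℝ F p.1 p.2)) p := by
  have h1 : ContDiffAt ℝ m (fderiv ℝ F) p.1 := h.fderiv_right (by norm_cast)
  have h0 : ContDiffAt ℝ m F p.1 := h.of_le (by norm_cast; omega)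
  refine ContDiffAt.prodMk (h0.comp p contDiffAt_fst) ?_
  exact (h1.comp p contDiffAt_fst).clm_apply contDiffAt_snd

lemma hasFDerivAt_tangentMap {F : X → X} {p : X × X} (h : ContDiffAt ℝ 2 F p.1) :
    HasFDerivAt (fun p : X × X => (F p.1, fderiv ℝ F p.1 p.2))
      (((fderiv ℝ F p.1).comp (ContinuousLinearMap.fst ℝ X X)).prod
        ((fderiv ℝ F p.1).comp (ContinuousLinearMap.snd ℝ X X) +
          ((fderiv ℝ (fderiv ℝ F) p.1).comp (ContinuousLinearMap.fst ℝ X X)).flip p.2)) p := by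
  have h1 : ContDiffAt ℝ 1 (fderiv ℝ F) p.1 := h.fderiv_right (by norm_num)
  have hF : HasFDerivAt F (fderiv ℝ F p.1) p.1 := (h.differentiableAt (by simp)).hasFDerivAt
  have hD : HasFDerivAt (fderiv ℝ F) (fderiv ℝ (fderiv ℝ F) p.1) p.1 :=
    (h1.differentiableAt (by simp)).hasFDerivAt
  refine HasFDerivAt.prodMk (hF.comp p hasFDerivAt_fst) ?_
  exact HasFDerivAt.clm_apply (hD.comp p hasFDerivAt_fst) hasFDerivAt_snd

lemma fderiv_tangentMap_apply {F : X → X} {p : X × X} (h : ContDiffAt ℝ 2 F p.1) (v : X × X) :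
    fderiv ℝ (fun p : X × X => (F p.1, fderiv ℝ F p.1 p.2)) p v =
      (fderiv ℝ F p.1 v.1, fderiv ℝ F p.1 v.2 + fderiv ℝ (fderiv ℝ F) p.1 v.1 p.2) := by
  rw [(hasFDerivAt_tangentMap h).fderiv]; rfl

end JetCalculus

/-! ### Functoriality of jets, and the rescaling of parameters -/

section Jets

set_option linter.unusedSectionVars false

variable {V : Type*} [NormedAddCommGroup V] [NormedSpace ℝ V]

/-- The automorphism of `T^k V` induced by the multiplication of the parameters by `t`. -/
def jetScale (V : Type*) [NormedAddCommGroup V] [NormedSpace ℝ V] (t : ℝ) :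
    (k : ℕ) → JetSpace V k →L[ℝ] JetSpace V k
  | 0 => ContinuousLinearMap.id ℝ V
  | k + 1 => (jetScale V t k).prodMap (t • jetScale V t k)

/-- The zero jet at `x`. -/
def jetLift : (k : ℕ) → V → JetSpace V k
  | 0, x => x
  | k + 1, x => (jetLift k x, 0)

/-- The jets all of whose components lie in `B`. -/
def jetSub (B : Submodule ℝ V) : (k : ℕ) → Submodule ℝ (JetSpace V k)
  | 0 => B
  | k + 1 => (jetSub B k).prod (jetSub B k)

/-- The linear map acting on all components of a jet as `L`. -/
def jetDiag (L : V →L[ℝ] V) : (k : ℕ) → JetSpace V k →L[ℝ] JetSpace V k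
  | 0 => L
  | k + 1 => (jetDiag L k).prodMap (jetDiag L k)

lemma continuous_jetBase : (k : ℕ) → Continuous (jetBase (V := V) k)
  | 0 => continuous_id
  | k + 1 => (continuous_jetBase k).comp continuous_fst

lemma jetBase_jetLift (x : V) : (k : ℕ) → jetBase k (jetLift k x) = x
  | 0 => rfl
  | k + 1 => jetBase_jetLift x k

lemma jetBase_jetMap (f : V → V) : (k : ℕ) → (ξ : JetSpace V k) →
    jetBase k (jetMap f k ξ) = f (jetBase k ξ)
  | 0, _ => rfl
  | k + 1, p => jetBase_jetMap f k p.1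

lemma jetBase_jetScale (t : ℝ) : (k : ℕ) → (ξ : JetSpace V k) →
    jetBase k (jetScale V t k ξ) = jetBase k ξ
  | 0, _ => rfl
  | k + 1, p => jetBase_jetScale t k p.1

lemma contDiffAt_jetMap {f : V → V} : (k m : ℕ) → (ξ : JetSpace V k) →
    ContDiffAt ℝ (m + k : ℕ) f (jetBase k ξ) → ContDiffAt ℝ m (jetMap f k) ξ
  | 0, _, _, h => h
  | k + 1, m, p, h => contDiffAt_tangentMap (F := jetMap f k) (p := p)
      (contDiffAt_jetMap k (m + 1) p.1 (by rw [show m + 1 + k = m + (k + 1) by ring]; exact h))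

lemma differentiableAt_jetMap {f : V → V} {k n : ℕ} (hk : k + 1 ≤ n) {ξ : JetSpace V k}
    (h : ContDiffAt ℝ n f (jetBase k ξ)) : DifferentiableAt ℝ (jetMap f k) ξ :=
  (contDiffAt_jetMap k 1 ξ (h.of_le (by norm_cast; omega))).differentiableAt (by simp)

lemma fderiv_jetMap_succ {f : V → V} {k : ℕ} {p : JetSpace V (k + 1)}
    (h : ContDiffAt ℝ (k + 2 : ℕ) f (jetBase (k + 1) p)) (v : JetSpace V (k + 1)) :
    fderiv ℝ (jetMap f (k + 1)) p v = ((fderiv ℝ (jetMap f k) p.1 v.1,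
      fderiv ℝ (jetMap f k) p.1 v.2 + fderiv ℝ (fderiv ℝ (jetMap f k)) p.1 v.1 p.2) :
        JetSpace V k × JetSpace V k) :=
  fderiv_tangentMap_apply (F := jetMap f k) (p := p)
    (contDiffAt_jetMap k 2 p.1 (by rw [add_comm 2 k]; exact h)) v

/-- The second-derivative term is evaluated at the velocity, which is zero here. This is why the
rates near zero jets are those of the base map. -/
lemma fderiv_jetMap_jetLift {f : V → V} {x : V} : (k : ℕ) → ContDiffAt ℝ (k + 1 : ℕ) f x →
    fderiv ℝ (jetMap f k) (jetLift k x) = jetDiag (fderiv ℝ f x) k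
  | 0, _ => rfl
  | k + 1, h => by
    ext1 v
    have ih := fderiv_jetMap_jetLift k (h.of_le (by norm_cast; omega))
    have := fderiv_jetMap_succ (p := jetLift (k + 1) x) (f := f) (k := k)
      (by rw [jetBase_jetLift]; exact h) v
    rw [this]
    change ((fderiv ℝ (jetMap f k) (jetLift k x) v.1, fderiv ℝ (jetMap f k) (jetLift k x) v.2 +
      fderiv ℝ (fderiv ℝ (jetMap f k)) (jetLift k x) v.1 0) : JetSpace V k × JetSpace V k) =
      (jetDiag (fderiv ℝ f x) k v.1, jetDiag (fderiv ℝ f x) k v.2)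
    rw [ih, map_zero, add_zero]

lemma jetSet_univ : (k : ℕ) → jetSet (univ : Set V) k = univ
  | 0 => rfl
  | k + 1 => by
    ext p
    change p.1 ∈ jetSet univ k ∧ p.2 ∈ tangentConeAt ℝ (jetSet univ k) p.1 ↔ _
    rw [jetSet_univ k, tangentConeAt_univ]; simp

lemma jetBase_mem_nhds {k : ℕ} {U : Set V} (hU : IsOpen U) {ξ : JetSpace V k}
    (h : jetBase k ξ ∈ U) : jetBase k ⁻¹' U ∈ 𝓝 ξ :=
  (hU.preimage (continuous_jetBase k)).mem_nhds h

/-- Jet maps respect the iterated tangent bundles. -/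
lemma jetMap_mem_jetSet {h : V → V} {S S' U : Set V} {n : ℕ} (hU : IsOpen U)
    (hh : ContDiffOn ℝ n h U) (hm : ∀ y ∈ U, y ∈ S → h y ∈ S') :
    ∀ (k : ℕ), k ≤ n → ∀ ξ ∈ jetSet S k, jetBase k ξ ∈ U → jetMap h k ξ ∈ jetSet S' k
  | 0, _, ξ, hξ, hb => hm ξ hb hξ
  | k + 1, hk, p, hp, hb => by
    have ih := jetMap_mem_jetSet hU hh hm k (by omega)
    refine ⟨ih p.1 hp.1 hb, ?_⟩
    have hd : DifferentiableAt ℝ (jetMap h k) p.1 :=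
      differentiableAt_jetMap hk (hh.contDiffAt (hU.mem_nhds hb))
    -- Tangent cones are local, so only the points over `U`, where the induction hypothesis applies,
    -- matter.
    have hv : p.2 ∈ tangentConeAt ℝ (jetSet S k ∩ jetBase k ⁻¹' U) p.1 := by
      rw [tangentConeAt_inter_nhds (jetBase_mem_nhds (k := k) (ξ := p.1) hU hb)]; exact hp.2
    have := hd.hasFDerivAt.hasFDerivWithinAt.mapsTo_tangent_cone hv
    refine tangentConeAt_mono ?_ this
    rintro _ ⟨ζ, hζ, rfl⟩
    exact ih ζ hζ.1 hζ.2

/-- Maps agreeing on `S` have the same jets on the iterated tangent bundles of `S`. -/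
lemma jetMap_eq_of_eqOn {h h' : V → V} {S U : Set V} {n : ℕ} (hU : IsOpen U)
    (hh : ContDiffOn ℝ n h U) (hh' : ContDiffOn ℝ n h' U) (he : ∀ y ∈ U, y ∈ S → h y = h' y) :
    ∀ (k : ℕ), k ≤ n → ∀ ξ ∈ jetSet S k, jetBase k ξ ∈ U → jetMap h k ξ = jetMap h' k ξ
  | 0, _, ξ, hξ, hb => he ξ hb hξ
  | k + 1, hk, p, hp, hb => by
    have ih := jetMap_eq_of_eqOn hU hh hh' he k (by omega)
    refine Prod.ext (ih p.1 hp.1 hb) ?_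
    have hd := differentiableAt_jetMap (ξ := p.1) hk (hh.contDiffAt (hU.mem_nhds hb))
    have hd' := differentiableAt_jetMap (ξ := p.1) hk (hh'.contDiffAt (hU.mem_nhds hb))
    have hv : p.2 ∈ tangentConeAt ℝ (jetSet S k ∩ jetBase k ⁻¹' U) p.1 := by
      rw [tangentConeAt_inter_nhds (jetBase_mem_nhds (k := k) (ξ := p.1) hU hb)]; exact hp.2
    have h1 : HasFDerivWithinAt (jetMap h k) (fderiv ℝ (jetMap h' k) p.1)
        (jetSet S k ∩ jetBase k ⁻¹' U) p.1 :=
      hd'.hasFDerivAt.hasFDerivWithinAt.congr (fun ζ hζ => ih ζ hζ.1 hζ.2) (ih p.1 hp.1 hb)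
    exact hd.hasFDerivAt.hasFDerivWithinAt.unique_on h1 hv

lemma jetMap_id : (k : ℕ) → (ξ : JetSpace V k) → jetMap (id : V → V) k ξ = ξ
  | 0, _ => rfl
  | k + 1, p => by
    have : jetMap (id : V → V) k = id := funext (jetMap_id k)
    change ((jetMap id k p.1, fderiv ℝ (jetMap id k) p.1 p.2) : JetSpace V k × JetSpace V k) = p
    rw [this, fderiv_id]; rfl

lemma jetMap_comp {f g : V → V} {U U' : Set V} {n : ℕ} (hU : IsOpen U) (hU' : IsOpen U')
    (hg : ContDiffOn ℝ n g U) (hf : ContDiffOn ℝ n f U') (hm : MapsTo g U U') :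
    ∀ (k : ℕ), k ≤ n → ∀ ξ : JetSpace V k, jetBase k ξ ∈ U →
      jetMap (f ∘ g) k ξ = jetMap f k (jetMap g k ξ)
  | 0, _, _, _ => rfl
  | k + 1, hk, p, hb => by
    have ih := jetMap_comp hU hU' hg hf hm k (by omega)
    have hb' : jetBase k p.1 ∈ U := hb
    refine Prod.ext (ih p.1 hb) ?_
    have hd := differentiableAt_jetMap (ξ := p.1) hk (hg.contDiffAt (hU.mem_nhds hb))
    have hd' := differentiableAt_jetMap (ξ := jetMap g k p.1) hk (f := f)
      (hf.contDiffAt (by rw [jetBase_jetMap]; exact hU'.mem_nhds (hm hb)))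
    have he : jetMap (f ∘ g) k =ᶠ[𝓝 p.1] jetMap f k ∘ jetMap g k :=
      Filter.mem_of_superset (jetBase_mem_nhds hU hb') fun ζ hζ => ih ζ hζ
    change fderiv ℝ (jetMap (f ∘ g) k) p.1 p.2 = _
    rw [he.fderiv_eq, fderiv_comp _ hd' hd]; rfl

lemma smul_mem_tangentConeAt {S : Set V} {x v : V} (t : ℝ) (h : v ∈ tangentConeAt ℝ S x) :
    t • v ∈ tangentConeAt ℝ S x := by
  obtain ⟨α, l, hl, c, d, hd, hs, hc⟩ := exists_fun_of_mem_tangentConeAt h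
  refine mem_tangentConeAt_of_seq l (fun n => t * c n) d hd hs ?_
  simpa [mul_smul] using hc.const_smul t

lemma jetScale_mem_jetSet {S : Set V} (t : ℝ) : ∀ (k : ℕ), ∀ ξ ∈ jetSet S k,
    jetScale V t k ξ ∈ jetSet S k
  | 0, _, h => h
  | k + 1, p, hp => by
    have ih := jetScale_mem_jetSet (S := S) t k
    refine ⟨ih p.1 hp.1, ?_⟩
    have hd : HasFDerivAt (jetScale V t k : JetSpace V k → JetSpace V k) (jetScale V t k) p.1 :=
      ContinuousLinearMap.hasFDerivAt _
    have hv : p.2 ∈ tangentConeAt ℝ (jetSet S k) p.1 := hp.2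
    have := hd.hasFDerivWithinAt.mapsTo_tangent_cone hv
    refine smul_mem_tangentConeAt t (tangentConeAt_mono ?_ this)
    rintro _ ⟨ζ, hζ, rfl⟩
    exact ih ζ hζ

lemma jetLift_mem_jetSet {S : Set V} {x : V} (hx : x ∈ S) : ∀ k : ℕ, jetLift k x ∈ jetSet S k
  | 0 => hx
  | k + 1 => ⟨jetLift_mem_jetSet hx k, zero_mem_tangentConeAt
      (subset_closure (jetLift_mem_jetSet hx k))⟩

end Jets

/-! ### Tangent spaces of jet bundles through local retractions -/

section Retractions

set_option linter.unusedSectionVars false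

variable {V : Type*} [NormedAddCommGroup V]

/-- `r` is a retraction of class `C^n` of the open set `U` onto `S ∩ U`, up to points of `S` which
may lie outside `U`. -/
structure IsLocalRetraction [NormedSpace ℝ V] (n : ℕ) (r : V → V) (S U : Set V) : Prop where
  isOpen : IsOpen U
  contDiffOn : ContDiffOn ℝ n r U
  mem : ∀ y ∈ U, r y ∈ S
  eq_self : ∀ y ∈ U, y ∈ S → r y = y

section Normed

variable [NormedSpace ℝ V] {n : ℕ} {r : V → V} {S U : Set V}

lemma IsLocalRetraction.contDiffAt (h : IsLocalRetraction n r S U) {x : V} (hx : x ∈ U) :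
    ContDiffAt ℝ n r x := h.contDiffOn.contDiffAt (h.isOpen.mem_nhds hx)

lemma IsLocalRetraction.jetMap_eq_self (h : IsLocalRetraction n r S U) {k : ℕ} (hk : k ≤ n)
    {ξ : JetSpace V k} (hξ : ξ ∈ jetSet S k) (hb : jetBase k ξ ∈ U) : jetMap r k ξ = ξ := by
  rw [jetMap_eq_of_eqOn h.isOpen h.contDiffOn contDiff_id.contDiffOn h.eq_self k hk ξ hξ hb,
    jetMap_id]

lemma IsLocalRetraction.jetMap_mem (h : IsLocalRetraction n r S U) {k : ℕ} (hk : k ≤ n)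
    {ξ : JetSpace V k} (hb : jetBase k ξ ∈ U) : jetMap r k ξ ∈ jetSet S k :=
  jetMap_mem_jetSet h.isOpen h.contDiffOn (S := univ) (fun y hy _ => h.mem y hy) k hk ξ
    (by rw [jetSet_univ]; trivial) hb

lemma IsLocalRetraction.fderiv_mem_tangentConeAt (h : IsLocalRetraction n r S U) {k : ℕ}
    (hk : k + 1 ≤ n) {ξ : JetSpace V k} (hξ : ξ ∈ jetSet S k) (hb : jetBase k ξ ∈ U)
    (v : JetSpace V k) : fderiv ℝ (jetMap r k) ξ v ∈ tangentConeAt ℝ (jetSet S k) ξ := by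
  have := (h.jetMap_mem hk (k := k + 1) (ξ := ((ξ, v) : JetSpace V k × JetSpace V k)) hb).2
  change _ ∈ tangentConeAt ℝ (jetSet S k) (jetMap r k ξ) at this
  rwa [h.jetMap_eq_self (by omega) hξ hb] at this

/-- The pair `(ξ, v)` is a jet of one order higher, and the jet map of a retraction fixes the jets
of `S` and takes all its values in them. In particular the tangent cone is a linear subspace. -/
lemma IsLocalRetraction.mem_tangentConeAt_iff (h : IsLocalRetraction n r S U) {k : ℕ}
    (hk : k + 1 ≤ n) {ξ : JetSpace V k} (hξ : ξ ∈ jetSet S k) (hb : jetBase k ξ ∈ U)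
    {v : JetSpace V k} :
    v ∈ tangentConeAt ℝ (jetSet S k) ξ ↔ fderiv ℝ (jetMap r k) ξ v = v := by
  refine ⟨fun hv => ?_, fun hv => hv ▸ h.fderiv_mem_tangentConeAt hk hξ hb v⟩
  have hm : ((ξ, v) : JetSpace V k × JetSpace V k) ∈ jetSet S (k + 1) := ⟨hξ, hv⟩
  exact congrArg Prod.snd (h.jetMap_eq_self hk (k := k + 1) hm hb)

lemma IsLocalRetraction.mem_tangentSpaceOf_iff (h : IsLocalRetraction n r S U) {k : ℕ}
    (hk : k + 1 ≤ n) {ξ : JetSpace V k} (hξ : ξ ∈ jetSet S k) (hb : jetBase k ξ ∈ U)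
    {v : JetSpace V k} :
    v ∈ tangentSpaceOf (jetSet S k) ξ ↔ fderiv ℝ (jetMap r k) ξ v = v := by
  refine ⟨fun hv => ?_, fun hv =>
    Submodule.subset_span ((h.mem_tangentConeAt_iff hk hξ hb).2 hv)⟩
  have : tangentSpaceOf (jetSet S k) ξ ≤
      LinearMap.eqLocus (fderiv ℝ (jetMap r k) ξ).toLinearMap LinearMap.id :=
    Submodule.span_le.2 fun w hw => (h.mem_tangentConeAt_iff hk hξ hb).1 hw
  exact this hv

lemma IsLocalRetraction.fderiv_mem (h : IsLocalRetraction n r S U) {k : ℕ}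
    (hk : k + 1 ≤ n) {ξ : JetSpace V k} (hξ : ξ ∈ jetSet S k) (hb : jetBase k ξ ∈ U)
    (v : JetSpace V k) : fderiv ℝ (jetMap r k) ξ v ∈ tangentSpaceOf (jetSet S k) ξ :=
  Submodule.subset_span (h.fderiv_mem_tangentConeAt hk hξ hb v)

lemma jetDiag_eq_self_iff (L : V →L[ℝ] V) (B : Submodule ℝ V) (hB : ∀ v, v ∈ B ↔ L v = v) :
    ∀ (k : ℕ) (v : JetSpace V k), v ∈ jetSub B k ↔ jetDiag L k v = v
  | 0, v => hB v
  | k + 1, v => by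
    change v.1 ∈ jetSub B k ∧ v.2 ∈ jetSub B k ↔
      ((jetDiag L k v.1, jetDiag L k v.2) : JetSpace V k × JetSpace V k) = v
    rw [jetDiag_eq_self_iff L B hB k, jetDiag_eq_self_iff L B hB k]
    exact ⟨fun h => Prod.ext h.1 h.2, fun h => ⟨congrArg Prod.fst h, congrArg Prod.snd h⟩⟩

lemma IsLocalRetraction.tangentSpaceOf_jetLift (h : IsLocalRetraction n r S U) {k : ℕ}
    (hk : k + 1 ≤ n) {x : V} (hx : x ∈ S) (hb : x ∈ U) :
    tangentSpaceOf (jetSet S k) (jetLift k x) = jetSub (tangentSpaceOf S x) k := by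
  ext v
  rw [h.mem_tangentSpaceOf_iff hk (jetLift_mem_jetSet hx k) (by rwa [jetBase_jetLift]),
    fderiv_jetMap_jetLift k ((h.contDiffAt hb).of_le (by norm_cast)),
    jetDiag_eq_self_iff (fderiv ℝ r x) (tangentSpaceOf S x) (fun w =>
      h.mem_tangentSpaceOf_iff (k := 0) (by omega) (ξ := x) hx hb)]

/-- Local diffeomorphism germs respect tangent spaces of the iterated tangent bundles. -/
lemma map_tangentSpaceOf_jetSet_le {h : V → V} {S' : Set V} (hU : IsOpen U)
    (hh : ContDiffOn ℝ n h U) (hm : ∀ y ∈ U, y ∈ S → h y ∈ S') {k : ℕ} (hk : k + 1 ≤ n)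
    {ξ : JetSpace V k} (hξ : ξ ∈ jetSet S k) (hb : jetBase k ξ ∈ U) :
    (tangentSpaceOf (jetSet S k) ξ).map (fderiv ℝ (jetMap h k) ξ).toLinearMap ≤
      tangentSpaceOf (jetSet S' k) (jetMap h k ξ) := by
  rw [tangentSpaceOf, Submodule.map_span_le]
  intro v hv
  have hm' : ((ξ, v) : JetSpace V k × JetSpace V k) ∈ jetSet S (k + 1) := ⟨hξ, hv⟩
  exact Submodule.subset_span (jetMap_mem_jetSet hU hh hm (k + 1) hk _ hm' hb).2

end Normed

section Inner

variable [InnerProductSpace ℝ V] [FiniteDimensional ℝ V]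

/-- The local retraction onto a submanifold given by a flattening chart. -/
def chartRetraction (Φ : OpenPartialHomeomorph V V) (A : Submodule ℝ V) (y : V) : V :=
  Φ.symm (A.starProjection (Φ y))

lemma Flattens.isLocalRetraction {n : WithTop ℕ∞} {m : ℕ} (hm : (m : WithTop ℕ∞) ≤ n)
    {Φ : OpenPartialHomeomorph V V} {S : Set V} {x : V} {A : Submodule ℝ V}
    (h : Flattens n Φ S x A) (hx : x ∈ S) :
    x ∈ Φ.source ∩ Φ ⁻¹' (A.starProjection ⁻¹' Φ.target) ∧
    IsLocalRetraction m (chartRetraction Φ A) S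
      (Φ.source ∩ Φ ⁻¹' (A.starProjection ⁻¹' Φ.target)) := by
  -- In the chart the retraction is the orthogonal projection onto `A`; its domain consists of the
  -- points whose projection still lies in the target of the chart.
  have hP : ∀ y ∈ Φ.source, y ∈ S → A.starProjection (Φ y) = Φ y := fun y hy hyS =>
    Submodule.starProjection_eq_self_iff.2 ((h.mem_iff y hy).1 hyS)
  refine ⟨⟨h.mem_source, ?_⟩, ⟨?_, ?_, ?_, ?_⟩⟩
  · simp only [mem_preimage]
    rw [hP x h.mem_source hx]; exact Φ.map_source h.mem_source
  · exact Φ.isOpen_inter_preimage (Φ.open_target.preimage A.starProjection.continuous)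
  · refine ((h.contDiffOn_symm.of_le hm).comp (A.starProjection.contDiff.comp_contDiffOn
      ((h.contDiffOn.of_le hm).mono inter_subset_left)) ?_)
    exact fun y hy => hy.2
  · intro y hy
    refine (h.mem_iff _ (Φ.map_target hy.2)).2 ?_
    rw [Φ.right_inv hy.2]
    exact Submodule.starProjection_apply_mem _ _
  · intro y hy hyS
    change Φ.symm (A.starProjection (Φ y)) = y
    rw [hP y hy.1 hyS, Φ.left_inv hy.1]

/-- This is the chain rule for higher derivatives, the projection having norm at most one. Only
bounds at the single point `x` enter, which is all that a leaf family provides uniformly; `R` serves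
order zero. -/
lemma Flattens.norm_iteratedFDeriv_chartRetraction_le {n : ℕ}
    {Φ : OpenPartialHomeomorph V V} {S : Set V} {x : V} {A : Submodule ℝ V}
    (h : Flattens n Φ S x A) (hx : x ∈ S) {K R : ℝ} (hR : ‖x‖ ≤ R)
    (hK : ∀ j : ℕ, 1 ≤ j → j ≤ n → ‖iteratedFDeriv ℝ j Φ x‖ ≤ K ∧
      ‖iteratedFDeriv ℝ j Φ.symm (Φ x)‖ ≤ K) {j : ℕ} (hj : j ≤ n) :
    ‖iteratedFDeriv ℝ j (chartRetraction Φ A) x‖ ≤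
      j.factorial * max K R * (max K 1) ^ j := by
  obtain ⟨hxU, hr⟩ := h.isLocalRetraction le_rfl hx
  set U := Φ.source ∩ Φ ⁻¹' (A.starProjection ⁻¹' Φ.target)
  have hPx : A.starProjection (Φ x) = Φ x :=
    Submodule.starProjection_eq_self_iff.2 ((h.mem_iff x h.mem_source).1 hx)
  have hjn : (j : WithTop ℕ∞) ≤ n := by exact_mod_cast hj
  have hf : ContDiffOn ℝ n (A.starProjection ∘ Φ) U :=
    A.starProjection.contDiff.comp_contDiffOn (h.contDiffOn.mono inter_subset_left)
  rw [← iteratedFDerivWithin_of_isOpen j hr.isOpen hxU]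
  refine norm_iteratedFDerivWithin_comp_le (g := Φ.symm) (f := A.starProjection ∘ Φ)
    (t := Φ.target) (N := n) h.contDiffOn_symm hf hjn Φ.open_target.uniqueDiffOn
    hr.isOpen.uniqueDiffOn (fun y hy => hy.2) hxU ?_ ?_
  · intro i hi
    rw [Function.comp_apply, hPx,
      iteratedFDerivWithin_of_isOpen i Φ.open_target (Φ.map_source h.mem_source)]
    rcases Nat.eq_zero_or_pos i with rfl | hi0
    · rw [norm_iteratedFDeriv_zero, Φ.left_inv h.mem_source]; exact hR.trans (le_max_right _ _)
    · exact (hK i hi0 (hi.trans hj)).2.trans (le_max_left _ _)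
  · intro i hi0 hi
    have hin : (i : WithTop ℕ∞) ≤ n := by exact_mod_cast hi.trans hj
    have h1 := A.starProjection.norm_iteratedFDerivWithin_comp_left
      ((h.contDiffOn.mono inter_subset_left).contDiffWithinAt hxU) hr.isOpen.uniqueDiffOn hxU hin
    refine h1.trans ?_
    rw [iteratedFDerivWithin_of_isOpen i hr.isOpen hxU]
    calc ‖A.starProjection‖ * ‖iteratedFDeriv ℝ i Φ x‖ ≤ 1 * K :=
          mul_le_mul (Submodule.starProjection_norm_le A) (hK i hi0 (hi.trans hj)).1 (norm_nonneg _)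
            zero_le_one
      _ ≤ max K 1 := by rw [one_mul]; exact le_max_left _ _
      _ ≤ max K 1 ^ i := le_self_pow₀ (le_max_right _ _) (by omega)

end Inner

end Retractions

/-! ### Derivatives of jet maps at jets with bounded velocities -/

section JetBounds

set_option linter.unusedSectionVars false

lemma norm_iteratedFDeriv_snd_le {X : Type*} [NormedAddCommGroup X] [NormedSpace ℝ X]
    {p : X × X} (hp : ‖p.2‖ ≤ 1) : ∀ j : ℕ, ‖iteratedFDeriv ℝ j (Prod.snd : X × X → X) p‖ ≤ 1
  | 0 => by rwa [norm_iteratedFDeriv_zero]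
  | 1 => by
    rw [norm_iteratedFDeriv_one, fderiv_snd]; exact ContinuousLinearMap.norm_snd_le ℝ X X
  | j + 2 => by
    have : fderiv ℝ (Prod.snd : X × X → X) = fun _ => ContinuousLinearMap.snd ℝ X X :=
      funext fun _ => fderiv_snd
    rw [← norm_iteratedFDeriv_fderiv, this, iteratedFDeriv_const_of_ne (by omega)]
    simp

lemma norm_iteratedFDeriv_comp_fst_le {X Y : Type*} [NormedAddCommGroup X] [NormedSpace ℝ X]
    [NormedAddCommGroup Y] [NormedSpace ℝ Y] {F : X → Y} {m : ℕ} {p : X × X}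
    (h : ContDiffAt ℝ m F p.1) :
    ‖iteratedFDeriv ℝ m (fun q : X × X => F q.1) p‖ ≤ ‖iteratedFDeriv ℝ m F p.1‖ := by
  obtain ⟨U, hU, hUo, hx⟩ : ∃ U, ContDiffOn ℝ m F U ∧ IsOpen U ∧ p.1 ∈ U := by
    obtain ⟨u, hu, hc⟩ := h.contDiffOn le_rfl (by simp)
    obtain ⟨U, hUu, hUo, hx⟩ := mem_nhds_iff.1 (by simpa using hu)
    exact ⟨U, hc.mono hUu, hUo, hx⟩
  have hVo : IsOpen ((ContinuousLinearMap.fst ℝ X X) ⁻¹' U) :=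
    hUo.preimage (ContinuousLinearMap.continuous _)
  have := (ContinuousLinearMap.fst ℝ X X).iteratedFDerivWithin_comp_right hU hUo.uniqueDiffOn
    hVo.uniqueDiffOn (x := p) hx (i := m) le_rfl
  rw [iteratedFDerivWithin_of_isOpen m hVo (x := p) hx,
    iteratedFDerivWithin_of_isOpen m hUo
      (x := ContinuousLinearMap.fst ℝ X X p) hx] at this
  change ‖iteratedFDeriv ℝ m (F ∘ (ContinuousLinearMap.fst ℝ X X)) p‖ ≤ _
  rw [this]
  refine (ContinuousMultilinearMap.norm_compContinuousLinearMap_le _ _).trans ?_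
  refine mul_le_of_le_one_right (norm_nonneg _) ?_
  exact Finset.prod_le_one (fun _ _ => norm_nonneg _)
    fun _ _ => ContinuousLinearMap.norm_fst_le ℝ X X

/-- By the Leibniz rule for the product of `DF` with the velocity: the velocity and all its
derivatives have norm at most one, and the binomial coefficients add up to `2 ^ m`. -/
lemma norm_iteratedFDeriv_tangentMap_le {X : Type*} [NormedAddCommGroup X] [NormedSpace ℝ X]
    {F : X → X} {m : ℕ} (hm : 1 ≤ m) {p : X × X} (h : ContDiffAt ℝ (m + 1 : ℕ) F p.1)
    (hp : ‖p.2‖ ≤ 1) {C : ℝ}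
    (hC : ∀ j : ℕ, 1 ≤ j → j ≤ m + 1 → ‖iteratedFDeriv ℝ j F p.1‖ ≤ C) :
    ‖iteratedFDeriv ℝ m (fun p : X × X => (F p.1, fderiv ℝ F p.1 p.2)) p‖ ≤ 2 ^ m * C := by
  have h0 : ContDiffAt ℝ m F p.1 := h.of_le (by norm_cast; omega)
  have h1 : ContDiffAt ℝ m (fderiv ℝ F) p.1 := h.fderiv_right (by norm_cast)
  have hA : ContDiffAt ℝ m (fun q : X × X => F q.1) p := h0.comp p contDiffAt_fst
  have hD : ContDiffAt ℝ m (fun q : X × X => fderiv ℝ F q.1) p := h1.comp p contDiffAt_fst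
  have hB : ContDiffAt ℝ m (fun q : X × X => fderiv ℝ F q.1 q.2) p := hD.clm_apply contDiffAt_snd
  have hC0 : 0 ≤ C := (norm_nonneg _).trans (hC 1 le_rfl (by omega))
  rw [iteratedFDeriv_prodMk hA hB le_rfl, ContinuousMultilinearMap.opNorm_prod]
  refine max_le ?_ ?_
  · refine (norm_iteratedFDeriv_comp_fst_le h0).trans ((hC m hm (by omega)).trans ?_)
    exact le_mul_of_one_le_left hC0 (one_le_pow₀ (by norm_num))
  · obtain ⟨U, hU, hUo, hx⟩ : ∃ U, ContDiffOn ℝ m (fun q : X × X => fderiv ℝ F q.1) U ∧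
        IsOpen U ∧ p ∈ U := by
      obtain ⟨u, hu, hc⟩ := hD.contDiffOn le_rfl (by simp)
      obtain ⟨U, hUu, hUo, hx⟩ := mem_nhds_iff.1 (by simpa using hu)
      exact ⟨U, hc.mono hUu, hUo, hx⟩
    rw [← iteratedFDerivWithin_of_isOpen m hUo hx]
    refine (norm_iteratedFDerivWithin_clm_apply hU (contDiff_snd.contDiffOn (n := m))
      hUo.uniqueDiffOn hx le_rfl).trans ?_
    calc _ ≤ ∑ i ∈ Finset.range (m + 1), (m.choose i : ℝ) * C := by
          refine Finset.sum_le_sum fun i hi => ?_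
          have him : i ≤ m := by simpa [Nat.lt_succ_iff] using hi
          rw [iteratedFDerivWithin_of_isOpen i hUo hx,
            iteratedFDerivWithin_of_isOpen (m - i) hUo hx, mul_assoc]
          refine mul_le_mul_of_nonneg_left ?_ (Nat.cast_nonneg _)
          have e1 : ‖iteratedFDeriv ℝ i (fun q : X × X => fderiv ℝ F q.1) p‖ ≤ C := by
            refine (norm_iteratedFDeriv_comp_fst_le (h1.of_le (by exact_mod_cast him))).trans ?_
            rw [norm_iteratedFDeriv_fderiv]; exact hC (i + 1) (by omega) (by omega)
          have e2 := norm_iteratedFDeriv_snd_le hp (m - i)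
          calc _ ≤ C * 1 := mul_le_mul e1 e2 (norm_nonneg _) hC0
            _ = C := mul_one C
      _ = 2 ^ m * C := by
          rw [← Finset.sum_mul, ← Nat.cast_sum, Nat.sum_range_choose]; simp

variable {V : Type*} [NormedAddCommGroup V] [NormedSpace ℝ V]

/-- All velocities of the jet have norm at most `τ`. -/
def VelocitiesLE (τ : ℝ) : (k : ℕ) → JetSpace V k → Prop
  | 0, _ => True
  | k + 1, p => VelocitiesLE τ k p.1 ∧ ‖p.2‖ ≤ τ

lemma VelocitiesLE.mono {τ τ' : ℝ} (h : τ ≤ τ') : ∀ {k : ℕ} {p : JetSpace V k},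
    VelocitiesLE τ k p → VelocitiesLE τ' k p
  | 0, _, _ => trivial
  | _ + 1, _, hp => ⟨hp.1.mono h, hp.2.trans h⟩

lemma VelocitiesLeOne.velocitiesLE : ∀ {k : ℕ} {p : JetSpace V k},
    VelocitiesLeOne k p → VelocitiesLE 1 k p
  | 0, _, _ => trivial
  | _ + 1, _, hp => ⟨VelocitiesLeOne.velocitiesLE hp.1, hp.2⟩

lemma VelocitiesLE.norm_sub_jetLift_le {τ : ℝ} (hτ : 0 ≤ τ) : ∀ {k : ℕ} {p : JetSpace V k},
    VelocitiesLE τ k p → ‖p - jetLift k (jetBase k p)‖ ≤ τ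
  | 0, p, _ => by
    change ‖p - p‖ ≤ τ
    rwa [sub_self, norm_zero]
  | k + 1, p, hp => by
    change max ‖p.1 - jetLift k (jetBase k p.1)‖ ‖p.2 - 0‖ ≤ τ
    rw [sub_zero]
    exact max_le (VelocitiesLE.norm_sub_jetLift_le hτ hp.1) hp.2

/-- Each further level of the jet map uses up one derivative and costs a factor `2 ^ m`. -/
lemma norm_iteratedFDeriv_jetMap_le {r : V → V} {K : ℝ} : ∀ (k m : ℕ), 1 ≤ m →
    ∀ ζ : JetSpace V k, VelocitiesLE 1 k ζ → ContDiffAt ℝ (m + k : ℕ) r (jetBase k ζ) →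
    (∀ j : ℕ, 1 ≤ j → j ≤ m + k → ‖iteratedFDeriv ℝ j r (jetBase k ζ)‖ ≤ K) →
    ‖iteratedFDeriv ℝ m (jetMap r k) ζ‖ ≤ 2 ^ ((m + k) * k) * K
  | 0, m, hm, ζ, _, _, hK => by
    rw [mul_zero, pow_zero, one_mul]; exact hK m hm (by omega)
  | k + 1, m, hm, p, hp, hc, hK => by
    have hK0 : 0 ≤ K := (norm_nonneg _).trans (hK 1 le_rfl (by omega))
    have hb : ∀ j : ℕ, 1 ≤ j → j ≤ m + 1 →
        ‖iteratedFDeriv ℝ j (jetMap r k) p.1‖ ≤ 2 ^ ((m + 1 + k) * k) * K := by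
      intro j hj hjm
      refine (norm_iteratedFDeriv_jetMap_le k j hj p.1 hp.1
        (ContDiffAt.of_le hc (by norm_cast; omega))
        fun i hi hi' => hK i hi (by omega)).trans ?_
      refine mul_le_mul_of_nonneg_right (pow_le_pow_right₀ (by norm_num) ?_) hK0
      gcongr
    have hF : ContDiffAt ℝ (m + 1 : ℕ) (jetMap r k) p.1 :=
      contDiffAt_jetMap k (m + 1) p.1 (by rw [show m + 1 + k = m + (k + 1) by ring]; exact hc)
    refine (norm_iteratedFDeriv_tangentMap_le (F := jetMap r k) (p := p) hm hF hp.2 hb).trans ?_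
    rw [← mul_assoc, ← pow_add]
    refine mul_le_mul_of_nonneg_right (pow_le_pow_right₀ (by norm_num) ?_) hK0
    nlinarith

lemma norm_fderiv_fderiv_jetMap_le {r : V → V} {K : ℝ} {k : ℕ} {ζ : JetSpace V k}
    (hζ : VelocitiesLE 1 k ζ) (hr : ContDiffAt ℝ (k + 2 : ℕ) r (jetBase k ζ))
    (hK : ∀ j : ℕ, 1 ≤ j → j ≤ k + 2 → ‖iteratedFDeriv ℝ j r (jetBase k ζ)‖ ≤ K) :
    ‖fderiv ℝ (fderiv ℝ (jetMap r k)) ζ‖ ≤ 2 ^ ((2 + k) * k) * K := by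
  have := norm_iteratedFDeriv_jetMap_le k 2 (by norm_num) ζ hζ (by rwa [add_comm])
    (fun j hj hj' => hK j hj (by omega))
  rwa [← norm_iteratedFDeriv_fderiv, norm_iteratedFDeriv_one] at this

/-- The derivative of the jet map of `r` at a jet with small velocities is close to the one
at the zero jet. -/
lemma norm_fderiv_jetMap_sub_le {r : V → V} {K τ : ℝ} (hτ0 : 0 ≤ τ) (hτ : τ ≤ 1) {x : V} :
    ∀ (k : ℕ) (ζ : JetSpace V k), VelocitiesLE τ k ζ → jetBase k ζ = x →
    ContDiffAt ℝ (k + 1 : ℕ) r x →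
    (∀ j : ℕ, 1 ≤ j → j ≤ k + 1 → ‖iteratedFDeriv ℝ j r x‖ ≤ K) →
    ‖fderiv ℝ (jetMap r k) ζ - fderiv ℝ (jetMap r k) (jetLift k x)‖ ≤
      k * 2 ^ ((k + 2) * (k + 2)) * K * τ
  | 0, ζ, _, hb, _, _ => by
    change ‖fderiv ℝ r ζ - fderiv ℝ r x‖ ≤ _
    rw [show ζ = x from hb]; simp
  | k + 1, p, hp, hb, hr, hK => by
    have hb' : jetBase k p.1 = x := hb
    have hK0 : 0 ≤ K := (norm_nonneg _).trans (hK 1 le_rfl (by omega))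
    have ih := norm_fderiv_jetMap_sub_le hτ0 hτ k p.1 hp.1 hb
      (hr.of_le (by norm_cast; omega)) fun j hj hj' => hK j hj (by omega)
    have h2 := norm_fderiv_fderiv_jetMap_le (r := r) (K := K) (k := k) (ζ := p.1)
      (hp.1.mono hτ) (by rw [hb']; exact hr) (by rw [hb']; exact hK)
    -- `a` bounds the change of the derivative one level below; `c * τ` bounds the new
    -- second-derivative term, which carries the velocity `p.2` as a factor and vanishes at the zero
    -- jet.
    set a := (k : ℝ) * 2 ^ ((k + 2) * (k + 2)) * K * τ
    set c : ℝ := 2 ^ ((2 + k) * k) * K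
    have ha0 : 0 ≤ a := by positivity
    have hc0 : 0 ≤ c := by positivity
    have hle : a + c * τ ≤ ((k + 1 : ℕ) : ℝ) * 2 ^ ((k + 1 + 2) * (k + 1 + 2)) * K * τ := by
      have e1 : (2 : ℝ) ^ ((k + 2) * (k + 2)) ≤ 2 ^ ((k + 1 + 2) * (k + 1 + 2)) :=
        pow_le_pow_right₀ (by norm_num) (by nlinarith)
      have e2 : (2 : ℝ) ^ ((2 + k) * k) ≤ 2 ^ ((k + 1 + 2) * (k + 1 + 2)) :=
        pow_le_pow_right₀ (by norm_num) (by nlinarith)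
      have hKτ : 0 ≤ K * τ := by positivity
      calc a + c * τ = (k * 2 ^ ((k + 2) * (k + 2)) + 2 ^ ((2 + k) * k)) * (K * τ) := by
            simp only [a, c]; ring
        _ ≤ (k * 2 ^ ((k + 1 + 2) * (k + 1 + 2)) + 2 ^ ((k + 1 + 2) * (k + 1 + 2))) * (K * τ) := by
            gcongr
        _ = _ := by push_cast; ring
    refine le_trans ?_ hle
    refine ContinuousLinearMap.opNorm_le_bound _ (by positivity) fun v => ?_
    rw [sub_apply,
      fderiv_jetMap_succ (f := r) (p := p) (by rw [hb]; exact hr) v,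
      fderiv_jetMap_succ (f := r) (p := jetLift (k + 1) x) (by rw [jetBase_jetLift]; exact hr) v]
    have hv1 : ‖v.1‖ ≤ ‖v‖ := le_max_left _ _
    have hv2 : ‖v.2‖ ≤ ‖v‖ := le_max_right _ _
    have ea : ∀ w, ‖fderiv ℝ (jetMap r k) p.1 w - fderiv ℝ (jetMap r k) (jetLift k x) w‖ ≤
        a * ‖w‖ := fun w => by
      rw [← sub_apply]
      exact (ContinuousLinearMap.le_opNorm _ _).trans
        (mul_le_mul_of_nonneg_right ih (norm_nonneg _))
    change max ‖fderiv ℝ (jetMap r k) p.1 v.1 - fderiv ℝ (jetMap r k) (jetLift k x) v.1‖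
      ‖(fderiv ℝ (jetMap r k) p.1 v.2 + fderiv ℝ (fderiv ℝ (jetMap r k)) p.1 v.1 p.2) -
        (fderiv ℝ (jetMap r k) (jetLift k x) v.2 +
          fderiv ℝ (fderiv ℝ (jetMap r k)) (jetLift k x) v.1 0)‖ ≤ (a + c * τ) * ‖v‖
    have hq : ‖fderiv ℝ (fderiv ℝ (jetMap r k)) p.1 v.1 p.2‖ ≤ c * ‖v‖ * τ := by
      refine (ContinuousLinearMap.le_opNorm₂ _ _ _).trans ?_
      have := hp.2
      gcongr
    refine max_le ?_ ?_
    · calc _ ≤ a * ‖v.1‖ := ea v.1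
        _ ≤ (a + c * τ) * ‖v‖ := by gcongr; nlinarith
    · rw [map_zero, add_zero, add_sub_right_comm]
      calc _ ≤ a * ‖v.2‖ + c * ‖v‖ * τ := (norm_add_le _ _).trans (add_le_add (ea v.2) hq)
        _ ≤ a * ‖v‖ + c * ‖v‖ * τ := by gcongr
        _ = _ := by ring

end JetBounds

/-! ### Perturbation of subspaces and of expansion on quotients -/

section Gaps

variable {X : Type*} [NormedAddCommGroup X] [NormedSpace ℝ X]

/-- Every vector of `A` is approximated by a vector of `B` up to a relative error `ε`. -/
def GapLE (A B : Submodule ℝ X) (ε : ℝ) : Prop := ∀ v ∈ A, ∃ w ∈ B, ‖v - w‖ ≤ ε * ‖v‖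

/-- Subspaces given as the fixed spaces of projections are close when the projections are. -/
lemma gapLE_of_norm_sub_le {A B : Submodule ℝ X} {P Q : X →L[ℝ] X} {ε : ℝ}
    (hA : ∀ v ∈ A, P v = v) (hB : ∀ v, Q v ∈ B) (h : ‖P - Q‖ ≤ ε) : GapLE A B ε := fun v hv => by
  refine ⟨Q v, hB v, ?_⟩
  calc ‖v - Q v‖ = ‖(P - Q) v‖ := by rw [sub_apply, hA v hv]
    _ ≤ ε * ‖v‖ := (ContinuousLinearMap.le_opNorm _ _).trans
        (mul_le_mul_of_nonneg_right h (norm_nonneg _))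

lemma exists_norm_sub_le_forall [FiniteDimensional ℝ X] (E : Submodule ℝ X) (u : X) :
    ∃ e ∈ E, ∀ e' ∈ E, ‖u - e‖ ≤ ‖u - e'‖ := by
  have : ProperSpace X := FiniteDimensional.proper_real X
  have hc : IsClosed (E : Set X) := E.closed_of_finiteDimensional
  obtain ⟨e, he, hd⟩ := hc.exists_infDist_eq_dist ⟨0, E.zero_mem⟩ u
  refine ⟨e, he, fun e' he' => ?_⟩
  rw [← dist_eq_norm, ← dist_eq_norm, ← hd]
  exact Metric.infDist_le_dist_of_mem he'

/-- Lower bounds for the map induced on quotient spaces persist under small perturbations. -/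
lemma quotient_lower_bound_of_perturbation [FiniteDimensional ℝ X] {L L0 : X →L[ℝ] X}
    {A A0 E E0 E' E0' : Submodule ℝ X} {m m' D ε : ℝ} (hL : ‖L0 - L‖ ≤ ε) (hD : ‖L‖ ≤ D)
    (hD0 : ‖L0‖ ≤ D) (gA : GapLE A A0 ε) (gE : GapLE E0 E ε) (gE' : GapLE E' E0' ε)
    (hEA : E ≤ A) (hLE : ∀ e ∈ E, L e ∈ E')
    (h0 : ∀ u ∈ A0, ∀ e' ∈ E0', ∃ e ∈ E0, m' * ‖u - e‖ ≤ ‖L0 u - e'‖)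
    (hε0 : 0 ≤ ε) (hε1 : ε ≤ 1) (hm' : 0 ≤ m')
    (hm : m * (1 + ε) ^ 2 ≤ m' * (1 - 3 * ε) - 2 * ε * (2 * D + 1)) :
    ∀ u ∈ A, ∀ e' ∈ E', ∃ e ∈ E, m * ‖u - e‖ ≤ ‖L u - e'‖ := by
  intro u hu e' he'
  -- With `e` nearest to `u`, the vector `t = u - e` realises the quotient norm. It is moved to
  -- `A0`, the unperturbed estimate is applied there, and the resulting vector of `E0` is moved back
  -- to `E`.
  obtain ⟨e, he, hmin⟩ := exists_norm_sub_le_forall E u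
  refine ⟨e, he, ?_⟩
  have hDn : 0 ≤ D := (norm_nonneg _).trans hD
  set t := u - e with ht
  have htA : t ∈ A := A.sub_mem hu (hEA he)
  obtain ⟨t0, ht0, h1⟩ := gA t htA
  set e2 := e' - L e with he2
  have hy : L u - e' = L t - e2 := by rw [ht, he2, map_sub]; abel
  rw [hy]
  set y := L t - e2 with hydef
  obtain ⟨e3, he3, h2⟩ := gE' e2 (E'.sub_mem he' (hLE e he))
  obtain ⟨e0, he0, h3⟩ := h0 t0 ht0 e3 he3
  obtain ⟨e1, he1, h4⟩ := gE e0 he0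
  have i1 : ‖e2‖ ≤ ‖y‖ + D * ‖t‖ := by
    have : e2 = L t - y := by rw [hydef]; abel
    rw [this]
    have := (norm_sub_le (L t) y).trans (add_le_add_left (L.le_of_opNorm_le hD t) _)
    linarith
  have i2 : ‖L0 t0 - e3‖ ≤ (1 + ε) * ‖y‖ + ε * (2 * D + 1) * ‖t‖ := by
    have e : L0 t0 - e3 = L0 (t0 - t) + (L0 - L) t + y + (e2 - e3) := by
      rw [hydef, map_sub, sub_apply]; abel
    rw [e]
    have n1 : ‖L0 (t0 - t)‖ ≤ D * (ε * ‖t‖) := by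
      refine (L0.le_of_opNorm_le hD0 _).trans ?_
      rw [norm_sub_rev]; gcongr
    have n2 : ‖(L0 - L) t‖ ≤ ε * ‖t‖ := (L0 - L).le_of_opNorm_le hL t
    have n3 : ‖e2 - e3‖ ≤ ε * (‖y‖ + D * ‖t‖) := h2.trans (by gcongr)
    have n4 := norm_add_le (L0 (t0 - t) + (L0 - L) t + y) (e2 - e3)
    have n5 := norm_add_le (L0 (t0 - t) + (L0 - L) t) y
    have n6 := norm_add_le (L0 (t0 - t)) ((L0 - L) t)
    nlinarith
  have i3 : ‖t‖ ≤ ‖t - e1‖ := by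
    have := hmin (e + e1) (E.add_mem he he1)
    rwa [← sub_sub] at this
  have i4 : ‖t - e1‖ ≤ ‖t - t0‖ + ‖t0 - e0‖ + ‖e0 - e1‖ := by
    have : t - e1 = (t - t0) + (t0 - e0) + (e0 - e1) := by abel
    rw [this]; exact norm_add₃_le
  have i5 : ‖e0‖ ≤ ‖t0 - e0‖ + (1 + ε) * ‖t‖ := by
    have a1 : ‖t0‖ ≤ (1 + ε) * ‖t‖ := by
      have : t0 = t - (t - t0) := by abel
      have := norm_sub_le t (t - t0)
      rw [sub_sub_cancel] at this
      linarith
    have : e0 = t0 - (t0 - e0) := by abel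
    have := norm_sub_le t0 (t0 - e0)
    rw [sub_sub_cancel] at this
    linarith
  have hs : (1 - 3 * ε) * ‖t‖ ≤ (1 + ε) * ‖t0 - e0‖ := by
    have a2 : ε * ‖e0‖ ≤ ε * (‖t0 - e0‖ + (1 + ε) * ‖t‖) := by gcongr
    have a3 : ε * ε * ‖t‖ ≤ ε * ‖t‖ := by
      have : ε * ε ≤ ε * 1 := by gcongr
      rw [mul_one] at this; gcongr
    nlinarith
  have hs2 : m' * (1 - 3 * ε) * ‖t‖ ≤ (1 + ε) * ((1 + ε) * ‖y‖ + ε * (2 * D + 1) * ‖t‖) := by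
    calc m' * (1 - 3 * ε) * ‖t‖ = m' * ((1 - 3 * ε) * ‖t‖) := by ring
      _ ≤ m' * ((1 + ε) * ‖t0 - e0‖) := by gcongr
      _ = (1 + ε) * (m' * ‖t0 - e0‖) := by ring
      _ ≤ _ := by
        have := h3.trans i2
        gcongr
  have hs3 : (1 + ε) * (ε * (2 * D + 1) * ‖t‖) ≤ 2 * (ε * (2 * D + 1) * ‖t‖) := by
    gcongr; linarith
  have hs4 := mul_le_mul_of_nonneg_right hm (norm_nonneg t)
  have : (1 + ε) ^ 2 * (m * ‖t‖) ≤ (1 + ε) ^ 2 * ‖y‖ := by nlinarith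
  exact le_of_mul_le_mul_left this (by positivity)

/-- At `ε = 0` the last inequality reads `m ≤ m'`, strict by assumption, so it persists for small
`ε` by continuity. -/
lemma exists_perturbation_size {m m' : ℝ} (hm : m < m') (D δ : ℝ) (hδ : 0 < δ) : ∃ ε : ℝ, 0 < ε ∧
    ε ≤ 1 ∧ ε ≤ δ ∧ m * (1 + ε) ^ 2 ≤ m' * (1 - 3 * ε) - 2 * ε * (2 * D + 1) := by
  have hc : Continuous fun ε : ℝ =>
      m' * (1 - 3 * ε) - 2 * ε * (2 * D + 1) - m * (1 + ε) ^ 2 := by fun_prop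
  have h0 : ∀ᶠ ε in 𝓝[>] (0 : ℝ),
      0 < m' * (1 - 3 * ε) - 2 * ε * (2 * D + 1) - m * (1 + ε) ^ 2 := by
    refine (hc.tendsto 0).eventually_const_lt ?_ |>.filter_mono nhdsWithin_le_nhds
    norm_num; exact hm
  have h1 : ∀ᶠ ε in 𝓝[>] (0 : ℝ), ε < min 1 δ :=
    (eventually_lt_nhds (by positivity)).filter_mono nhdsWithin_le_nhds
  obtain ⟨ε, ⟨a, b⟩, c⟩ := ((h0.and h1).and self_mem_nhdsWithin).exists
  exact ⟨ε, c, (b.trans_le (min_le_left _ _)).le, (b.trans_le (min_le_right _ _)).le, by linarith⟩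

end Gaps

/-! ### Uniform constants from finiteness and compactness -/

section Uniformity

lemma exists_pos_forall_le {P : ℕ → ℝ → Prop} {k : ℕ}
    (anti : ∀ j τ τ', 0 < τ' → τ' ≤ τ → P j τ → P j τ')
    (h : ∀ j ≤ k, ∃ τ, 0 < τ ∧ P j τ) : ∃ τ, 0 < τ ∧ ∀ j ≤ k, P j τ := by
  induction k with
  | zero =>
    obtain ⟨τ, h0, h1⟩ := h 0 le_rfl
    exact ⟨τ, h0, fun j hj => by obtain rfl : j = 0 := by omega
                                 exact h1⟩
  | succ k ih =>
    obtain ⟨τ, h0, h1⟩ := ih fun j hj => h j (by omega)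
    obtain ⟨τ', h0', h1'⟩ := h (k + 1) le_rfl
    refine ⟨min τ τ', lt_min h0 h0', fun j hj => ?_⟩
    rcases Nat.lt_or_ge j (k + 1) with hlt | hge
    · exact anti j _ _ (lt_min h0 h0') (min_le_left _ _) (h1 j (by omega))
    · obtain rfl : j = k + 1 := by omega
      exact anti _ _ _ (lt_min h0 h0') (min_le_right _ _) h1'

lemma IsCompact.exists_uniform_radius_bound {V : Type*} [PseudoMetricSpace V] {Λ : Set V}
    (hΛ : IsCompact Λ) {P : V → ℝ → ℝ → Prop}
    (mono : ∀ x τ τ' K K', 0 < τ' → τ' ≤ τ → K ≤ K' → P x τ K → P x τ' K')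
    (h : ∀ x₀ ∈ Λ, ∃ τ K, 0 < τ ∧ ∀ x ∈ Metric.ball x₀ τ, P x τ K) :
    ∃ τ K, 0 < τ ∧ 0 ≤ K ∧ ∀ x ∈ Λ, P x τ K := by
  refine hΛ.induction_on (p := fun s => ∃ τ K, 0 < τ ∧ 0 ≤ K ∧ ∀ x ∈ s, P x τ K) ?_ ?_ ?_ ?_
  · exact ⟨1, 0, one_pos, le_rfl, fun _ h => h.elim⟩
  · rintro s t hst ⟨τ, K, h0, h1, h2⟩
    exact ⟨τ, K, h0, h1, fun x hx => h2 x (hst hx)⟩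
  · rintro s t ⟨τ, K, h0, h1, h2⟩ ⟨τ', K', h0', h1', h2'⟩
    refine ⟨min τ τ', max K K', lt_min h0 h0', h1.trans (le_max_left _ _), ?_⟩
    rintro x (hx | hx)
    · exact mono _ _ _ _ _ (lt_min h0 h0') (min_le_left _ _) (le_max_left _ _) (h2 x hx)
    · exact mono _ _ _ _ _ (lt_min h0 h0') (min_le_right _ _) (le_max_right _ _) (h2' x hx)
  · intro x₀ hx₀
    obtain ⟨τ, K, h0, h1⟩ := h x₀ hx₀
    refine ⟨Metric.ball x₀ τ, mem_nhdsWithin_of_mem_nhds (Metric.ball_mem_nhds _ h0), τ, max K 0,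
      h0, le_max_right _ _, fun x hx => mono _ _ _ _ _ h0 le_rfl (le_max_left _ _) (h1 x hx)⟩

end Uniformity

/-! ### Norms of rescaled and diagonal maps on jets -/

section JetLinear

variable {V : Type*} [NormedAddCommGroup V] [NormedSpace ℝ V]

set_option linter.unusedSectionVars false

lemma norm_jetBase_sub_le : ∀ (k : ℕ) (p q : JetSpace V k),
    ‖jetBase k p - jetBase k q‖ ≤ ‖p - q‖
  | 0, _, _ => le_rfl
  | k + 1, p, q => (norm_jetBase_sub_le k p.1 q.1).trans (le_max_left _ _)

lemma norm_jetLift_sub_jetLift (x y : V) : ∀ k : ℕ, ‖jetLift k x - jetLift k y‖ = ‖x - y‖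
  | 0 => rfl
  | k + 1 => by
    change max ‖jetLift k x - jetLift k y‖ ‖(0 : JetSpace V k) - 0‖ = _
    rw [norm_jetLift_sub_jetLift x y k, sub_zero, norm_zero, max_eq_left (norm_nonneg _)]

lemma norm_jetScale_le {t : ℝ} (h0 : 0 ≤ t) (h1 : t ≤ 1) : ∀ (k : ℕ) (p : JetSpace V k),
    ‖jetScale V t k p‖ ≤ ‖p‖
  | 0, _ => le_rfl
  | k + 1, p => by
    change max ‖jetScale V t k p.1‖ ‖t • jetScale V t k p.2‖ ≤ max ‖p.1‖ ‖p.2‖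
    refine max_le_max (norm_jetScale_le h0 h1 k p.1) ?_
    rw [norm_smul, Real.norm_of_nonneg h0]
    exact (mul_le_of_le_one_left (norm_nonneg _) h1).trans (norm_jetScale_le h0 h1 k p.2)

lemma le_norm_jetScale {t : ℝ} (h0 : 0 ≤ t) (h1 : t ≤ 1) : ∀ (k : ℕ) (p : JetSpace V k),
    t ^ k * ‖p‖ ≤ ‖jetScale V t k p‖
  | 0, p => by rw [pow_zero, one_mul]; exact le_rfl
  | k + 1, p => by
    change t ^ (k + 1) * max ‖p.1‖ ‖p.2‖ ≤ max ‖jetScale V t k p.1‖ ‖t • jetScale V t k p.2‖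
    rw [mul_max_of_nonneg _ _ (by positivity), norm_smul, Real.norm_of_nonneg h0, pow_succ']
    refine max_le_max ?_ ?_
    · rw [mul_assoc]
      exact (mul_le_of_le_one_left (by positivity) h1).trans (le_norm_jetScale h0 h1 k p.1)
    · rw [mul_assoc]
      exact mul_le_mul_of_nonneg_left (le_norm_jetScale h0 h1 k p.2) h0

lemma VelocitiesLE.jetScale {τ t : ℝ} (h0 : 0 ≤ t) (h1 : t ≤ 1) : ∀ {k : ℕ} {p : JetSpace V k},
    VelocitiesLE τ k p → VelocitiesLE (t * τ) k (jetScale V t k p)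
  | 0, _, _ => trivial
  | k + 1, p, hp => by
    refine ⟨VelocitiesLE.jetScale h0 h1 hp.1, ?_⟩
    change ‖t • _root_.jetScale V t k p.2‖ ≤ t * τ
    rw [norm_smul, Real.norm_of_nonneg h0]
    exact mul_le_mul_of_nonneg_left ((norm_jetScale_le h0 h1 k p.2).trans hp.2) h0

lemma jetScale_jetScale_inv {t : ℝ} (ht : t ≠ 0) : ∀ (k : ℕ) (p : JetSpace V k),
    jetScale V t k (jetScale V t⁻¹ k p) = p
  | 0, _ => rfl
  | k + 1, p => by
    refine Prod.ext (jetScale_jetScale_inv ht k p.1) ?_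
    change t • jetScale V t k (t⁻¹ • jetScale V t⁻¹ k p.2) = p.2
    rw [ContinuousLinearMap.map_smul, smul_inv_smul₀ ht, jetScale_jetScale_inv ht k p.2]

lemma norm_jetDiag_le {L : V →L[ℝ] V} {B : Submodule ℝ V} {c : ℝ} (hc : 0 ≤ c)
    (h : ∀ v ∈ B, ‖L v‖ ≤ c * ‖v‖) : ∀ (k : ℕ), ∀ p ∈ jetSub B k, ‖jetDiag L k p‖ ≤ c * ‖p‖
  | 0, p, hp => h p hp
  | k + 1, p, hp => by
    change max ‖jetDiag L k p.1‖ ‖jetDiag L k p.2‖ ≤ c * max ‖p.1‖ ‖p.2‖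
    rw [mul_max_of_nonneg _ _ hc]
    exact max_le_max (norm_jetDiag_le hc h k p.1 hp.1) (norm_jetDiag_le hc h k p.2 hp.2)

lemma jetSub_top : ∀ k : ℕ, jetSub (⊤ : Submodule ℝ V) k = ⊤
  | 0 => rfl
  | k + 1 => by
    change (jetSub (⊤ : Submodule ℝ V) k).prod (jetSub (⊤ : Submodule ℝ V) k) = ⊤
    rw [jetSub_top k, Submodule.prod_top]

lemma opNorm_jetDiag_le (L : V →L[ℝ] V) (k : ℕ) : ‖jetDiag L k‖ ≤ ‖L‖ :=
  ContinuousLinearMap.opNorm_le_bound _ (norm_nonneg _) fun p =>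
    norm_jetDiag_le (B := ⊤) (norm_nonneg L) (fun v _ => L.le_opNorm v) k p
      (by rw [jetSub_top]; trivial)

/-- The hypothesis is a lower bound `m` for the map induced by `L` from `A / E` modulo `E'`. On jets
it holds component by component, and the rescaling shrinks a component by at most `t ^ k`. -/
lemma jetDiag_quotient_lower_bound {L : V →L[ℝ] V} {A E E' : Submodule ℝ V} {t m : ℝ}
    (ht0 : 0 < t) (ht1 : t ≤ 1) (hm : 0 ≤ m)
    (h : ∀ u ∈ A, ∀ e' ∈ E', ∃ e ∈ E, m * ‖u - e‖ ≤ ‖L u - e'‖) :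
    ∀ (k : ℕ), ∀ u ∈ jetSub A k, ∀ e' ∈ jetSub E' k, ∃ e ∈ jetSub E k,
      m * t ^ k * ‖u - e‖ ≤ ‖jetScale V t k (jetDiag L k u) - e'‖
  | 0, u, hu, e', he' => by
    obtain ⟨e, he, h1⟩ := h u hu e' he'
    exact ⟨e, he, by rw [pow_zero, mul_one]; exact h1⟩
  | k + 1, u, hu, e', he' => by
    obtain ⟨e1, he1, h1⟩ := jetDiag_quotient_lower_bound ht0 ht1 hm h k u.1 hu.1 e'.1 he'.1
    -- The comparison vector is divided by `t` so that the factor `t` of the second component can be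
    -- pulled out.
    obtain ⟨e2, he2, h2⟩ := jetDiag_quotient_lower_bound ht0 ht1 hm h k u.2 hu.2 (t⁻¹ • e'.2)
      ((jetSub E' k).smul_mem _ he'.2)
    refine ⟨((e1, e2) : JetSpace V k × JetSpace V k), ⟨he1, he2⟩, ?_⟩
    change m * t ^ (k + 1) * max ‖u.1 - e1‖ ‖u.2 - e2‖ ≤
      max ‖jetScale V t k (jetDiag L k u.1) - e'.1‖ ‖t • jetScale V t k (jetDiag L k u.2) - e'.2‖
    rw [mul_max_of_nonneg _ _ (by positivity)]
    refine max_le_max (le_trans ?_ h1) ?_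
    · have : t ^ (k + 1) ≤ t ^ k := pow_le_pow_of_le_one ht0.le ht1 (Nat.le_succ k)
      gcongr
    · have e : t • jetScale V t k (jetDiag L k u.2) - e'.2 =
          t • (jetScale V t k (jetDiag L k u.2) - t⁻¹ • e'.2) := by
        rw [smul_sub, smul_inv_smul₀ ht0.ne']
      rw [e, norm_smul, Real.norm_of_nonneg ht0.le, pow_succ]
      calc m * (t ^ k * t) * ‖u.2 - e2‖ = t * (m * t ^ k * ‖u.2 - e2‖) := by ring
        _ ≤ _ := mul_le_mul_of_nonneg_left h2 ht0.le

lemma finiteDimensional_jetSpace [FiniteDimensional ℝ V] :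
    ∀ k : ℕ, FiniteDimensional ℝ (JetSpace V k)
  | 0 => inferInstanceAs (FiniteDimensional ℝ V)
  | k + 1 => by
    have : FiniteDimensional ℝ (JetSpace V k) := finiteDimensional_jetSpace k
    exact inferInstanceAs (FiniteDimensional ℝ (JetSpace V k × JetSpace V k))

lemma jetScale_mem_tangentSpaceOf {S : Set V} {t : ℝ} (ht : t ≠ 0) {k : ℕ} {ξ : JetSpace V k}
    (hξ : ξ ∈ jetSet S k) {v : JetSpace V k} (hv : v ∈ tangentSpaceOf (jetSet S k) ξ) :
    jetScale V t k v ∈ tangentSpaceOf (jetSet S k) (jetScale V t k ξ) := by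
  have : tangentSpaceOf (jetSet S k) ξ ≤ (tangentSpaceOf (jetSet S k) (jetScale V t k ξ)).comap
      (jetScale V t k).toLinearMap := by
    refine Submodule.span_le.2 fun w hw => ?_
    have hm : ((ξ, w) : JetSpace V k × JetSpace V k) ∈ jetSet S (k + 1) := ⟨hξ, hw⟩
    have h2 : t • jetScale V t k w ∈ tangentConeAt ℝ (jetSet S k) (jetScale V t k ξ) :=
      (jetScale_mem_jetSet t (k + 1) _ hm).2
    have h3 := smul_mem_tangentConeAt t⁻¹ h2
    rw [inv_smul_smul₀ ht] at h3
    exact Submodule.subset_span h3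
  exact this hv

end JetLinear

/-! ### Separation of orbits and of transported vectors -/

section OrbitComparison

variable {X : Type*} [NormedAddCommGroup X] [NormedSpace ℝ X]

/-- The distance of two orbits of `G`, and of two vectors transported along them. -/
lemma norm_sub_transport_le {G : X → X} {p ξ η Y Z : ℕ → X} {τ ρ K D D' σ l δ c : ℝ}
    (hK : 0 ≤ K) (hD : 0 ≤ D) (hDD : D < D') (hσ : 1 ≤ σ) (hl : 0 ≤ l) (hlσ : l ≤ σ)
    (hδ : 0 ≤ δ) (hc : 0 ≤ c)
    (hG : ∀ n, ∀ ζ ∈ Metric.ball (p n) τ, DifferentiableAt ℝ G ζ ∧ ‖fderiv ℝ G ζ‖ ≤ D ∧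
      ∀ ζ' ∈ Metric.ball (p n) τ, ‖fderiv ℝ G ζ - fderiv ℝ G ζ'‖ ≤ K * ‖ζ - ζ'‖)
    (hξ : ∀ n, ξ n ∈ Metric.ball (p n) τ) (hη : ∀ n, ‖ξ n - η n‖ < ρ → η n ∈ Metric.ball (p n) τ)
    (hξs : ∀ n, ξ (n + 1) = G (ξ n)) (hηs : ∀ n, η (n + 1) = G (η n))
    (hYs : ∀ n, Y (n + 1) = fderiv ℝ G (ξ n) (Y n)) (hZs : ∀ n, Z (n + 1) = fderiv ℝ G (η n) (Z n))
    (h0 : ‖ξ 0 - η 0‖ ≤ δ) (hY : ∀ n, ‖Y n‖ ≤ l ^ n * c) (hZ : ‖Y 0 - Z 0‖ ≤ K * δ * c) :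
    ∀ n : ℕ, (∀ j < n, D ^ j * δ < ρ) → ‖ξ n - η n‖ ≤ D ^ n * δ ∧
      ‖Y n - Z n‖ ≤ (K + K / (D' - D)) * (D' * σ) ^ n * δ * c
  | 0, _ => by
    refine ⟨by simpa using h0, hZ.trans ?_⟩
    have : 0 ≤ K / (D' - D) := div_nonneg hK (by linarith)
    rw [pow_zero, mul_one]
    gcongr
    linarith
  | n + 1, hn => by
    obtain ⟨h1, h2⟩ := norm_sub_transport_le hK hD hDD hσ hl hlσ hδ hc hG hξ hη hξs hηs hYs hZs
      h0 hY hZ n fun j hj => hn j (by omega)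
    have hηn : η n ∈ Metric.ball (p n) τ := hη n (h1.trans_lt (hn n (by omega)))
    refine ⟨?_, ?_⟩
    · rw [hξs, hηs]
      have := (convex_ball (p n) τ).norm_image_sub_le_of_norm_fderiv_le (𝕜 := ℝ)
        (fun ζ hζ => (hG n ζ hζ).1) (fun ζ hζ => (hG n ζ hζ).2.1) hηn (hξ n)
      refine this.trans ?_
      rw [pow_succ', mul_assoc]
      exact mul_le_mul_of_nonneg_left h1 hD
    · have hD' : 0 ≤ D' := hD.trans hDD.le
      have hσ0 : 0 ≤ σ := zero_le_one.trans hσ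
      -- The error obeys a recursion with factor `D` and a forcing term with coefficient `K`; `K'`
      -- is chosen so that `D * K' + K ≤ D' * K'`, which closes the induction at the rate `D'`.
      set K' := K + K / (D' - D)
      have hK' : 0 ≤ K' := add_nonneg hK (div_nonneg hK (by linarith))
      have hKK : D * K' + K ≤ D' * K' := by
        have h3 : (D' - D) * (K / (D' - D)) = K := mul_div_cancel₀ _ (by linarith)
        have h4 : (D' - D) * K' = (D' - D) * K + K := by rw [mul_add, h3]
        nlinarith [mul_nonneg (sub_nonneg.2 hDD.le) hK]
      have e : Y (n + 1) - Z (n + 1) = fderiv ℝ G (η n) (Y n - Z n) +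
          (fderiv ℝ G (ξ n) - fderiv ℝ G (η n)) (Y n) := by
        rw [hYs, hZs, map_sub, sub_apply]; abel
      have n1 : ‖fderiv ℝ G (η n) (Y n - Z n)‖ ≤ D * (K' * (D' * σ) ^ n * δ * c) :=
        ((fderiv ℝ G (η n)).le_of_opNorm_le (hG n _ hηn).2.1 _).trans (by gcongr)
      have n2 : ‖(fderiv ℝ G (ξ n) - fderiv ℝ G (η n)) (Y n)‖ ≤
          K * (D ^ n * δ) * (l ^ n * c) := by
        refine (ContinuousLinearMap.le_opNorm _ _).trans ?_
        have := ((hG n _ (hξ n)).2.2 _ hηn).trans (mul_le_mul_of_nonneg_left h1 hK)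
        exact mul_le_mul this (hY n) (norm_nonneg _) (by positivity)
      have n3 : K * (D ^ n * δ) * (l ^ n * c) ≤ K * ((D' * σ) ^ n * δ * c) := by
        have : D ^ n * l ^ n ≤ (D' * σ) ^ n := by
          rw [← mul_pow]; gcongr
        calc K * (D ^ n * δ) * (l ^ n * c) = K * ((D ^ n * l ^ n) * (δ * c)) := by ring
          _ ≤ K * ((D' * σ) ^ n * (δ * c)) := by gcongr
          _ = _ := by ring
      rw [e]
      calc _ ≤ D * (K' * (D' * σ) ^ n * δ * c) + K * ((D' * σ) ^ n * δ * c) :=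
            (norm_add_le _ _).trans (add_le_add n1 (n2.trans n3))
        _ = (D * K' + K) * ((D' * σ) ^ n * δ * c) := by ring
        _ ≤ (D' * K') * ((D' * σ) ^ n * δ * c) := by gcongr
        _ ≤ (D' * K') * ((D' * σ) ^ n * δ * c) * σ := le_mul_of_one_le_right (by positivity) hσ
        _ = _ := by rw [pow_succ]; ring

/-- The derivative of a `C^2` map is `C^1`, hence locally Lipschitz, and its norm stays below any
strict bound nearby. -/
lemma exists_ball_fderiv_bounds {F : X → X} {p : X} (hF : ContDiffAt ℝ 2 F p) {D : ℝ}
    (hD : ‖fderiv ℝ F p‖ < D) : ∃ τ K : ℝ, 0 < τ ∧ 0 ≤ K ∧ ∀ ζ ∈ Metric.ball p τ,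
      DifferentiableAt ℝ F ζ ∧ ‖fderiv ℝ F ζ‖ ≤ D ∧
      ∀ ζ' ∈ Metric.ball p τ, ‖fderiv ℝ F ζ - fderiv ℝ F ζ'‖ ≤ K * ‖ζ - ζ'‖ := by
  have h1 : ContDiffAt ℝ 1 (fderiv ℝ F) p := hF.fderiv_right (by norm_num)
  obtain ⟨K, s, hs, hK⟩ := h1.exists_lipschitzOnWith
  have h2 : ∀ᶠ ζ in 𝓝 p, ‖fderiv ℝ F ζ‖ < D := h1.continuousAt.norm.eventually_lt_const hD
  have h3 : ∀ᶠ ζ in 𝓝 p, DifferentiableAt ℝ F ζ :=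
    (hF.eventually (by simp)).mono fun ζ hζ => hζ.differentiableAt (by simp)
  obtain ⟨τ, hτ, hb⟩ := Metric.eventually_nhds_iff_ball.1 ((h2.and h3).and hs)
  refine ⟨τ, K, hτ, K.2, fun ζ hζ => ⟨(hb ζ hζ).1.2, (hb ζ hζ).1.1.le, fun ζ' hζ' => ?_⟩⟩
  have := hK.dist_le_mul ζ (hb ζ hζ).2 ζ' (hb ζ' hζ').2
  rwa [dist_eq_norm, dist_eq_norm] at this

end OrbitComparison

/-! ### Invariant leaf families and uniform estimates near zero jets -/

section LeafSystems

variable {V : Type*} [NormedAddCommGroup V] [NormedSpace ℝ V]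

lemma jetSet_mono {S S' : Set V} (h : S ⊆ S') : ∀ k : ℕ, jetSet S k ⊆ jetSet S' k
  | 0 => h
  | k + 1 => fun _ hp => ⟨jetSet_mono h k hp.1, tangentConeAt_mono (jetSet_mono h k) hp.2⟩

lemma tangentSpaceOf_jetSet_mono {S S' : Set V} (h : S ⊆ S') (k : ℕ) (ξ : JetSpace V k) :
    tangentSpaceOf (jetSet S k) ξ ≤ tangentSpaceOf (jetSet S' k) ξ :=
  Submodule.span_mono (tangentConeAt_mono (jetSet_mono h k))

/-- A family `W` of submanifolds of `M` which is locally invariant under `h`, described by local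
retractions. -/
structure IsLeafSystem (k : ℕ) (Λ M : Set V) (h : V → V) (W : V → Set V) : Prop where
  isCompact : IsCompact Λ
  mapsTo : MapsTo h Λ Λ
  mapsTo_manifold : MapsTo h M M
  contDiffAt : ∀ x ∈ Λ, ContDiffAt ℝ (k + 3 : ℕ) h x
  mem : ∀ x ∈ Λ, x ∈ W x
  subset : ∀ x ∈ Λ, W x ⊆ M
  invariant : ∀ x ∈ Λ, ∀ᶠ y in 𝓝 x, y ∈ W x → h y ∈ W (h x)
  retraction_manifold : ∀ x ∈ Λ, ∃ (r : V → V) (U : Set V), x ∈ U ∧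
    IsLocalRetraction (k + 3) r M U
  retraction : ∃ K : ℝ, ∀ x ∈ Λ, ∃ (r : V → V) (U : Set V), x ∈ U ∧
    IsLocalRetraction (k + 1) r (W x) U ∧
    ∀ j : ℕ, 1 ≤ j → j ≤ k + 1 → ‖iteratedFDeriv ℝ j r x‖ ≤ K

/-- The jet map of `h` followed by a multiplication of the parameters by `t`. -/
def jetStep (t : ℝ) (h : V → V) (k : ℕ) (ξ : JetSpace V k) : JetSpace V k :=
  jetScale V t k (jetMap h k ξ)

lemma jetBase_jetStep (t : ℝ) (h : V → V) (k : ℕ) (ξ : JetSpace V k) :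
    jetBase k (jetStep t h k ξ) = h (jetBase k ξ) := by
  rw [jetStep, jetBase_jetScale, jetBase_jetMap]

lemma fderiv_jetStep {t : ℝ} {h : V → V} {k n : ℕ} (hk : k + 1 ≤ n) {ξ : JetSpace V k}
    (hh : ContDiffAt ℝ n h (jetBase k ξ)) :
    fderiv ℝ (jetStep t h k) ξ = (jetScale V t k).comp (fderiv ℝ (jetMap h k) ξ) :=
  ((jetScale V t k).hasFDerivAt.comp ξ (differentiableAt_jetMap hk hh).hasFDerivAt).fderiv

lemma exists_isOpen_contDiffOn {h : V → V} {x : V} {n : ℕ} {p : V → Prop}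
    (hh : ContDiffAt ℝ n h x) (hp : ∀ᶠ y in 𝓝 x, p y) :
    ∃ U : Set V, IsOpen U ∧ x ∈ U ∧ ContDiffOn ℝ n h U ∧ ∀ y ∈ U, p y := by
  have := (hh.eventually (by simp)).and hp
  obtain ⟨U, hU, hUo, hx⟩ := mem_nhds_iff.1 this
  exact ⟨U, hUo, hx, fun y hy => (hU hy).1.contDiffWithinAt, fun y hy => (hU hy).2⟩

/-- Jet maps of map germs respect the jets and their tangent spaces. -/
lemma jetMap_mem_of_germ {h : V → V} {x : V} {n : ℕ} {S S' : Set V} (hh : ContDiffAt ℝ n h x)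
    (hp : ∀ᶠ y in 𝓝 x, y ∈ S → h y ∈ S') {k : ℕ} (hk : k + 1 ≤ n) {ξ : JetSpace V k}
    (hξ : ξ ∈ jetSet S k) (hb : jetBase k ξ = x) :
    jetMap h k ξ ∈ jetSet S' k ∧
    (tangentSpaceOf (jetSet S k) ξ).map (fderiv ℝ (jetMap h k) ξ).toLinearMap ≤
      tangentSpaceOf (jetSet S' k) (jetMap h k ξ) := by
  obtain ⟨U, hU, hx, hc, hm⟩ := exists_isOpen_contDiffOn hh hp
  rw [← hb] at hx
  exact ⟨jetMap_mem_jetSet hU hc hm k (by omega) ξ hξ hx,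
    map_tangentSpaceOf_jetSet_le hU hc hm hk hξ hx⟩

lemma jetStep_mem_of_germ {h : V → V} {x : V} {n : ℕ} {S S' : Set V} (hh : ContDiffAt ℝ n h x)
    (hp : ∀ᶠ y in 𝓝 x, y ∈ S → h y ∈ S') {t : ℝ} (ht : t ≠ 0) {k : ℕ} (hk : k + 1 ≤ n)
    {ξ : JetSpace V k} (hξ : ξ ∈ jetSet S k) (hb : jetBase k ξ = x) :
    jetStep t h k ξ ∈ jetSet S' k ∧ ∀ v ∈ tangentSpaceOf (jetSet S k) ξ,
      fderiv ℝ (jetStep t h k) ξ v ∈ tangentSpaceOf (jetSet S' k) (jetStep t h k ξ) := by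
  obtain ⟨h1, h2⟩ := jetMap_mem_of_germ hh hp hk hξ hb
  refine ⟨jetScale_mem_jetSet t k _ h1, fun v hv => ?_⟩
  rw [fderiv_jetStep hk (by rwa [hb])]
  exact jetScale_mem_tangentSpaceOf ht h1 (h2 (Submodule.mem_map_of_mem hv))

namespace IsLeafSystem

variable {k : ℕ} {Λ M : Set V} {h : V → V} {W : V → Set V}

/-- The jets of `W x` at `x` with velocities bounded by `τ`. -/
def smallJets (Λ : Set V) (W : V → Set V) (τ : ℝ) (j : ℕ) (x : V) : Set (JetSpace V j) :=
  {ζ | x ∈ Λ ∧ ζ ∈ jetSet (W x) j ∧ jetBase j ζ = x ∧ VelocitiesLE τ j ζ}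

/-- Both spaces are fixed spaces of derivatives of the jet map of the same retraction, at jets over
the same foot point. These derivatives are close by `norm_fderiv_jetMap_sub_le`, which needs no more
smoothness than the leaves have and no continuity of the leaves in `x`. -/
lemma exists_gap_le (H : IsLeafSystem k Λ M h W) {ε : ℝ} (hε : 0 < ε) :
    ∃ τ, 0 < τ ∧ τ ≤ 1 ∧ ∀ j ≤ k, ∀ x, ∀ ζ ∈ smallJets Λ W τ j x,
      GapLE (tangentSpaceOf (jetSet (W x) j) ζ) (jetSub (tangentSpaceOf (W x) x) j) ε ∧
      GapLE (jetSub (tangentSpaceOf (W x) x) j) (tangentSpaceOf (jetSet (W x) j) ζ) ε := by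
  obtain ⟨K, hK⟩ := H.retraction
  set C := (k : ℝ) * 2 ^ ((k + 2) * (k + 2)) * max K 0
  have hC : 0 ≤ C := by positivity
  set τ := min 1 (ε / (C + 1))
  have hτ : 0 < τ := by positivity
  have hτ1 : τ ≤ 1 := min_le_left _ _
  have hCτ : C * τ ≤ ε := by
    have h1 : τ ≤ ε / (C + 1) := min_le_right _ _
    rw [le_div_iff₀ (by positivity)] at h1
    nlinarith
  refine ⟨τ, hτ, hτ1, ?_⟩
  rintro j hj x ζ ⟨hx, hζ, hb, hv⟩
  obtain ⟨r, U, hxU, hr, hrK⟩ := hK x hx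
  have hbU : jetBase j ζ ∈ U := by rwa [hb]
  have hxl : jetBase j (jetLift j x) ∈ U := by rwa [jetBase_jetLift]
  have hl := jetLift_mem_jetSet (H.mem x hx) j
  have hd : ‖fderiv ℝ (jetMap r j) ζ - fderiv ℝ (jetMap r j) (jetLift j x)‖ ≤ ε := by
    refine (norm_fderiv_jetMap_sub_le (K := max K 0) hτ.le hτ1 j ζ hv hb
      ((hr.contDiffAt hxU).of_le (by norm_cast; omega))
      fun i hi hi' => (hrK i hi (by omega)).trans (le_max_left _ _)).trans (le_trans ?_ hCτ)
    have e1 : (2 : ℝ) ^ ((j + 2) * (j + 2)) ≤ 2 ^ ((k + 2) * (k + 2)) :=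
      pow_le_pow_right₀ (by norm_num) (by gcongr)
    have e2 : (j : ℝ) ≤ k := by exact_mod_cast hj
    have e3 : 0 ≤ max K 0 := le_max_right _ _
    simp only [C]
    gcongr
  rw [← hr.tangentSpaceOf_jetLift (by omega) (H.mem x hx) hxU]
  refine ⟨gapLE_of_norm_sub_le (fun v hv => (hr.mem_tangentSpaceOf_iff (by omega) hζ hbU).1 hv)
    (hr.fderiv_mem (by omega) hl hxl) hd, gapLE_of_norm_sub_le (fun v hv =>
      (hr.mem_tangentSpaceOf_iff (by omega) hl hxl).1 hv) (hr.fderiv_mem (by omega) hζ hbU) ?_⟩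
  rwa [norm_sub_rev]

/-- Unlike the leaves, `M` is smooth enough for its retractions to have jet maps with Lipschitz
derivative, and one retraction serves a whole ball of foot points. This allows tangent vectors of
`T^k M` to be compared at jets with different foot points. -/
lemma exists_ball_retraction (H : IsLeafSystem k Λ M h W) :
    ∃ τ K : ℝ, 0 < τ ∧ 0 ≤ K ∧ ∀ x ∈ Λ, ∃ (r : V → V) (U : Set V),
      IsLocalRetraction (k + 3) r M U ∧ Metric.ball x τ ⊆ U ∧
      ∀ ζ ∈ Metric.ball (jetLift k x) τ, ∀ ζ' ∈ Metric.ball (jetLift k x) τ,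
        ‖fderiv ℝ (jetMap r k) ζ - fderiv ℝ (jetMap r k) ζ'‖ ≤ K * ‖ζ - ζ'‖ := by
  refine H.isCompact.exists_uniform_radius_bound ?_ ?_
  · rintro x τ τ' K K' h0 h1 h2 ⟨r, U, hr, hU, hL⟩
    refine ⟨r, U, hr, (Metric.ball_subset_ball h1).trans hU, fun ζ hζ ζ' hζ' => ?_⟩
    exact (hL ζ (Metric.ball_subset_ball h1 hζ) ζ' (Metric.ball_subset_ball h1 hζ')).trans
      (by gcongr)
  · intro x₀ hx₀
    obtain ⟨r, U, hxU, hr⟩ := H.retraction_manifold x₀ hx₀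
    have h2 : ContDiffAt ℝ 2 (jetMap r k) (jetLift k x₀) := contDiffAt_jetMap k 2 _ (by
      rw [jetBase_jetLift]; exact (hr.contDiffAt hxU).of_le (by norm_cast; omega))
    obtain ⟨τ, K, hτ, hK, hb⟩ := exists_ball_fderiv_bounds h2 (lt_add_one _)
    obtain ⟨τ', hτ', hb'⟩ := Metric.isOpen_iff.1 hr.isOpen x₀ hxU
    refine ⟨min τ τ' / 2, K, by positivity, fun x hx => ⟨r, U, hr, ?_, ?_⟩⟩
    · refine (Metric.ball_subset_ball' ?_).trans hb'
      have := (Metric.mem_ball.1 hx).le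
      have := min_le_right τ τ'
      linarith
    · have hs : Metric.ball (jetLift k x) (min τ τ' / 2) ⊆ Metric.ball (jetLift k x₀) τ := by
        refine Metric.ball_subset_ball' ?_
        rw [dist_eq_norm, norm_jetLift_sub_jetLift, ← dist_eq_norm]
        have := (Metric.mem_ball.1 hx).le
        have := min_le_left τ τ'
        linarith
      exact fun ζ hζ ζ' hζ' => (hb ζ (hs hζ)).2.2 ζ' (hs hζ')

/-- At a zero jet the derivative is the rescaling composed with `jetDiag`, of norm at most that of
`Dh`. So orbits of small jets separate at a rate barely above `D0`, whatever the order of the jets.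
-/
lemma exists_ball_jetStep_bounds (H : IsLeafSystem k Λ M h W) {t D0 D : ℝ} (ht0 : 0 ≤ t)
    (ht1 : t ≤ 1) (hD0 : ∀ x ∈ Λ, ‖fderiv ℝ h x‖ ≤ D0) (hD : D0 < D) {j : ℕ} (hj : j ≤ k) :
    ∃ τ K : ℝ, 0 < τ ∧ 0 ≤ K ∧ ∀ x ∈ Λ, ∀ ζ ∈ Metric.ball (jetLift j x) τ,
      DifferentiableAt ℝ (jetStep t h j) ζ ∧ ‖fderiv ℝ (jetStep t h j) ζ‖ ≤ D ∧
      ∀ ζ' ∈ Metric.ball (jetLift j x) τ,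
        ‖fderiv ℝ (jetStep t h j) ζ - fderiv ℝ (jetStep t h j) ζ'‖ ≤ K * ‖ζ - ζ'‖ := by
  refine H.isCompact.exists_uniform_radius_bound ?_ ?_
  · rintro x τ τ' K K' h0 h1 h2 hL ζ hζ
    obtain ⟨a, b, c⟩ := hL ζ (Metric.ball_subset_ball h1 hζ)
    exact ⟨a, b, fun ζ' hζ' => (c ζ' (Metric.ball_subset_ball h1 hζ')).trans (by gcongr)⟩
  · intro x₀ hx₀
    have hc := H.contDiffAt x₀ hx₀
    have h2 : ContDiffAt ℝ 2 (jetStep t h j) (jetLift j x₀) :=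
      (jetScale V t j).contDiff.contDiffAt.comp _ (contDiffAt_jetMap j 2 _ (by
        rw [jetBase_jetLift]; exact hc.of_le (by norm_cast; omega)))
    have hn : ‖fderiv ℝ (jetStep t h j) (jetLift j x₀)‖ < D := by
      rw [fderiv_jetStep (n := k + 3) (by omega) (by rwa [jetBase_jetLift]),
        fderiv_jetMap_jetLift j (hc.of_le (by norm_cast; omega))]
      refine lt_of_le_of_lt (ContinuousLinearMap.opNorm_le_bound _ (norm_nonneg (fderiv ℝ h x₀))
        fun v => ?_) ((hD0 x₀ hx₀).trans_lt hD)
      exact (norm_jetScale_le ht0 ht1 j _).trans ((jetDiag _ j).le_of_opNorm_le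
        (opNorm_jetDiag_le _ j) v)
    obtain ⟨τ, K, hτ, hK, hb⟩ := exists_ball_fderiv_bounds h2 hn
    refine ⟨τ / 2, K, by positivity, fun x hx => ?_⟩
    have hs : Metric.ball (jetLift j x) (τ / 2) ⊆ Metric.ball (jetLift j x₀) τ := by
      refine Metric.ball_subset_ball' ?_
      rw [dist_eq_norm, norm_jetLift_sub_jetLift, ← dist_eq_norm]
      have := (Metric.mem_ball.1 hx).le
      linarith
    exact fun ζ hζ => ⟨(hb ζ (hs hζ)).1, (hb ζ (hs hζ)).2.1,
      fun ζ' hζ' => (hb ζ (hs hζ)).2.2 ζ' (hs hζ')⟩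

lemma jetStep_mem (H : IsLeafSystem k Λ M h W) {t : ℝ} (ht : t ≠ 0) {j : ℕ} (hj : j ≤ k) {x : V}
    (hx : x ∈ Λ) {ζ : JetSpace V j} (hζ : ζ ∈ jetSet (W x) j) (hb : jetBase j ζ = x) :
    jetStep t h j ζ ∈ jetSet (W (h x)) j ∧ ∀ v ∈ tangentSpaceOf (jetSet (W x) j) ζ,
      fderiv ℝ (jetStep t h j) ζ v ∈ tangentSpaceOf (jetSet (W (h x)) j) (jetStep t h j ζ) :=
  jetStep_mem_of_germ (H.contDiffAt x hx) (H.invariant x hx) ht (by omega) hζ hb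

end IsLeafSystem

end LeafSystems

/-! ### Rates of the rescaled jet map at small jets -/

section LeafSystemRates

variable {V : Type*} [NormedAddCommGroup V] [NormedSpace ℝ V]

lemma fderiv_jetStep_jetLift {t : ℝ} {h : V → V} {x : V} {k n : ℕ} (hk : k + 1 ≤ n)
    (hh : ContDiffAt ℝ n h x) :
    fderiv ℝ (jetStep t h k) (jetLift k x) = (jetScale V t k).comp (jetDiag (fderiv ℝ h x) k) := by
  rw [fderiv_jetStep hk (by rwa [jetBase_jetLift]),
    fderiv_jetMap_jetLift k (hh.of_le (by norm_cast))]

namespace IsLeafSystem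

variable {k : ℕ} {Λ M : Set V} {h : V → V} {W : V → Set V}

lemma smallJets_mono {τ τ' : ℝ} (hτ : τ ≤ τ') (j : ℕ) (x : V) :
    smallJets Λ W τ j x ⊆ smallJets Λ W τ' j x :=
  fun _ hζ => ⟨hζ.1, hζ.2.1, hζ.2.2.1, hζ.2.2.2.mono hτ⟩

lemma mem_ball_of_mem_smallJets {τ τ' : ℝ} (h0 : 0 ≤ τ) (hτ : τ < τ') {j : ℕ} {x : V}
    {ζ : JetSpace V j} (hζ : ζ ∈ smallJets Λ W τ j x) : ζ ∈ Metric.ball (jetLift j x) τ' := by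
  rw [Metric.mem_ball, dist_eq_norm]
  have := hζ.2.2.2.norm_sub_jetLift_le h0
  rw [hζ.2.2.1] at this
  exact this.trans_lt hτ

/-- At a zero jet the rate is `l0`. Passing to a small jet changes both the tangent space
(`exists_gap_le`) and the derivative by at most `ε`, which costs less than `l - l0`. -/
lemma exists_rate_le (H : IsLeafSystem k Λ M h W) {t l0 l D0 : ℝ} (ht0 : 0 ≤ t)
    (ht1 : t ≤ 1) (hD0 : ∀ x ∈ Λ, ‖fderiv ℝ h x‖ ≤ D0) (hl0 : 0 ≤ l0) (hl : l0 < l)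
    (hsc : ∀ x ∈ Λ, ∀ v ∈ tangentSpaceOf (W x) x, ‖fderiv ℝ h x v‖ ≤ l0 * ‖v‖) :
    ∃ τ, 0 < τ ∧ ∀ j ≤ k, ∀ x, ∀ ζ ∈ smallJets Λ W τ j x,
      ∀ v ∈ tangentSpaceOf (jetSet (W x) j) ζ, ‖fderiv ℝ (jetStep t h j) ζ v‖ ≤ l * ‖v‖ := by
  refine exists_pos_forall_le (fun j τ τ' _ hττ hP x ζ hζ => hP x ζ (smallJets_mono hττ j x hζ)) ?_
  intro j hj
  obtain ⟨τ1, K, hτ1, hK, hb⟩ := H.exists_ball_jetStep_bounds ht0 ht1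
    (fun x hx => (hD0 x hx).trans (le_max_left D0 0)) (lt_add_one (max D0 0)) hj
  set D := max D0 0 + 1
  have hD : 0 ≤ D := by positivity
  set ε := min 1 ((l - l0) / (D + 2 + l0))
  have hll : 0 < l - l0 := sub_pos.2 hl
  have hε : 0 < ε := by positivity
  have hε1 : ε ≤ 1 := min_le_left _ _
  have hε2 : ε * (D + 2 + l0) ≤ l - l0 := by
    have : ε ≤ (l - l0) / (D + 2 + l0) := min_le_right _ _
    rwa [le_div_iff₀ (by positivity)] at this
  obtain ⟨τ2, hτ2, -, hg⟩ := H.exists_gap_le hε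
  set τ := min τ2 (min (τ1 / 2) (ε / (K + 1)))
  have hτ : 0 < τ := by positivity
  have hKτ : K * τ ≤ ε := by
    have : τ ≤ ε / (K + 1) := (min_le_right _ _).trans (min_le_right _ _)
    rw [le_div_iff₀ (by positivity)] at this
    nlinarith
  have hττ : τ < τ1 := lt_of_le_of_lt ((min_le_right _ _).trans (min_le_left _ _)) (by linarith)
  refine ⟨τ, hτ, fun x ζ hζ v hv => ?_⟩
  have hx := hζ.1
  obtain ⟨v0, hv0, h1⟩ := (hg j hj x ζ (smallJets_mono (min_le_left _ _) j x hζ)).1 v hv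
  have hball : ζ ∈ Metric.ball (jetLift j x) τ1 := mem_ball_of_mem_smallJets hτ.le hττ hζ
  obtain ⟨-, n1, n2⟩ := hb x hx ζ hball
  have n3 := n2 _ (Metric.mem_ball_self hτ1)
  have n4 : ‖ζ - jetLift j x‖ ≤ τ := by
    have := hζ.2.2.2.norm_sub_jetLift_le hτ.le
    rwa [hζ.2.2.1] at this
  have n5 : ‖fderiv ℝ (jetStep t h j) ζ - fderiv ℝ (jetStep t h j) (jetLift j x)‖ ≤ ε :=
    n3.trans ((mul_le_mul_of_nonneg_left n4 hK).trans hKτ)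
  have n6 : ‖fderiv ℝ (jetStep t h j) (jetLift j x) v0‖ ≤ l0 * ‖v0‖ := by
    rw [fderiv_jetStep_jetLift (n := k + 3) (by omega) (H.contDiffAt x hx)]
    exact (norm_jetScale_le ht0 ht1 j _).trans (norm_jetDiag_le hl0 (hsc x hx) j v0 hv0)
  have n7 : ‖v0‖ ≤ (1 + ε) * ‖v‖ := by
    have := norm_sub_le v (v - v0)
    rw [sub_sub_cancel] at this
    linarith
  have e : fderiv ℝ (jetStep t h j) ζ v = fderiv ℝ (jetStep t h j) ζ (v - v0) +
      (fderiv ℝ (jetStep t h j) ζ - fderiv ℝ (jetStep t h j) (jetLift j x)) v0 +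
      fderiv ℝ (jetStep t h j) (jetLift j x) v0 := by
    rw [map_sub, sub_apply]; abel
  rw [e]
  calc _ ≤ D * (ε * ‖v‖) + ε * ‖v0‖ + l0 * ‖v0‖ := by
        refine (norm_add₃_le).trans (add_le_add (add_le_add ?_ ?_) n6)
        · exact (ContinuousLinearMap.le_of_opNorm_le _ n1 _).trans (by gcongr)
        · exact ContinuousLinearMap.le_of_opNorm_le _ n5 _
    _ ≤ D * (ε * ‖v‖) + ε * ((1 + ε) * ‖v‖) + l0 * ((1 + ε) * ‖v‖) := by gcongr
    _ = (D * ε + ε * (1 + ε) + l0 * (1 + ε)) * ‖v‖ := by ring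
    _ ≤ l * ‖v‖ := by
        refine mul_le_mul_of_nonneg_right ?_ (norm_nonneg _)
        nlinarith

/-- Every velocity of a jet of a leaf is itself tangent to the jet bundle one level below, so the
map expands it by at most `l` before the rescaling multiplies it by `t`; hence `t * l ≤ 1` prevents
growth. -/
lemma jetStep_mem_smallJets (H : IsLeafSystem k Λ M h W) {t l τ : ℝ} (ht0 : 0 < t)
    (hlt : t * l ≤ 1)
    (hE : ∀ j ≤ k, ∀ x, ∀ ζ ∈ smallJets Λ W τ j x,
      ∀ v ∈ tangentSpaceOf (jetSet (W x) j) ζ, ‖fderiv ℝ (jetStep t h j) ζ v‖ ≤ l * ‖v‖) :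
    ∀ j ≤ k, ∀ x, ∀ ζ ∈ smallJets Λ W τ j x, jetStep t h j ζ ∈ smallJets Λ W τ j (h x) := by
  have key : ∀ j ≤ k, ∀ x, ∀ ζ ∈ smallJets Λ W τ j x, VelocitiesLE τ j (jetStep t h j ζ) := by
    intro j
    induction j with
    | zero => intro _ _ _ _; trivial
    | succ j ih =>
      intro hj x ζ hζ
      have hζ1 : ζ.1 ∈ smallJets Λ W τ j x := ⟨hζ.1, hζ.2.1.1, hζ.2.2.1, hζ.2.2.2.1⟩
      refine ⟨ih (by omega) x ζ.1 hζ1, ?_⟩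
      have hv : ζ.2 ∈ tangentSpaceOf (jetSet (W x) j) ζ.1 := Submodule.subset_span hζ.2.1.2
      have hn := hE j (by omega) x ζ.1 hζ1 ζ.2 hv
      rw [fderiv_jetStep (n := k + 3) (by omega)
        (by rw [hζ1.2.2.1]; exact H.contDiffAt x hζ.1)] at hn
      change ‖t • jetScale V t j (fderiv ℝ (jetMap h j) ζ.1 ζ.2)‖ ≤ τ
      rw [norm_smul, Real.norm_of_nonneg ht0.le]
      calc _ ≤ t * (l * ‖ζ.2‖) := mul_le_mul_of_nonneg_left hn ht0.le
        _ = t * l * ‖ζ.2‖ := by ring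
        _ ≤ 1 * ‖ζ.2‖ := mul_le_mul_of_nonneg_right hlt (norm_nonneg _)
        _ ≤ τ := by rw [one_mul]; exact hζ.2.2.2.2
  intro j hj x ζ hζ
  refine ⟨H.mapsTo hζ.1, (H.jetStep_mem ht0.ne' hj hζ.1 hζ.2.1 hζ.2.2.1).1, ?_, key j hj x ζ hζ⟩
  rw [jetBase_jetStep, hζ.2.2.1]

/-- The estimate at the zero jet is `jetDiag_quotient_lower_bound`, the source of the factor `t ^
k`; `quotient_lower_bound_of_perturbation` carries it to small jets. The gap is needed at the image
jet too, hence the invariance hypothesis. -/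
lemma exists_quotient_rate [FiniteDimensional ℝ V] (H : IsLeafSystem k Λ M h W)
    {t μ m D0 τ0 : ℝ} (ht0 : 0 < t) (ht1 : t ≤ 1) (hD0 : ∀ x ∈ Λ, ‖fderiv ℝ h x‖ ≤ D0)
    (hμ : 0 ≤ μ) (hm : m < μ * t ^ k) (hτ0 : 0 < τ0)
    (hq : ∀ x ∈ Λ, ∀ u ∈ tangentSpaceOf M x, ∀ e' ∈ tangentSpaceOf (W (h x)) (h x),
      ∃ e ∈ tangentSpaceOf (W x) x, μ * ‖u - e‖ ≤ ‖fderiv ℝ h x u - e'‖)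
    (hinv : ∀ τ, 0 < τ → τ ≤ τ0 → ∀ x, ∀ ζ ∈ smallJets Λ W τ k x,
      jetStep t h k ζ ∈ smallJets Λ W τ k (h x)) :
    ∃ τ, 0 < τ ∧ ∀ x, ∀ ζ ∈ smallJets Λ W τ k x,
      ∀ u ∈ tangentSpaceOf (jetSet M k) ζ,
      ∀ e' ∈ tangentSpaceOf (jetSet (W (h x)) k) (jetStep t h k ζ),
      ∃ e ∈ tangentSpaceOf (jetSet (W x) k) ζ,
        m * ‖u - e‖ ≤ ‖fderiv ℝ (jetStep t h k) ζ u - e'‖ := by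
  have : FiniteDimensional ℝ (JetSpace V k) := finiteDimensional_jetSpace k
  obtain ⟨τ1, K, hτ1, hK, hb⟩ := H.exists_ball_jetStep_bounds ht0.le ht1
    hD0 (lt_add_one D0) (le_refl k)
  obtain ⟨τ3, K3, hτ3, hK3, hr⟩ := H.exists_ball_retraction
  obtain ⟨ε, hε, hε1, -, hεm⟩ := exists_perturbation_size hm (D0 + 1) 1 one_pos
  obtain ⟨τ2, hτ2, -, hg⟩ := H.exists_gap_le hε
  set τ := min (min τ0 τ2) (min (min (τ1 / 2) (τ3 / 2)) (ε / (K + K3 + 1)))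
  have hτ : 0 < τ := by positivity
  have hτε : τ * (K + K3 + 1) ≤ ε := by
    have : τ ≤ ε / (K + K3 + 1) := (min_le_right _ _).trans (min_le_right _ _)
    rwa [le_div_iff₀ (by positivity)] at this
  have hKτ : K * τ ≤ ε := by nlinarith [mul_nonneg hK3 hτ.le]
  have hKτ3 : K3 * τ ≤ ε := by nlinarith [mul_nonneg hK hτ.le]
  have hττ2 : τ ≤ τ2 := (min_le_left _ _).trans (min_le_right _ _)
  have hττ1 : τ < τ1 := lt_of_le_of_lt ((min_le_right _ _).trans ((min_le_left _ _).trans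
    (min_le_left _ _))) (by linarith)
  have hττ3 : τ < τ3 := lt_of_le_of_lt ((min_le_right _ _).trans ((min_le_left _ _).trans
    (min_le_right _ _))) (by linarith)
  refine ⟨τ, hτ, fun x ζ hζ => ?_⟩
  have hx := hζ.1
  have hGζ := hinv τ hτ ((min_le_left _ _).trans (min_le_left _ _)) x ζ hζ
  have hl1 : jetLift k x ∈ Metric.ball (jetLift k x) τ1 := Metric.mem_ball_self hτ1
  have n4 : ‖ζ - jetLift k x‖ ≤ τ := by
    have := hζ.2.2.2.norm_sub_jetLift_le hτ.le
    rwa [hζ.2.2.1] at this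
  obtain ⟨-, a1, -⟩ := hb x hx ζ (mem_ball_of_mem_smallJets hτ.le hττ1 hζ)
  obtain ⟨-, b1, b2⟩ := hb x hx _ hl1
  have b3 := b2 ζ (mem_ball_of_mem_smallJets hτ.le hττ1 hζ)
  rw [norm_sub_rev (jetLift k x)] at b3
  have b4 := b3.trans ((mul_le_mul_of_nonneg_left n4 hK).trans hKτ)
  obtain ⟨r, U, hrM, hU, hrL⟩ := hr x hx
  have hxU : x ∈ U := hU (Metric.mem_ball_self hτ3)
  have hxM : x ∈ M := H.subset x hx (H.mem x hx)
  have hbU : jetBase k ζ ∈ U := by rw [hζ.2.2.1]; exact hxU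
  have hζM : ζ ∈ jetSet M k := jetSet_mono (H.subset x hx) k hζ.2.1
  have c1 := (hrL ζ (mem_ball_of_mem_smallJets hτ.le hττ3 hζ) _ (Metric.mem_ball_self hτ3)).trans
    ((mul_le_mul_of_nonneg_left n4 hK3).trans hKτ3)
  have gA : GapLE (tangentSpaceOf (jetSet M k) ζ) (jetSub (tangentSpaceOf M x) k) ε := by
    rw [← hrM.tangentSpaceOf_jetLift (by omega) hxM hxU]
    exact gapLE_of_norm_sub_le
      (fun v hv => (hrM.mem_tangentSpaceOf_iff (by omega) hζM hbU).1 hv)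
      (hrM.fderiv_mem (by omega) (jetLift_mem_jetSet hxM k) (by rwa [jetBase_jetLift])) c1
  have gE := hg k le_rfl x ζ (smallJets_mono hττ2 k x hζ)
  have gE' := hg k le_rfl (h x) _ (smallJets_mono hττ2 k (h x) hGζ)
  refine quotient_lower_bound_of_perturbation b4 a1 b1 gA gE.2 gE'.1
    (tangentSpaceOf_jetSet_mono (H.subset x hx) k ζ)
    (H.jetStep_mem ht0.ne' le_rfl hx hζ.2.1 hζ.2.2.1).2 ?_ hε.le hε1 (by positivity) hεm
  rw [fderiv_jetStep_jetLift (n := k + 3) (by omega) (H.contDiffAt x hx)]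
  exact jetDiag_quotient_lower_bound ht0 ht1 hμ (hq x hx) k

end IsLeafSystem

end LeafSystemRates

/-! ### The Hölder estimate at small jets -/

section HolderEstimate

variable {V : Type*} [NormedAddCommGroup V] [NormedSpace ℝ V]

/-- The transport of the vector `v` by the derivative of `G` along the orbit of `ξ`. -/
def transport {X : Type*} [NormedAddCommGroup X] [NormedSpace ℝ X] (G : X → X) (ξ v : X) : ℕ → X
  | 0 => v
  | n + 1 => fderiv ℝ G (G^[n] ξ) (transport G ξ v n)

namespace IsLeafSystem

variable {k : ℕ} {Λ M : Set V} {h : V → V} {W : V → Set V}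

lemma iterate_jetStep_mem_smallJets {t τ : ℝ}
    (hinv : ∀ x, ∀ ζ ∈ smallJets Λ W τ k x, jetStep t h k ζ ∈ smallJets Λ W τ k (h x))
    {x : V} {ζ : JetSpace V k} (hζ : ζ ∈ smallJets Λ W τ k x) :
    ∀ n : ℕ, (jetStep t h k)^[n] ζ ∈ smallJets Λ W τ k (h^[n] x)
  | 0 => hζ
  | n + 1 => by
    rw [Function.iterate_succ_apply', Function.iterate_succ_apply']
    exact hinv _ _ (iterate_jetStep_mem_smallJets hinv hζ n)

lemma transport_mem_leaf (H : IsLeafSystem k Λ M h W) {t τ l : ℝ} (ht : t ≠ 0) (hl : 0 ≤ l)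
    (hinv : ∀ x, ∀ ζ ∈ smallJets Λ W τ k x, jetStep t h k ζ ∈ smallJets Λ W τ k (h x))
    (hE : ∀ x, ∀ ζ ∈ smallJets Λ W τ k x,
      ∀ v ∈ tangentSpaceOf (jetSet (W x) k) ζ, ‖fderiv ℝ (jetStep t h k) ζ v‖ ≤ l * ‖v‖)
    {x : V} {ζ : JetSpace V k} (hζ : ζ ∈ smallJets Λ W τ k x) {v : JetSpace V k}
    (hv : v ∈ tangentSpaceOf (jetSet (W x) k) ζ) :
    ∀ n : ℕ, transport (jetStep t h k) ζ v n ∈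
        tangentSpaceOf (jetSet (W (h^[n] x)) k) ((jetStep t h k)^[n] ζ) ∧
      ‖transport (jetStep t h k) ζ v n‖ ≤ l ^ n * ‖v‖
  | 0 => ⟨hv, by simp [transport]⟩
  | n + 1 => by
    obtain ⟨h1, h2⟩ := transport_mem_leaf H ht hl hinv hE hζ hv n
    have hs := iterate_jetStep_mem_smallJets hinv hζ n
    rw [Function.iterate_succ_apply', Function.iterate_succ_apply', transport]
    refine ⟨(H.jetStep_mem ht le_rfl hs.1 hs.2.1 hs.2.2.1).2 _ h1, ?_⟩
    refine (hE _ _ hs _ h1).trans ?_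
    rw [pow_succ', mul_assoc]
    exact mul_le_mul_of_nonneg_left h2 hl

/-- Quotient lower bounds compose: the vector produced at step `n` is the comparison vector for the
preceding steps. -/
lemma transport_quotient (H : IsLeafSystem k Λ M h W) {t τ m : ℝ} (ht : t ≠ 0) (hm : 0 ≤ m)
    (hinv : ∀ x, ∀ ζ ∈ smallJets Λ W τ k x, jetStep t h k ζ ∈ smallJets Λ W τ k (h x))
    (hU : ∀ x, ∀ ζ ∈ smallJets Λ W τ k x, ∀ u ∈ tangentSpaceOf (jetSet M k) ζ,
      ∀ e' ∈ tangentSpaceOf (jetSet (W (h x)) k) (jetStep t h k ζ),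
      ∃ e ∈ tangentSpaceOf (jetSet (W x) k) ζ,
        m * ‖u - e‖ ≤ ‖fderiv ℝ (jetStep t h k) ζ u - e'‖)
    {x : V} {ζ : JetSpace V k} (hζ : ζ ∈ smallJets Λ W τ k x) {u : JetSpace V k}
    (hu : u ∈ tangentSpaceOf (jetSet M k) ζ) :
    ∀ n : ℕ, transport (jetStep t h k) ζ u n ∈ tangentSpaceOf (jetSet M k)
        ((jetStep t h k)^[n] ζ) ∧
      ∀ e' ∈ tangentSpaceOf (jetSet (W (h^[n] x)) k) ((jetStep t h k)^[n] ζ),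
        ∃ e ∈ tangentSpaceOf (jetSet (W x) k) ζ,
          m ^ n * ‖u - e‖ ≤ ‖transport (jetStep t h k) ζ u n - e'‖
  | 0 => ⟨hu, fun e' he' => ⟨e', he', by simp [transport]⟩⟩
  | n + 1 => by
    obtain ⟨h1, h2⟩ := transport_quotient H ht hm hinv hU hζ hu n
    have hs := iterate_jetStep_mem_smallJets hinv hζ n
    rw [Function.iterate_succ_apply', Function.iterate_succ_apply', transport]
    refine ⟨(jetStep_mem_of_germ (H.contDiffAt _ hs.1)
      (Eventually.of_forall fun y hy => H.mapsTo_manifold hy) ht (by omega)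
      (jetSet_mono (H.subset _ hs.1) k hs.2.1) hs.2.2.1).2 _ h1, fun e' he' => ?_⟩
    obtain ⟨e1, he1, h3⟩ := hU _ _ hs _ h1 e' he'
    obtain ⟨e, he, h4⟩ := h2 e1 he1
    refine ⟨e, he, le_trans ?_ h3⟩
    rw [pow_succ', mul_assoc]
    exact mul_le_mul_of_nonneg_left h4 hm

/-- Hölder continuity of the distribution of tangent spaces of the jets of the leaves, at jets with
small velocities. -/
theorem exists_gap_le_rpow [FiniteDimensional ℝ V] (H : IsLeafSystem k Λ M h W)
    {σ l0 l μ m D0 D' φ : ℝ} (hσ : 1 ≤ σ) (hl0 : 0 ≤ l0) (hl : l0 < l) (hlσ : l ≤ σ)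
    (hD00 : 0 ≤ D0) (hDD : D0 < D') (hD' : 1 < D') (hμ : 0 ≤ μ) (hm : m < μ * σ⁻¹ ^ k)
    (hφ0 : 0 < φ) (hφ1 : φ ≤ 1) (hrate : l * (D' * σ / l) ^ φ ≤ m)
    (hD0 : ∀ x ∈ Λ, ‖fderiv ℝ h x‖ ≤ D0)
    (hsc : ∀ x ∈ Λ, ∀ v ∈ tangentSpaceOf (W x) x, ‖fderiv ℝ h x v‖ ≤ l0 * ‖v‖)
    (hq : ∀ x ∈ Λ, ∀ u ∈ tangentSpaceOf M x, ∀ e' ∈ tangentSpaceOf (W (h x)) (h x),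
      ∃ e ∈ tangentSpaceOf (W x) x, μ * ‖u - e‖ ≤ ‖fderiv ℝ h x u - e'‖) :
    ∃ τ C : ℝ, 0 < τ ∧ 0 ≤ C ∧ ∀ x y, ∀ ξ ∈ smallJets Λ W τ k x, ∀ η ∈ smallJets Λ W τ k y,
      GapLE (tangentSpaceOf (jetSet (W x) k) ξ) (tangentSpaceOf (jetSet (W y) k) η)
        (C * ‖ξ - η‖ ^ φ) := by
  have hσ0 : 0 < σ := zero_lt_one.trans_le hσ
  have hlp : 0 < l := hl0.trans_lt hl
  set t := σ⁻¹ with ht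
  have ht0 : 0 < t := inv_pos.2 hσ0
  have ht1 : t ≤ 1 := inv_le_one_of_one_le₀ hσ
  have htl : t * l ≤ 1 := by rw [ht, inv_mul_le_iff₀ hσ0, mul_one]; exact hlσ
  -- The ratio between the growth of the comparison error and that of vectors along the leaves.
  set κ := D' * σ / l with hκdef
  have hκD : D' ≤ κ := by
    rw [hκdef, le_div_iff₀ hlp]
    exact mul_le_mul_of_nonneg_left hlσ (by linarith)
  have hκ1 : 1 < κ := hD'.trans_le hκD
  have hκ0 : 0 < κ := one_pos.trans hκ1
  have hm0 : 0 < m := lt_of_lt_of_le (mul_pos hlp (Real.rpow_pos_of_pos hκ0 _)) hrate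
  set D := (D0 + D') / 2 with hDdef
  have hD0D : D0 < D := by rw [hDdef]; linarith
  have hDD' : D < D' := by rw [hDdef]; linarith
  have hDn : 0 ≤ D := hD00.trans hD0D.le
  obtain ⟨τ1, hτ1, hE⟩ := H.exists_rate_le ht0.le ht1 hD0 hl0 hl hsc
  have hinv : ∀ τ, 0 < τ → τ ≤ τ1 → ∀ x, ∀ ζ ∈ smallJets Λ W τ k x,
      jetStep t h k ζ ∈ smallJets Λ W τ k (h x) := fun τ hτ hττ =>
    H.jetStep_mem_smallJets ht0 htl
      (fun j hj x ζ hζ => hE j hj x ζ (smallJets_mono hττ j x hζ)) k le_rfl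
  obtain ⟨τ2, hτ2, hU⟩ := H.exists_quotient_rate ht0 ht1 hD0 hμ hm hτ1 hq hinv
  obtain ⟨τ3, K3, hτ3, hK3, hG⟩ := H.exists_ball_jetStep_bounds ht0.le ht1 hD0 hD0D (le_refl k)
  obtain ⟨τ4, K4, hτ4, hK4, hr⟩ := H.exists_ball_retraction
  set τ := min (min τ1 τ2) (min (τ3 / 2) (τ4 / 2)) with hτdef
  have hτ : 0 < τ := by positivity
  have hττ1 : τ ≤ τ1 := (min_le_left _ _).trans (min_le_left _ _)
  have hττ2 : τ ≤ τ2 := (min_le_left _ _).trans (min_le_right _ _)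
  have hττ3 : τ ≤ τ3 / 2 := (min_le_right _ _).trans (min_le_left _ _)
  have hττ4 : τ ≤ τ4 / 2 := (min_le_right _ _).trans (min_le_right _ _)
  -- The separation at which the comparison stops: at most one, and small enough that the orbit of
  -- `η` stays in the balls around the zero jets over the orbit of `x`.
  set s := min 1 (min (τ3 / 4) (τ4 / 4)) with hsdef
  have hs : 0 < s := by positivity
  have hs1 : s ≤ 1 := min_le_left _ _
  have hs3 : s ≤ τ3 / 4 := (min_le_right _ _).trans (min_le_left _ _)
  have hs4 : s ≤ τ4 / 4 := (min_le_right _ _).trans (min_le_right _ _)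
  set K := max K3 K4
  have hK : 0 ≤ K := hK3.trans (le_max_left _ _)
  set K' := K + K / (D' - D) with hK'def
  have hK' : 0 ≤ K' := add_nonneg hK (div_nonneg hK (by linarith))
  have hinvτ := hinv τ hτ hττ1
  have hEτ : ∀ x, ∀ ζ ∈ smallJets Λ W τ k x, ∀ v ∈ tangentSpaceOf (jetSet (W x) k) ζ,
      ‖fderiv ℝ (jetStep t h k) ζ v‖ ≤ l * ‖v‖ :=
    fun x ζ hζ => hE k le_rfl x ζ (smallJets_mono hττ1 k x hζ)
  have hUτ := fun x ζ (hζ : ζ ∈ smallJets Λ W τ k x) => hU x ζ (smallJets_mono hττ2 k x hζ)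
  set C1 := (1 + K') * κ ^ φ * s⁻¹ ^ φ with hC1
  have hC1n : 0 ≤ C1 := by positivity
  set C := max (s⁻¹ ^ φ) (K + C1) with hCdef
  have hC : 0 ≤ C := le_trans (by positivity) (le_max_left _ _)
  refine ⟨τ, C, hτ, hC, fun x y ξ hξ η hη v hv => ?_⟩
  set δ := ‖ξ - η‖ with hδ
  rcases eq_or_ne ξ η with rfl | hne
  · have hxy : x = y := hξ.2.2.1.symm.trans hη.2.2.1
    subst hxy
    exact ⟨v, hv, by rw [sub_self, norm_zero]; positivity⟩
  have hδ0 : 0 < δ := norm_pos_iff.2 (sub_ne_zero.2 hne)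
  rcases lt_or_ge s δ with hbig | hsmall
  -- For distant jets the zero vector suffices, since `C * δ ^ φ ≥ 1`.
  · refine ⟨0, Submodule.zero_mem _, ?_⟩
    rw [sub_zero]
    refine le_mul_of_one_le_left (norm_nonneg _) ?_
    calc (1 : ℝ) = (s⁻¹ * s) ^ φ := by rw [inv_mul_cancel₀ hs.ne', Real.one_rpow]
      _ = s⁻¹ ^ φ * s ^ φ := Real.mul_rpow (by positivity) hs.le
      _ ≤ C * δ ^ φ := by
        have := Real.rpow_le_rpow hs.le hbig.le hφ0.le
        have := le_max_left (s⁻¹ ^ φ) (K + C1)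
        gcongr
  -- the number of iterates after which the orbits are separated
  obtain ⟨n, hn1, hn2⟩ : ∃ n : ℕ, κ ^ n ≤ s / δ ∧ s / δ < κ ^ (n + 1) :=
    exists_nat_pow_near ((one_le_div hδ0).2 hsmall) hκ1
  rw [le_div_iff₀ hδ0] at hn1
  rw [div_lt_iff₀ hδ0] at hn2
  have hx := hξ.1
  have hy := hη.1
  obtain ⟨r, U, hrM, hUr, hrL⟩ := hr x hx
  have hξb : ξ ∈ Metric.ball (jetLift k x) τ4 :=
    mem_ball_of_mem_smallJets hτ.le (by linarith) hξ
  have hηb : η ∈ Metric.ball (jetLift k x) τ4 := by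
    have h1 := hξ.2.2.2.norm_sub_jetLift_le hτ.le
    rw [hξ.2.2.1] at h1
    rw [Metric.mem_ball, dist_eq_norm]
    have h2 : η - jetLift k x = (ξ - jetLift k x) - (ξ - η) := by abel
    rw [h2]
    refine (norm_sub_le _ _).trans_lt ?_
    linarith
  have hbU : ∀ ζ ∈ Metric.ball (jetLift k x) τ4, jetBase k ζ ∈ U := by
    intro ζ hζ
    refine hUr ?_
    rw [Metric.mem_ball, dist_eq_norm] at hζ ⊢
    have := norm_jetBase_sub_le k ζ (jetLift k x)
    rw [jetBase_jetLift] at this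
    exact this.trans_lt hζ
  have hξM : ξ ∈ jetSet M k := jetSet_mono (H.subset x hx) k hξ.2.1
  have hηM : η ∈ jetSet M k := jetSet_mono (H.subset y hy) k hη.2.1
  have hvM := tangentSpaceOf_jetSet_mono (H.subset x hx) k ξ hv
  -- The quotient expansion at `η` is available only for vectors tangent to `T^k M`, so `v` is first
  -- projected there, at a cost Lipschitz in `δ`.
  set z := fderiv ℝ (jetMap r k) η v with hz
  have hzM : z ∈ tangentSpaceOf (jetSet M k) η :=
    hrM.fderiv_mem (by omega) hηM (hbU η hηb) v
  have hvz : ‖v - z‖ ≤ K * δ * ‖v‖ := by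
    have h1 := (hrM.mem_tangentSpaceOf_iff (by omega) hξM (hbU ξ hξb)).1 hvM
    calc ‖v - z‖ = ‖(fderiv ℝ (jetMap r k) ξ - fderiv ℝ (jetMap r k) η) v‖ := by
          rw [sub_apply, h1]
      _ ≤ K4 * δ * ‖v‖ := ContinuousLinearMap.le_of_opNorm_le _ (hrL ξ hξb η hηb) v
      _ ≤ K * δ * ‖v‖ := by gcongr; exact le_max_right _ _
  have hξo := iterate_jetStep_mem_smallJets hinvτ hξ
  have hηo := iterate_jetStep_mem_smallJets hinvτ hη
  have hY := transport_mem_leaf H ht0.ne' hlp.le hinvτ hEτ hξ hv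
  have hsep : ∀ j < n, D ^ j * δ < τ3 / 2 := by
    intro j hj
    have h1 : D ^ j ≤ κ ^ n := by
      calc D ^ j ≤ κ ^ j := by gcongr; linarith
        _ ≤ κ ^ n := pow_le_pow_right₀ hκ1.le hj.le
    calc D ^ j * δ ≤ κ ^ n * δ := by gcongr
      _ ≤ s := hn1
      _ < _ := by linarith
  have hcomp := (norm_sub_transport_le (G := jetStep t h k) (p := fun n => jetLift k (h^[n] x))
    (ξ := fun n => (jetStep t h k)^[n] ξ) (η := fun n => (jetStep t h k)^[n] η)
    (Y := transport (jetStep t h k) ξ v) (Z := transport (jetStep t h k) η z) (τ := τ3) (ρ := τ3 / 2)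
    (K := K) (D := D) (D' := D') (σ := σ) (l := l) (δ := δ) (c := ‖v‖) hK hDn hDD' hσ hlp.le hlσ
    hδ0.le (norm_nonneg _) ?_ ?_ ?_ ?_ ?_ (fun _ => rfl) (fun _ => rfl) le_rfl
    (fun n => (hY n).2) hvz n ?_).2
  rotate_left
  · intro j ζ hζ
    obtain ⟨a, b, c⟩ := hG _ (hξo j).1 ζ hζ
    refine ⟨a, b, fun ζ' hζ' => (c ζ' hζ').trans ?_⟩
    gcongr
    exact le_max_left _ _
  · exact fun j => mem_ball_of_mem_smallJets hτ.le (by linarith) (hξo j)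
  · intro j hj
    have h1 := (hξo j).2.2.2.norm_sub_jetLift_le hτ.le
    rw [(hξo j).2.2.1] at h1
    rw [Metric.mem_ball, dist_eq_norm, ← sub_sub_sub_cancel_left _ _ ((jetStep t h k)^[j] ξ)]
    refine (norm_sub_le _ _).trans_lt ?_
    linarith
  · exact fun j => Function.iterate_succ_apply' _ _ _
  · exact fun j => Function.iterate_succ_apply' _ _ _
  · exact hsep
  -- With comparison vector `0` at time `n`, the norm of the transported `z` bounds its distance to
  -- the leaf directions at `η`, multiplied by `m ^ n`.
  obtain ⟨e, he, hme⟩ := (transport_quotient H ht0.ne' hm0.le hinvτ hUτ hη hzM n).2 0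
    (Submodule.zero_mem _)
  rw [sub_zero] at hme
  refine ⟨e, he, ?_⟩
  have hZn : ‖transport (jetStep t h k) η z n‖ ≤ l ^ n * (1 + K') * ‖v‖ := by
    have h1 : ‖transport (jetStep t h k) η z n‖ ≤ ‖transport (jetStep t h k) ξ v n‖ +
        ‖transport (jetStep t h k) ξ v n - transport (jetStep t h k) η z n‖ := by
      have := norm_sub_le (transport (jetStep t h k) ξ v n)
        (transport (jetStep t h k) ξ v n - transport (jetStep t h k) η z n)
      rwa [sub_sub_cancel] at this
    have h2 : (D' * σ) ^ n = l ^ n * κ ^ n := by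
      rw [← mul_pow, hκdef, mul_div_cancel₀ _ hlp.ne']
    calc _ ≤ l ^ n * ‖v‖ + K' * (D' * σ) ^ n * δ * ‖v‖ := h1.trans (add_le_add (hY n).2 hcomp)
      _ = l ^ n * ‖v‖ + K' * l ^ n * (κ ^ n * δ) * ‖v‖ := by rw [h2]; ring
      _ ≤ l ^ n * ‖v‖ + K' * l ^ n * 1 * ‖v‖ := by
        have := hn1.trans hs1
        gcongr
      _ = _ := by ring
  -- Here `l * κ ^ φ ≤ m` is iterated `n` times, and the maximality of `n` turns `κ ^ n` into a
  -- power of `δ`.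
  have hlm : l ^ n ≤ m ^ n * (κ ^ φ * s⁻¹ ^ φ * δ ^ φ) := by
    have hκφ : 0 < κ ^ φ := Real.rpow_pos_of_pos hκ0 _
    have h1 : l ^ n * (κ ^ n) ^ φ ≤ m ^ n := by
      have : (κ ^ n) ^ φ = (κ ^ φ) ^ n := by
        rw [← Real.rpow_natCast, ← Real.rpow_natCast, ← Real.rpow_mul hκ0.le,
          ← Real.rpow_mul hκ0.le, mul_comm]
      rw [this, ← mul_pow]
      gcongr
    have h2 : 1 ≤ (κ ^ n) ^ φ * (κ ^ φ * s⁻¹ ^ φ * δ ^ φ) := by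
      have h3 : (κ ^ n) ^ φ * (κ ^ φ * s⁻¹ ^ φ * δ ^ φ) = (κ ^ n * κ * s⁻¹ * δ) ^ φ := by
        rw [Real.mul_rpow (by positivity) hδ0.le, Real.mul_rpow (by positivity) (by positivity),
          Real.mul_rpow (by positivity) hκ0.le]
        ring
      rw [h3]
      refine Real.one_le_rpow ?_ hφ0.le
      rw [pow_succ] at hn2
      have : κ ^ n * κ * s⁻¹ * δ = (κ ^ n * κ * δ) * s⁻¹ := by ring
      rw [this, ← div_eq_mul_inv, one_le_div hs]
      exact hn2.le
    calc l ^ n ≤ l ^ n * ((κ ^ n) ^ φ * (κ ^ φ * s⁻¹ ^ φ * δ ^ φ)) :=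
          le_mul_of_one_le_right (by positivity) h2
      _ = (l ^ n * (κ ^ n) ^ φ) * (κ ^ φ * s⁻¹ ^ φ * δ ^ φ) := by ring
      _ ≤ _ := by gcongr
  have hze : ‖z - e‖ ≤ C1 * δ ^ φ * ‖v‖ := by
    have h1 : m ^ n * ‖z - e‖ ≤ m ^ n * (C1 * δ ^ φ * ‖v‖) := by
      calc m ^ n * ‖z - e‖ ≤ l ^ n * (1 + K') * ‖v‖ := hme.trans hZn
        _ ≤ (m ^ n * (κ ^ φ * s⁻¹ ^ φ * δ ^ φ)) * (1 + K') * ‖v‖ := by gcongr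
        _ = _ := by rw [hC1]; ring
    exact le_of_mul_le_mul_left h1 (by positivity)
  -- As `δ ≤ 1` and `φ ≤ 1`, the Lipschitz error of the projection is absorbed into the Hölder
  -- bound.
  have hδφ : δ ≤ δ ^ φ := by
    have := Real.rpow_le_rpow_of_exponent_ge hδ0 (hsmall.trans hs1) hφ1
    rwa [Real.rpow_one] at this
  calc ‖v - e‖ ≤ ‖v - z‖ + ‖z - e‖ := norm_sub_le_norm_sub_add_norm_sub v z e
    _ ≤ K * δ ^ φ * ‖v‖ + C1 * δ ^ φ * ‖v‖ := by
        refine add_le_add (hvz.trans ?_) hze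
        gcongr
    _ = (K + C1) * δ ^ φ * ‖v‖ := by ring
    _ ≤ C * δ ^ φ * ‖v‖ := by
        have := le_max_right (s⁻¹ ^ φ) (K + C1)
        gcongr

end IsLeafSystem

end HolderEstimate

/-! ### From rates on a complement to one-step rates on the quotient -/

section Cocycles

variable {V : Type*} [NormedAddCommGroup V] [NormedSpace ℝ V]

lemma infDist_add_mem (E : Submodule ℝ V) (u : V) {e : V} (he : e ∈ E) :
    Metric.infDist (u + e) (E : Set V) = Metric.infDist u (E : Set V) := by
  have key : ∀ (u e : V), e ∈ E →
      Metric.infDist (u + e) (E : Set V) ≤ Metric.infDist u (E : Set V) := by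
    intro u e he
    refine (Metric.le_infDist ⟨0, E.zero_mem⟩).2 fun y hy => ?_
    refine (Metric.infDist_le_dist_of_mem (E.add_mem hy he)).trans ?_
    rw [dist_add_right]
  refine le_antisymm (key u e he) ?_
  have := key (u + e) (-e) (E.neg_mem he)
  rwa [add_neg_cancel_right] at this

lemma exists_norm_sub_eq_infDist [FiniteDimensional ℝ V] (E : Submodule ℝ V) (u : V) :
    ∃ e ∈ E, ‖u - e‖ = Metric.infDist u (E : Set V) := by
  obtain ⟨e, he, hmin⟩ := exists_norm_sub_le_forall E u
  refine ⟨e, he, le_antisymm ?_ ?_⟩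
  · refine (Metric.le_infDist ⟨0, E.zero_mem⟩).2 fun y hy => ?_
    rw [dist_eq_norm]; exact hmin y hy
  · rw [← dist_eq_norm]; exact Metric.infDist_le_dist_of_mem he

/-- A linear cocycle `L` over `f : Λ → Λ` leaving invariant the distribution `E`, with an upper
rate on `E` and a lower rate on a complementary distribution. -/
structure IsRateCocycle (Λ : Set V) (f : V → V) (L : ℕ → V → V →L[ℝ] V) (E U : V → Submodule ℝ V)
    (C F l μ : ℝ) : Prop where
  mapsTo : MapsTo f Λ Λ
  zero : ∀ x ∈ Λ, L 0 x = ContinuousLinearMap.id ℝ V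
  add : ∀ x ∈ Λ, ∀ a b, L (a + b) x = (L a (f^[b] x)).comp (L b x)
  mem : ∀ x ∈ Λ, ∀ n, ∀ v ∈ E x, L n x v ∈ E (f^[n] x)
  norm_le : ∀ x ∈ Λ, ‖L 1 x‖ ≤ F
  upper : ∀ x ∈ Λ, ∀ n, ∀ v ∈ E x, ‖L n x v‖ ≤ C * l ^ n * ‖v‖
  lower : ∀ x ∈ Λ, ∀ n, ∀ v ∈ U x, C⁻¹ * μ ^ n * ‖v‖ ≤ ‖L n x v‖

namespace IsRateCocycle

variable {Λ : Set V} {f : V → V} {L : ℕ → V → V →L[ℝ] V} {E U : V → Submodule ℝ V}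
  {C F l μ : ℝ}

lemma iterate_mem (H : IsRateCocycle Λ f L E U C F l μ) {x : V} (hx : x ∈ Λ) (n : ℕ) :
    f^[n] x ∈ Λ := H.mapsTo.iterate n hx

lemma succ_apply (H : IsRateCocycle Λ f L E U C F l μ) {x : V} (hx : x ∈ Λ) (n : ℕ) (u : V) :
    L (n + 1) x u = L 1 (f^[n] x) (L n x u) := by
  rw [add_comm, H.add x hx 1 n]; rfl

variable [FiniteDimensional ℝ V]

/-- The cocycle preserves `E`, so it maps a nearest point in `E` to a competitor at the next step.
-/
lemma infDist_succ_le (H : IsRateCocycle Λ f L E U C F l μ) {x : V} (hx : x ∈ Λ) (n : ℕ) (u : V) :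
    Metric.infDist (L (n + 1) x u) (E (f^[n + 1] x) : Set V) ≤
      F * Metric.infDist (L n x u) (E (f^[n] x) : Set V) := by
  obtain ⟨e, he, hd⟩ := exists_norm_sub_eq_infDist (E (f^[n] x)) (L n x u)
  have hm := H.mem _ (H.iterate_mem hx n) 1 e he
  rw [← Function.iterate_add_apply, add_comm 1 n] at hm
  rw [← hd]
  refine (Metric.infDist_le_dist_of_mem hm).trans ?_
  rw [dist_eq_norm, H.succ_apply hx, ← map_sub]
  exact ContinuousLinearMap.le_of_opNorm_le _ (H.norm_le _ (H.iterate_mem hx n)) _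

lemma infDist_add_le (H : IsRateCocycle Λ f L E U C F l μ) (hF : 1 ≤ F) {x : V} (hx : x ∈ Λ)
    (n : ℕ) (u : V) : ∀ j : ℕ,
    Metric.infDist (L (n + j) x u) (E (f^[n + j] x) : Set V) ≤
      F ^ j * Metric.infDist (L n x u) (E (f^[n] x) : Set V)
  | 0 => by simp
  | j + 1 => by
    refine (H.infDist_succ_le hx (n + j) u).trans ?_
    rw [pow_succ', mul_assoc]
    exact mul_le_mul_of_nonneg_left (H.infDist_add_le hF hx n u j) (by linarith)

/-- A vector of `U` whose distance to `E` grows slowly for `n` steps grows slowly itself. -/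
lemma norm_le_of_infDist_le (H : IsRateCocycle Λ f L E U C F l μ) (hC : 0 < C) (hF : 1 ≤ F)
    (hl : 0 ≤ l) {θ : ℝ} (hθ : l < θ) {x : V} (hx : x ∈ Λ) (w : V) (n : ℕ)
    (hd : ∀ j ≤ n, Metric.infDist (L j x w) (E (f^[j] x) : Set V) ≤ θ ^ j * ‖w‖) :
    ‖L n x w‖ ≤ (1 + 2 * C + 2 * F * C / (θ - l)) * θ ^ n * ‖w‖ := by
  have hθl : 0 < θ - l := sub_pos.2 hθ
  have hθ0 : 0 ≤ θ := hl.trans hθ.le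
  choose e he hed using fun j => exists_norm_sub_eq_infDist (E (f^[j] x)) (L j x w)
  have he0 : ‖e 0‖ ≤ 2 * ‖w‖ := by
    have h1 := hed 0
    have h2 := hd 0 (Nat.zero_le _)
    rw [← h1, H.zero x hx] at h2
    simp only [ContinuousLinearMap.id_apply, pow_zero, one_mul] at h2
    have := norm_sub_le w (w - e 0)
    rw [sub_sub_cancel] at this
    linarith
  have hstep : ∀ j < n, ‖L 1 (f^[j] x) (e j) - e (j + 1)‖ ≤ 2 * F * (θ ^ j * ‖w‖) := by
    intro j hj
    have h1 : L 1 (f^[j] x) (e j) - e (j + 1) =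
        (L (j + 1) x w - e (j + 1)) - L 1 (f^[j] x) (L j x w - e j) := by
      rw [H.succ_apply hx, map_sub]; abel
    have h2 : ‖L 1 (f^[j] x) (L j x w - e j)‖ ≤ F * (θ ^ j * ‖w‖) := by
      refine (ContinuousLinearMap.le_of_opNorm_le _ (H.norm_le _ (H.iterate_mem hx j)) _).trans ?_
      rw [hed j]
      exact mul_le_mul_of_nonneg_left (hd j hj.le) (by linarith)
    have h3 : ‖L (j + 1) x w - e (j + 1)‖ ≤ F * (θ ^ j * ‖w‖) := by
      rw [hed (j + 1)]
      exact (H.infDist_succ_le hx j w).trans (mul_le_mul_of_nonneg_left (hd j hj.le) (by linarith))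
    rw [h1]
    refine (norm_sub_le _ _).trans ?_
    linarith
  have hmem : ∀ j, L 1 (f^[j] x) (e j) - e (j + 1) ∈ E (f^[j + 1] x) := by
    intro j
    have hm := H.mem _ (H.iterate_mem hx j) 1 (e j) (he j)
    rw [← Function.iterate_add_apply, add_comm 1 j] at hm
    exact Submodule.sub_mem _ hm (he (j + 1))
  -- The nearest points `e j` form a pseudo-orbit in `E`. Pushing each forward to time `n` gives a
  -- telescoping sum between the image of `e 0` and `e n`, whose terms grow at most at the rate `l`
  -- after time `j`.
  set a : ℕ → V := fun j => L (n - j) (f^[j] x) (e j) with ha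
  have hsum : ‖a 0 - a n‖ ≤ ∑ j ∈ Finset.range n,
      C * l ^ (n - 1 - j) * (2 * F * (θ ^ j * ‖w‖)) := by
    rw [← dist_eq_norm]
    refine (dist_le_range_sum_dist a n).trans (Finset.sum_le_sum fun j hj => ?_)
    have hjn : j < n := Finset.mem_range.1 hj
    have h1 : a j - a (j + 1) =
        L (n - 1 - j) (f^[j + 1] x) (L 1 (f^[j] x) (e j) - e (j + 1)) := by
      have h2 : n - j = (n - 1 - j) + 1 := by omega
      have h3 : n - (j + 1) = n - 1 - j := by omega
      simp only [ha]
      rw [h3, h2, H.add _ (H.iterate_mem hx j) (n - 1 - j) 1, map_sub,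
        ← Function.iterate_add_apply, add_comm 1 j]
      rfl
    rw [dist_eq_norm, h1]
    refine (H.upper _ (H.iterate_mem hx (j + 1)) _ _ (hmem j)).trans ?_
    exact mul_le_mul_of_nonneg_left (hstep j hjn) (by positivity)
  have hgeom : ∑ j ∈ Finset.range n, C * l ^ (n - 1 - j) * (2 * F * (θ ^ j * ‖w‖)) ≤
      2 * F * C / (θ - l) * θ ^ n * ‖w‖ := by
    have h1 : ∑ j ∈ Finset.range n, C * l ^ (n - 1 - j) * (2 * F * (θ ^ j * ‖w‖)) =
        2 * F * C * ‖w‖ * ∑ j ∈ Finset.range n, θ ^ j * l ^ (n - 1 - j) := by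
      rw [Finset.mul_sum]
      exact Finset.sum_congr rfl fun j _ => by ring
    have h2 : ∑ j ∈ Finset.range n, θ ^ j * l ^ (n - 1 - j) ≤ θ ^ n / (θ - l) := by
      rw [le_div_iff₀ hθl, (Commute.all θ l).geom_sum₂_mul]
      have := pow_nonneg hl n
      linarith
    rw [h1]
    calc _ ≤ 2 * F * C * ‖w‖ * (θ ^ n / (θ - l)) := by gcongr
      _ = _ := by ring
  have hen : ‖a n‖ ≤ ‖a 0‖ + ‖a 0 - a n‖ := by
    have := norm_sub_le (a 0) (a 0 - a n)
    rwa [sub_sub_cancel] at this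
  have han : a n = e n := by
    simp only [ha]
    rw [Nat.sub_self, H.zero _ (H.iterate_mem hx n)]; rfl
  have ha0 : ‖a 0‖ ≤ C * θ ^ n * (2 * ‖w‖) := by
    refine (H.upper x hx n _ (he 0)).trans ?_
    gcongr
  have hfin : ‖L n x w‖ ≤ ‖L n x w - e n‖ + ‖e n‖ := by
    have := norm_add_le (L n x w - e n) (e n)
    rwa [sub_add_cancel] at this
  have hdn := hd n le_rfl
  rw [← hed n] at hdn
  rw [← han] at hfin hdn
  calc ‖L n x w‖ ≤ θ ^ n * ‖w‖ + (C * θ ^ n * (2 * ‖w‖) +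
        2 * F * C / (θ - l) * θ ^ n * ‖w‖) := by linarith [hsum.trans hgeom]
    _ = _ := by ring

/-- Modulo `E` only the component `w` in `U` matters. If its distance to `E` grew slower than `θ ^
j` at all times up to `N`, then `norm_le_of_infDist_le` would bound `w` itself by a multiple of `θ ^
N`, contradicting the lower rate `μ > θ`. No invariance of `U` is involved. -/
lemma exists_growth_time (H : IsRateCocycle Λ f L E U C F l μ) (hC : 0 < C) (hF : 1 ≤ F)
    (hl : 0 ≤ l) {θ : ℝ} (hθ : l < θ) (hθμ : θ < μ) :
    ∃ N : ℕ, 1 ≤ N ∧ ∀ x ∈ Λ, ∀ u ∈ E x ⊔ U x, ∃ j : ℕ, 1 ≤ j ∧ j ≤ N ∧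
      θ ^ j * Metric.infDist u (E x : Set V) ≤
        Metric.infDist (L j x u) (E (f^[j] x) : Set V) := by
  have hθ0 : 0 < θ := hl.trans_lt hθ
  set K := 1 + 2 * C + 2 * F * C / (θ - l)
  have hK : 0 < K := by
    have := sub_pos.2 hθ
    positivity
  obtain ⟨N, hN⟩ := pow_unbounded_of_one_lt (K * C) ((one_lt_div hθ0).2 hθμ)
  have hlt : K * θ ^ (N + 1) < C⁻¹ * μ ^ (N + 1) := by
    have h1 : K * C < (μ / θ) ^ (N + 1) := hN.trans_le
      (pow_le_pow_right₀ ((one_lt_div hθ0).2 hθμ).le (Nat.le_succ N))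
    rw [div_pow, lt_div_iff₀ (by positivity)] at h1
    rw [inv_mul_eq_div, lt_div_iff₀ hC]
    linarith
  refine ⟨N + 1, by omega, fun x hx u hu => ?_⟩
  obtain ⟨e, he, w, hw, rfl⟩ := Submodule.mem_sup.1 hu
  have hd : ∀ j, Metric.infDist (L j x (e + w)) (E (f^[j] x) : Set V) =
      Metric.infDist (L j x w) (E (f^[j] x) : Set V) := by
    intro j
    rw [map_add, add_comm]
    exact infDist_add_mem _ _ (H.mem x hx j e he)
  have hd0 : Metric.infDist (e + w) (E x : Set V) = Metric.infDist w (E x : Set V) := by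
    rw [add_comm]; exact infDist_add_mem _ _ he
  rw [hd0]
  simp only [hd]
  by_contra hcon
  push Not at hcon
  have hdw : Metric.infDist w (E x : Set V) ≤ ‖w‖ := by
    have := Metric.infDist_le_dist_of_mem (x := w) (E x).zero_mem
    rwa [dist_zero_right] at this
  have hle := H.norm_le_of_infDist_le hC hF hl hθ hx w (N + 1) fun j hj => by
    rcases Nat.eq_zero_or_pos j with rfl | hj0
    · rw [H.zero x hx, pow_zero, one_mul]; exact hdw
    · exact (hcon j hj0 hj).le.trans (mul_le_mul_of_nonneg_left hdw (by positivity))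
  have hge := H.lower x hx (N + 1) w hw
  have hw0 : 0 < ‖w‖ := by
    rcases (norm_nonneg w).eq_or_lt with h0 | h0
    · exfalso
      have := hcon 1 le_rfl (by omega)
      have h1 := Metric.infDist_nonneg (x := L 1 x w) (s := (E (f^[1] x) : Set V))
      rw [← h0] at hdw
      have h2 : θ ^ 1 * Metric.infDist w (E x : Set V) ≤ 0 :=
        mul_nonpos_of_nonneg_of_nonpos (by positivity) hdw
      linarith
    · exact h0
  have := mul_lt_mul_of_pos_right hlt hw0
  linarith

/-- Growth times are concatenated, so every interval `[n, n + N]` contains a time `T` at which the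
distance has grown by `θ ^ T`. Between `n` and `T` it grows by at most `F` per step. -/
lemma exists_quotient_lower_bound (H : IsRateCocycle Λ f L E U C F l μ) (hC : 0 < C) (hF : 1 ≤ F)
    (hl : 0 ≤ l) {θ : ℝ} (hθ : l < θ) (hθμ : θ < μ)
    (hA : ∀ x ∈ Λ, ∀ n, ∀ u ∈ E x ⊔ U x, L n x u ∈ E (f^[n] x) ⊔ U (f^[n] x)) :
    ∃ c : ℝ, 0 < c ∧ ∀ x ∈ Λ, ∀ u ∈ E x ⊔ U x, ∀ n : ℕ,
      c * θ ^ n * Metric.infDist u (E x : Set V) ≤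
        Metric.infDist (L n x u) (E (f^[n] x) : Set V) := by
  have hθ0 : 0 < θ := hl.trans_lt hθ
  obtain ⟨N, hN, hg⟩ := H.exists_growth_time hC hF hl hθ hθμ
  have hF0 : 0 < F := by linarith
  -- The loss in going back from `T` to `n` is `(θ / F) ^ (T - n)`; replacing `θ` by `min 1 θ` makes
  -- the base at most one, so `T - n ≤ N` gives a uniform bound.
  refine ⟨(min 1 θ / F) ^ N, by positivity, fun x hx u hu n => ?_⟩
  have key : ∀ n : ℕ, ∃ T : ℕ, n ≤ T ∧ T ≤ n + N ∧ θ ^ T * Metric.infDist u (E x : Set V) ≤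
      Metric.infDist (L T x u) (E (f^[T] x) : Set V) := by
    intro n
    induction n with
    | zero => exact ⟨0, le_rfl, by omega, by rw [H.zero x hx, pow_zero, one_mul]; exact le_rfl⟩
    | succ n ih =>
      obtain ⟨T, h1, h2, h3⟩ := ih
      rcases Nat.lt_or_ge n T with hlt | hge
      · exact ⟨T, hlt, by omega, h3⟩
      · obtain rfl : T = n := by omega
        obtain ⟨j, hj1, hj2, h4⟩ := hg _ (H.iterate_mem hx T) _ (hA x hx T u hu)
        refine ⟨j + T, by omega, by omega, ?_⟩
        rw [H.add x hx j T, Function.iterate_add_apply, pow_add, mul_assoc]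
        exact (mul_le_mul_of_nonneg_left h3 (by positivity)).trans h4
  obtain ⟨T, h1, h2, h3⟩ := key n
  obtain ⟨j, rfl⟩ := Nat.exists_eq_add_of_le h1
  have hjN : j ≤ N := by omega
  have h4 := h3.trans (H.infDist_add_le hF hx n u j)
  set d0 := Metric.infDist u (E x : Set V)
  set dn := Metric.infDist (L n x u) (E (f^[n] x) : Set V)
  have hd0 : 0 ≤ d0 := Metric.infDist_nonneg
  have h5 : (min 1 θ / F) ^ N ≤ (min 1 θ / F) ^ j := by
    refine pow_le_pow_of_le_one (by positivity) ?_ hjN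
    rw [div_le_one hF0]
    exact (min_le_left _ _).trans hF
  have h6 : (min 1 θ) ^ j ≤ θ ^ j := pow_le_pow_left₀ (by positivity) (min_le_right _ _) j
  calc (min 1 θ / F) ^ N * θ ^ n * d0 ≤ (min 1 θ / F) ^ j * θ ^ n * d0 := by gcongr
    _ = (min 1 θ) ^ j * θ ^ n * d0 / F ^ j := by rw [div_pow]; ring
    _ ≤ θ ^ j * θ ^ n * d0 / F ^ j := by gcongr
    _ ≤ dn := by
      rw [div_le_iff₀ (by positivity), ← pow_add, add_comm j n, mul_comm dn]
      exact h4

/-- A large iterate satisfies the rates, up to a small loss, in one step. -/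
lemma exists_one_step (H : IsRateCocycle Λ f L E U C F l μ) (hC : 0 < C) (hF : 1 ≤ F)
    (hl : 0 ≤ l) {l' m : ℝ} (hl' : l < l') (hm0 : 0 < m) (hm : m < μ) (hlμ : l < μ)
    (hA : ∀ x ∈ Λ, ∀ n, ∀ u ∈ E x ⊔ U x, L n x u ∈ E (f^[n] x) ⊔ U (f^[n] x)) :
    ∃ N : ℕ, 1 ≤ N ∧ ∀ x ∈ Λ, (∀ v ∈ E x, ‖L N x v‖ ≤ l' ^ N * ‖v‖) ∧
      ∀ u ∈ E x ⊔ U x, ∀ e' ∈ E (f^[N] x), ∃ e ∈ E x, m ^ N * ‖u - e‖ ≤ ‖L N x u - e'‖ := by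
  -- An intermediate rate between `max m l` and `μ`: the gaps `l < l'` and `m < θ` let a large
  -- iterate absorb the constants.
  obtain ⟨θ, hθ1, hθ2⟩ := exists_between (max_lt hm hlμ)
  have hmθ : m < θ := (le_max_left _ _).trans_lt hθ1
  have hlθ : l < θ := (le_max_right _ _).trans_lt hθ1
  obtain ⟨c, hc, hq⟩ := H.exists_quotient_lower_bound hC hF hl hlθ hθ2 hA
  have hl'0 : 0 < l' := hl.trans_lt hl'
  have e1 : ∀ᶠ n : ℕ in atTop, C * l ^ n ≤ l' ^ n := by
    have : Tendsto (fun n : ℕ => C * (l / l') ^ n) atTop (𝓝 (C * 0)) :=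
      (tendsto_pow_atTop_nhds_zero_of_lt_one (by positivity)
        ((div_lt_one hl'0).2 hl')).const_mul C
    rw [mul_zero] at this
    filter_upwards [this.eventually_lt_const one_pos] with n hn
    rw [div_pow, ← mul_div_assoc, div_lt_one (by positivity)] at hn
    exact hn.le
  have e2 : ∀ᶠ n : ℕ in atTop, m ^ n ≤ c * θ ^ n := by
    have hθ0 : 0 < θ := hm0.trans hmθ
    have := tendsto_pow_atTop_nhds_zero_of_lt_one (r := m / θ) (by positivity)
      ((div_lt_one hθ0).2 hmθ)
    filter_upwards [this.eventually_lt_const hc] with n hn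
    rw [div_pow, div_lt_iff₀ (by positivity)] at hn
    exact hn.le
  obtain ⟨N, ⟨h1, h2⟩, h3⟩ := ((e1.and e2).and (eventually_ge_atTop 1)).exists
  refine ⟨N, h3, fun x hx => ⟨fun v hv => (H.upper x hx N v hv).trans
    (mul_le_mul_of_nonneg_right h1 (norm_nonneg _)), fun u hu e' he' => ?_⟩⟩
  obtain ⟨e, he, hd⟩ := exists_norm_sub_eq_infDist (E x) u
  refine ⟨e, he, ?_⟩
  rw [hd]
  calc _ ≤ c * θ ^ N * Metric.infDist u (E x : Set V) :=
        mul_le_mul_of_nonneg_right h2 Metric.infDist_nonneg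
    _ ≤ _ := hq x hx u hu N
    _ ≤ ‖L N x u - e'‖ := by
        rw [← dist_eq_norm]; exact Metric.infDist_le_dist_of_mem he'

end IsRateCocycle

end Cocycles

/-! ### Iterates of the map and the `C^k` norm -/

section Iterates

set_option linter.unusedSectionVars false

lemma natCast_le_infty (n : ℕ) : (n : WithTop ℕ∞) ≤ ∞ := by exact_mod_cast le_top

variable {V : Type*} [NormedAddCommGroup V] [NormedSpace ℝ V]

lemma contDiffAt_iterate {M : Set V} {f : V → V} {n : WithTop ℕ∞} (hm : MapsTo f M M)
    (hf : ∀ x ∈ M, ContDiffAt ℝ n f x) : ∀ (j : ℕ), ∀ x ∈ M, ContDiffAt ℝ n f^[j] x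
  | 0, _, _ => contDiffAt_id
  | j + 1, x, hx => by
    rw [Function.iterate_succ]
    exact (contDiffAt_iterate hm hf j (f x) (hm hx)).comp x (hf x hx)

lemma eventually_iterate_mem {Λ : Set V} {f : V → V} {W : V → Set V} (hm : MapsTo f Λ Λ)
    (hf : ∀ x ∈ Λ, ContinuousAt f x)
    (hW : ∀ x ∈ Λ, ∀ᶠ y in 𝓝 x, y ∈ W x → f y ∈ W (f x)) :
    ∀ (j : ℕ), ∀ x ∈ Λ, ∀ᶠ y in 𝓝 x, y ∈ W x → f^[j] y ∈ W (f^[j] x)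
  | 0, _, _ => Eventually.of_forall fun _ h => h
  | j + 1, x, hx => by
    have h1 := (hf x hx).eventually (eventually_iterate_mem hm hf hW j (f x) (hm hx))
    filter_upwards [h1, hW x hx] with y hy1 hy2 hy
    exact hy1 (hy2 hy)

lemma norm_fderiv_le_cNorm {Λ : Set V} {f : V → V} {k : ℕ} (hk : 1 ≤ k) (hΛ : IsCompact Λ)
    (hf : ∀ x ∈ Λ, ContDiffAt ℝ ∞ f x) {x : V} (hx : x ∈ Λ) : ‖fderiv ℝ f x‖ ≤ cNorm k f Λ := by
  have hb : ∀ j : ℕ, ∃ B : ℝ, ∀ y ∈ Λ, ‖iteratedFDeriv ℝ j f y‖ ≤ B := by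
    intro j
    have hc : ContinuousOn (iteratedFDeriv ℝ j f) Λ := fun y hy =>
      ((hf y hy).iteratedFDeriv_right (m := 0) (i := j)
        (by rw [zero_add]; exact natCast_le_infty j)).continuousAt.continuousWithinAt
    exact hΛ.exists_bound_of_continuousOn hc
  choose B hB using hb
  -- A real supremum dominates its terms only when the family is bounded; compactness of `Λ`
  -- provides the bound.
  set B' := ∑ j ∈ Finset.range (k + 1), |B j|
  have hB' : ∀ y ∈ Λ, ∀ j : Fin (k + 1), ‖iteratedFDeriv ℝ (j : ℕ) f y‖ ≤ B' := by
    intro y hy j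
    refine ((hB j y hy).trans (le_abs_self _)).trans ?_
    exact Finset.single_le_sum (f := fun j => |B j|) (fun _ _ => abs_nonneg _)
      (Finset.mem_range.2 j.2)
  have h1 : ‖fderiv ℝ f x‖ ≤ ⨆ j : Fin (k + 1), ‖iteratedFDeriv ℝ (j : ℕ) f x‖ := by
    have := le_ciSup (f := fun j : Fin (k + 1) => ‖iteratedFDeriv ℝ (j : ℕ) f x‖)
      ⟨B', by rintro _ ⟨j, rfl⟩; exact hB' x hx j⟩ ⟨1, by omega⟩
    simpa only [norm_iteratedFDeriv_one] using this
  refine h1.trans (le_ciSup (f := fun y : Λ => ⨆ j : Fin (k + 1), ‖iteratedFDeriv ℝ (j : ℕ) f y‖)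
    ⟨B', ?_⟩ ⟨x, hx⟩)
  rintro _ ⟨y, rfl⟩
  exact ciSup_le fun j => hB' y y.2 j

end Iterates

/-! ### The exponent and the choice of the scaling factor -/

section Parameters

/-- The defining property of the exponent: it makes the growth ratio `b / l` match the spectral
ratio `μ / l`. -/
lemma rpow_holderExponent {l μ b : ℝ} (hl : 0 < l) (hμ : 0 < μ) (hb : l < b) :
    (b / l) ^ holderExponent l μ b = μ / l := by
  have hb0 : 0 < b := hl.trans hb
  have h1 : Real.log b - Real.log l ≠ 0 := (sub_pos.2 (Real.log_lt_log hl hb)).ne'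
  rw [Real.rpow_def_of_pos (by positivity), Real.log_div hb0.ne' hl.ne', holderExponent,
    mul_div_cancel₀ _ h1, ← Real.log_div hμ.ne' hl.ne', Real.exp_log (by positivity)]

lemma holderExponent_pos {l μ b : ℝ} (hl : 0 < l) (hlμ : l < μ) (hb : l < b) :
    0 < holderExponent l μ b :=
  div_pos (sub_pos.2 (Real.log_lt_log hl hlμ)) (sub_pos.2 (Real.log_lt_log hl hb))

lemma holderExponent_le_one {l μ b : ℝ} (hl : 0 < l) (hμ : 0 < μ) (hb : l < b) (hμb : μ ≤ b) :
    holderExponent l μ b ≤ 1 :=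
  (div_le_one (sub_pos.2 (Real.log_lt_log hl hb))).2
    (sub_le_sub_right (Real.log_le_log hμ hμb) _)

/-- The choice of the scaling factor `σ` and of the rate `l'`. -/
lemma exists_scaling {l μ F b : ℝ} {k : ℕ} (hl : 0 < l) (hlμ : l < μ) (hμF : μ ≤ F) (hF : 1 ≤ F)
    (hk : 1 ≤ k → l ^ (k + 2) < μ) (hb : (2 * F) ^ (k + 1) * F < b) :
    ∃ σ l' : ℝ, 1 ≤ σ ∧ l < l' ∧ l' ≤ σ ∧
      l' * (2 * F * σ / l') ^ holderExponent l μ b * σ ^ k < μ := by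
  have hF0 : 0 < F := by linarith
  have hμ : 0 < μ := hl.trans hlμ
  have h2F : 1 ≤ 2 * F := by linarith
  have h2Fk : 2 * F ≤ (2 * F) ^ (k + 1) := le_self_pow₀ h2F (by omega)
  have h2Fb : 2 * F < b := by
    refine lt_of_le_of_lt (h2Fk.trans ?_) hb
    exact le_mul_of_one_le_right (by positivity) hF
  have hlb : l < b := by linarith
  set φ := holderExponent l μ b
  have hφ : 0 < φ := holderExponent_pos hl hlμ hlb
  have hrel : (b / l) ^ φ = μ / l := rpow_holderExponent hl hμ hlb
  -- For `l < 1` the choice `σ = 1` suffices, since velocities contract without rescaling. For `l ≥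
  -- 1` the choice `σ = l'` is the smallest that keeps velocities bounded. In both cases the strict
  -- inequality is checked at `l' = l` and extended by continuity.
  rcases lt_or_ge l 1 with hl1 | hl1
  · have hlim : ∀ᶠ l' in 𝓝[>] l, l' * (2 * F * 1 / l') ^ φ * 1 ^ k < μ := by
      have hc : ContinuousAt (fun l' : ℝ => l' * (2 * F * 1 / l') ^ φ * 1 ^ k) l := by
        have : ContinuousAt (fun l' : ℝ => (2 * F * 1 / l')) l :=
          continuousAt_const.div continuousAt_id hl.ne'
        exact (continuousAt_id.mul (this.rpow_const (Or.inr hφ.le))).mul continuousAt_const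
      refine (hc.eventually_lt_const ?_).filter_mono nhdsWithin_le_nhds
      simp only [one_pow, mul_one]
      have : (2 * F / l) ^ φ < μ / l := by
        rw [← hrel]
        exact Real.rpow_lt_rpow (by positivity) (by gcongr) hφ
      rw [lt_div_iff₀ hl] at this
      linarith
    have hlt : ∀ᶠ l' in 𝓝[>] l, l' < 1 := (eventually_lt_nhds hl1).filter_mono nhdsWithin_le_nhds
    obtain ⟨l', ⟨h1, h2⟩, h3⟩ := ((hlim.and hlt).and self_mem_nhdsWithin).exists
    exact ⟨1, l', le_rfl, h3, h2.le, h1⟩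
  · have hlim : ∀ᶠ l' in 𝓝[>] l, l' ^ (k + 1) * (2 * F) ^ φ < μ := by
      have hc : Continuous (fun l' : ℝ => l' ^ (k + 1) * (2 * F) ^ φ) := by fun_prop
      refine ((hc.tendsto l).eventually_lt_const ?_).filter_mono nhdsWithin_le_nhds
      have h1 : (2 * F) ^ (k + 1) < b / l := by
        rw [lt_div_iff₀ hl]
        refine lt_of_le_of_lt ?_ hb
        gcongr
        linarith
      have h2 : ((2 * F) ^ φ) ^ (k + 1) < μ / l := by
        have e : ((2 * F) ^ φ) ^ (k + 1) = ((2 * F) ^ (k + 1)) ^ φ := by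
          rw [← Real.rpow_natCast, ← Real.rpow_natCast, ← Real.rpow_mul (by positivity),
            ← Real.rpow_mul (by positivity), mul_comm φ]
        rw [e, ← hrel]
        exact Real.rpow_lt_rpow (by positivity) h1 hφ
      -- Cleared of denominators, this is the `k`-th power of `l ^ (k + 2) < μ`; for `k = 0` it is
      -- an equality and needs no such condition.
      have h3 : μ / l ≤ (μ / l ^ (k + 1)) ^ (k + 1) := by
        rw [div_pow, div_le_div_iff₀ hl (by positivity)]
        have h4 : (l ^ (k + 2)) ^ k ≤ μ ^ k := by
          rcases Nat.eq_zero_or_pos k with rfl | hk0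
          · simp
          · exact pow_le_pow_left₀ (by positivity) (hk hk0).le k
        calc μ * (l ^ (k + 1)) ^ (k + 1) = μ * l * (l ^ (k + 2)) ^ k := by ring
          _ ≤ μ * l * μ ^ k := by gcongr
          _ = μ ^ (k + 1) * l := by ring
      have h5 : (2 * F) ^ φ < μ / l ^ (k + 1) :=
        lt_of_pow_lt_pow_left₀ (k + 1) (by positivity) (h2.trans_le h3)
      rw [lt_div_iff₀ (by positivity)] at h5
      linarith
    obtain ⟨l', h1, h3⟩ := (hlim.and self_mem_nhdsWithin).exists
    have h3' : l < l' := h3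
    have hl'0 : 0 < l' := hl.trans h3'
    refine ⟨l', l', by linarith, h3', le_rfl, ?_⟩
    rw [mul_div_cancel_right₀ _ hl'0.ne']
    calc _ = l' ^ (k + 1) * (2 * F) ^ φ := by ring
      _ < μ := h1

/-- A crude comparison: `3 ^ (4 * (k + 1))` beats `2 ^ (k + 1)`, and the other factors of `b` are at
least one. -/
lemma pow_mul_lt_bConst {V : Type*} [NormedAddCommGroup V] [NormedSpace ℝ V] {f : V → V}
    {Λ : Set V} {k : ℕ} (hF : 1 ≤ cNorm (k + 4) f Λ) :
    (2 * cNorm (k + 4) f Λ) ^ (k + 1) * cNorm (k + 4) f Λ < bConst (k + 1) f Λ := by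
  change _ < 3 ^ (4 * (k + 1)) * ((k + 1 + 1).factorial : ℝ) *
    2 ^ ((k + 1 + 2) * (k + 1 + 3) / 2) * cNorm (k + 4) f Λ ^ (k + 4)
  set F := cNorm (k + 4) f Λ
  have hF0 : 0 < F := by linarith
  have h1 : (2 : ℝ) ^ (k + 1) < 3 ^ (4 * (k + 1)) := by
    calc (2 : ℝ) ^ (k + 1) < 3 ^ (k + 1) := by gcongr; norm_num
      _ ≤ 3 ^ (4 * (k + 1)) := pow_le_pow_right₀ (by norm_num) (by omega)
  have h2 : (1 : ℝ) ≤ ((k + 1 + 1).factorial : ℝ) := by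
    exact_mod_cast Nat.one_le_iff_ne_zero.2 (Nat.factorial_ne_zero _)
  have h3 : (1 : ℝ) ≤ 2 ^ ((k + 1 + 2) * (k + 1 + 3) / 2) := one_le_pow₀ (by norm_num)
  calc (2 * F) ^ (k + 1) * F = 2 ^ (k + 1) * F ^ (k + 2) := by ring
    _ < 3 ^ (4 * (k + 1)) * F ^ (k + 2) := by gcongr
    _ = 3 ^ (4 * (k + 1)) * 1 * 1 * F ^ (k + 2) := by ring
    _ ≤ _ := by
      gcongr
      · omega

end Parameters

/-! ### Hölder continuity of the jet distributions -/

section HolderDistribution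

variable {V : Type*} [NormedAddCommGroup V]

lemma subspaceDist_le [NormedSpace ℝ V] {A B : Submodule ℝ V} {ε : ℝ} (hε : 0 ≤ ε)
    (h1 : GapLE A B ε) (h2 : GapLE B A ε) : subspaceDist A B ≤ ε := by
  have key : ∀ {A B : Submodule ℝ V}, GapLE A B ε → ∀ v : {v : V // v ∈ A ∧ ‖v‖ = 1},
      Metric.infDist (v : V) (B : Set V) ≤ ε := by
    intro A B h v
    obtain ⟨w, hw, hd⟩ := h v v.2.1
    rw [v.2.2, mul_one, ← dist_eq_norm] at hd
    exact (Metric.infDist_le_dist_of_mem hw).trans hd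
  -- For the zero subspace the supremum is over an empty unit sphere and equals `0`, so `0 ≤ ε` is
  -- needed.
  exact max_le (Real.iSup_le (key h1) hε) (Real.iSup_le (key h2) hε)

/-- Rescaling by `t ≤ τ` makes the velocities at most `τ`, does not increase distances of jets,
carries tangent spaces to tangent spaces and shrinks vectors by at most `t ^ k`. Only the constant
suffers. -/
lemma isHolderJetDistribution_of_smallJets [NormedSpace ℝ V] {k : ℕ} {Λ : Set V} {W : V → Set V}
    {φ τ C : ℝ} (hφ : 0 ≤ φ) (hτ : 0 < τ) (hC : 0 ≤ C)
    (h : ∀ x y, ∀ ξ ∈ IsLeafSystem.smallJets Λ W τ k x, ∀ η ∈ IsLeafSystem.smallJets Λ W τ k y,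
      GapLE (tangentSpaceOf (jetSet (W x) k) ξ) (tangentSpaceOf (jetSet (W y) k) η)
        (C * ‖ξ - η‖ ^ φ)) : IsHolderJetDistribution k Λ W φ := by
  set t := min τ 1
  have ht0 : 0 < t := by positivity
  have ht1 : t ≤ 1 := min_le_right _ _
  have hs : ∀ x ∈ Λ, ∀ ξ ∈ jetSet (W x) k, jetBase k ξ = x → VelocitiesLeOne k ξ →
      jetScale V t k ξ ∈ IsLeafSystem.smallJets Λ W τ k x := by
    intro x hx ξ hξ hb hv
    refine ⟨hx, jetScale_mem_jetSet t k ξ hξ, by rw [jetBase_jetScale, hb], ?_⟩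
    refine (hv.velocitiesLE.jetScale ht0.le ht1).mono ?_
    rw [mul_one]; exact min_le_left _ _
  have key : ∀ x ∈ Λ, ∀ y ∈ Λ, ∀ ξ ∈ jetSet (W x) k, ∀ η ∈ jetSet (W y) k,
      jetBase k ξ = x → jetBase k η = y → VelocitiesLeOne k ξ → VelocitiesLeOne k η →
      GapLE (tangentSpaceOf (jetSet (W x) k) ξ) (tangentSpaceOf (jetSet (W y) k) η)
        (C / t ^ k * ‖ξ - η‖ ^ φ) := by
    intro x hx y hy ξ hξ η hη hbx hby hvx hvy v hv
    have hξ' := hs x hx ξ hξ hbx hvx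
    have hη' := hs y hy η hη hby hvy
    obtain ⟨w', hw', hd⟩ := h x y _ hξ' _ hη' (jetScale V t k v)
      (jetScale_mem_tangentSpaceOf ht0.ne' hξ hv)
    have hinv : ∀ p : JetSpace V k, jetScale V t⁻¹ k (jetScale V t k p) = p := by
      intro p
      have := jetScale_jetScale_inv (V := V) (inv_ne_zero ht0.ne') k p
      rwa [inv_inv] at this
    refine ⟨jetScale V t⁻¹ k w', ?_, ?_⟩
    · have := jetScale_mem_tangentSpaceOf (inv_ne_zero ht0.ne') hη'.2.1 hw'
      rwa [hinv] at this
    · have h1 := le_norm_jetScale ht0.le ht1 k (v - jetScale V t⁻¹ k w')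
      rw [map_sub, jetScale_jetScale_inv ht0.ne'] at h1
      have h2 : ‖jetScale V t k ξ - jetScale V t k η‖ ^ φ ≤ ‖ξ - η‖ ^ φ := by
        rw [← map_sub]
        exact Real.rpow_le_rpow (norm_nonneg _) (norm_jetScale_le ht0.le ht1 k _) hφ
      have h3 := norm_jetScale_le ht0.le ht1 k v
      have h4 : t ^ k * ‖v - jetScale V t⁻¹ k w'‖ ≤ C * ‖ξ - η‖ ^ φ * ‖v‖ := by
        refine h1.trans (hd.trans ?_)
        gcongr
      have h5 : C / t ^ k * ‖ξ - η‖ ^ φ * ‖v‖ = C * ‖ξ - η‖ ^ φ * ‖v‖ / t ^ k := by ring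
      rw [h5, le_div_iff₀ (by positivity), mul_comm]
      exact h4
  refine ⟨C / t ^ k, fun x hx y hy ξ hξ η hη hbx hby hvx hvy => subspaceDist_le (by positivity)
    (key x hx y hy ξ hξ η hη hbx hby hvx hvy) ?_⟩
  rw [norm_sub_rev]
  exact key y hy x hx η hη ξ hξ hby hbx hvy hvx

variable [InnerProductSpace ℝ V] [FiniteDimensional ℝ V]

lemma isLeafSystem_iterate {k : ℕ} {M Λ : Set V} {f : V → V} {A : V → Submodule ℝ V}
    {W : V → Set V} (hM : IsEmbeddedSubmanifold ∞ M) (hfM : MapsTo f M M)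
    (hf : ∀ x ∈ M, ContDiffAt ℝ ∞ f x) (hΛM : Λ ⊆ M) (hΛ : IsCompact Λ) (hfΛ : MapsTo f Λ Λ)
    (hW : IsInvariantLeafFamily (k + 1) M Λ f A W) (n : ℕ) :
    IsLeafSystem k Λ M f^[n] W where
  isCompact := hΛ
  mapsTo := hfΛ.iterate n
  mapsTo_manifold := hfM.iterate n
  contDiffAt x hx := (contDiffAt_iterate hfM hf n x (hΛM hx)).of_le
    (natCast_le_infty _)
  mem := hW.mem
  subset := hW.subset
  invariant := eventually_iterate_mem hfΛ (fun x hx => (hf x (hΛM hx)).continuousAt) hW.invariant n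
  retraction_manifold x hx := by
    obtain ⟨Φ, B, hΦ⟩ := hM x (hΛM hx)
    obtain ⟨h1, h2⟩ := hΦ.isLocalRetraction (m := k + 3)
      (natCast_le_infty _) (hΛM hx)
    exact ⟨_, _, h1, h2⟩
  retraction := by
    obtain ⟨K, hK⟩ := hW.smooth
    obtain ⟨R, hR⟩ := hΛ.isBounded.exists_norm_le
    refine ⟨(k + 1).factorial * max K (max R 0) * max K 1 ^ (k + 1), fun x hx => ?_⟩
    obtain ⟨Φ, B, hΦ, hb⟩ := hK x hx
    obtain ⟨h1, h2⟩ := hΦ.isLocalRetraction (m := k + 1) le_rfl (hW.mem x hx)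
    refine ⟨_, _, h1, h2, fun j _ hj => ?_⟩
    refine (hΦ.norm_iteratedFDeriv_chartRetraction_le (hW.mem x hx)
      ((hR x hx).trans (le_max_left R 0)) hb hj).trans ?_
    have e1 : ((j.factorial : ℕ) : ℝ) ≤ ((k + 1).factorial : ℕ) := by
      exact_mod_cast Nat.factorial_le hj
    have e2 : max K 1 ^ j ≤ max K 1 ^ (k + 1) := pow_le_pow_right₀ (le_max_right _ _) hj
    gcongr

/-- Hölder continuity of the distribution of tangent spaces of the jets of an invariant family of
submanifolds. -/
theorem isHolderJetDistribution_of_hasRates {k : ℕ} {M Λ : Set V} {f : V → V}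
    {A U : V → Submodule ℝ V} {W : V → Set V} {l μ : ℝ} (hM : IsEmbeddedSubmanifold ∞ M)
    (hfM : MapsTo f M M) (hf : ∀ x ∈ M, ContDiffAt ℝ ∞ f x) (hΛM : Λ ⊆ M) (hΛ : IsCompact Λ)
    (hfΛ : MapsTo f Λ Λ) (hW : IsInvariantLeafFamily (k + 1) M Λ f A W)
    (hT : ∀ x ∈ Λ, tangentSpaceOf M x = A x ⊔ U x) (hl : 0 < l) (hlμ : l < μ)
    (hr : HasRates f Λ A U l μ) (hU : ∃ x ∈ Λ, U x ≠ ⊥) (hk : 1 ≤ k → l ^ (k + 2) < μ)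
    (hF : 1 ≤ cNorm (k + 4) f Λ) :
    IsHolderJetDistribution k Λ W (holderExponent l μ (bConst (k + 1) f Λ)) := by
  obtain ⟨C, hC, hrC⟩ := hr
  set F := cNorm (k + 4) f Λ
  have hF0 : 0 < F := by linarith
  have hμ : 0 < μ := hl.trans hlμ
  have hDf : ∀ x ∈ Λ, ‖fderiv ℝ f x‖ ≤ F := fun x hx =>
    norm_fderiv_le_cNorm (by omega) hΛ (fun y hy => hf y (hΛM hy)) hx
  have hsmooth : ∀ n : ℕ, ∀ x ∈ Λ, ContDiffAt ℝ (1 : ℕ) f^[n] x := fun n x hx =>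
    (contDiffAt_iterate hfM hf n x (hΛM hx)).of_le (natCast_le_infty _)
  have hdiff : ∀ n : ℕ, ∀ x ∈ Λ, DifferentiableAt ℝ f^[n] x := fun n x hx =>
    (hsmooth n x hx).differentiableAt (by simp)
  have hadd : ∀ x ∈ Λ, ∀ a b : ℕ, fderiv ℝ f^[a + b] x =
      (fderiv ℝ f^[a] (f^[b] x)).comp (fderiv ℝ f^[b] x) := by
    intro x hx a b
    rw [Function.iterate_add]
    exact fderiv_comp x (hdiff a _ (hfΛ.iterate b hx)) (hdiff b x hx)
  have hH : IsRateCocycle Λ f (fun n x => fderiv ℝ f^[n] x) A U C F l μ :=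
    { mapsTo := hfΛ
      zero := fun x _ => fderiv_id
      add := hadd
      mem := by
        intro x hx n v hv
        rw [← hW.tangent x hx] at hv
        rw [← hW.tangent _ (hfΛ.iterate n hx)]
        exact (jetMap_mem_of_germ (k := 0) (hsmooth n x hx) (eventually_iterate_mem hfΛ
          (fun x hx => (hf x (hΛM hx)).continuousAt) hW.invariant n x hx) le_rfl
          (hW.mem x hx) rfl).2 (Submodule.mem_map_of_mem hv)
      norm_le := hDf
      upper := fun x hx n => (hrC x hx n).1
      lower := fun x hx n => (hrC x hx n).2 }
  have hA : ∀ x ∈ Λ, ∀ n : ℕ, ∀ u ∈ A x ⊔ U x,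
      fderiv ℝ f^[n] x u ∈ A (f^[n] x) ⊔ U (f^[n] x) := by
    intro x hx n u hu
    rw [← hT x hx] at hu
    rw [← hT _ (hfΛ.iterate n hx)]
    exact (jetMap_mem_of_germ (k := 0) (S := M) (S' := M) (hsmooth n x hx)
      (Eventually.of_forall fun y hy => hfM.iterate n hy) le_rfl (hΛM hx) rfl).2
      (Submodule.mem_map_of_mem hu)
  have hDn : ∀ n : ℕ, ∀ x ∈ Λ, ‖fderiv ℝ f^[n] x‖ ≤ F ^ n := by
    intro n
    induction n with
    | zero => intro x _; rw [pow_zero]; exact (congrArg norm fderiv_id).trans_le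
                ContinuousLinearMap.norm_id_le
    | succ n ih =>
      intro x hx
      rw [hadd x hx n 1, pow_succ]
      exact (ContinuousLinearMap.opNorm_comp_le _ _).trans
        (mul_le_mul (ih _ (hfΛ hx)) (hDf x hx) (norm_nonneg _) (by positivity))
  -- A nonzero vector of `U` grows at least like `μ ^ n` and at most like `F ^ n`; this is the point
  -- where `U` must be nontrivial.
  have hμF : μ ≤ F := by
    by_contra hcon
    obtain ⟨x, hx, hne⟩ := hU
    obtain ⟨v, hv, hv0⟩ := Submodule.exists_mem_ne_zero_of_ne_bot hne
    have hvn : 0 < ‖v‖ := norm_pos_iff.2 hv0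
    obtain ⟨n, hn⟩ := pow_unbounded_of_one_lt C ((one_lt_div hF0).2 (not_le.1 hcon))
    have h1 := ((hrC x hx n).2 v hv).trans (ContinuousLinearMap.le_of_opNorm_le _ (hDn n x hx) v)
    have h2 := le_of_mul_le_mul_right h1 hvn
    rw [inv_mul_eq_div, div_le_iff₀ hC] at h2
    rw [div_pow, lt_div_iff₀ (by positivity)] at hn
    linarith
  have hb := pow_mul_lt_bConst (V := V) (f := f) (Λ := Λ) (k := k) hF
  set b := bConst (k + 1) f Λ
  have hFb : F < b := lt_of_le_of_lt
    (le_mul_of_one_le_left hF0.le (one_le_pow₀ (by linarith))) hb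
  have hφ0 := holderExponent_pos hl hlμ (show l < b by linarith)
  have hφ1 := holderExponent_le_one hl hμ (show l < b by linarith) (show μ ≤ b by linarith)
  obtain ⟨σ, l', hσ, hll', hl'σ, hs⟩ := exists_scaling hl hlμ hμF hF hk hb
  set φ := holderExponent l μ b
  have hσ0 : 0 < σ := by linarith
  have hl'0 : 0 < l' := hl.trans hll'
  set m := l' * (2 * F * σ / l') ^ φ
  have hm0 : 0 < m := by positivity
  -- The rate `m'` between `m * σ ^ k` and `μ` is the one attained on the quotient by the iterate;
  -- `m` is what remains after the rescaling and the perturbation.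
  obtain ⟨m', hm1, hm2⟩ := exists_between hs
  have hm'0 : 0 < m' := lt_trans (by positivity) hm1
  obtain ⟨l₁, hl1, hl2⟩ := exists_between hll'
  obtain ⟨N, hN, hone⟩ := hH.exists_one_step hC hF hl.le hl1 hm'0 hm2 hlμ hA
  have hN0 : N ≠ 0 := by omega
  have hl₁0 : 0 < l₁ := hl.trans hl1
  -- The estimate is applied to the `N`-th iterate with `N`-th powers of all rates, so that the
  -- condition on `φ` is the `N`-th power of the original one.
  obtain ⟨τ, C', hτ, hC', hgap⟩ := (isLeafSystem_iterate hM hfM hf hΛM hΛ hfΛ hW N).exists_gap_le_rpow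
    (σ := σ ^ N) (l0 := l₁ ^ N) (l := l' ^ N) (μ := m' ^ N) (m := m ^ N) (D0 := F ^ N)
    (D' := (2 * F) ^ N) (φ := φ) (one_le_pow₀ hσ) (by positivity)
    (pow_lt_pow_left₀ hl2 hl₁0.le hN0) (pow_le_pow_left₀ hl'0.le hl'σ N) (by positivity)
    (pow_lt_pow_left₀ (by linarith) hF0.le hN0) (one_lt_pow₀ (by linarith) hN0) (by positivity)
    (by
      rw [← inv_pow, ← pow_mul, mul_comm N k, pow_mul, ← mul_pow]
      refine pow_lt_pow_left₀ ?_ hm0.le hN0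
      rw [inv_pow, ← div_eq_mul_inv, lt_div_iff₀ (by positivity)]
      exact hm1) hφ0 hφ1
    (by
      rw [← mul_pow, ← div_pow]
      have : ((2 * F * σ / l') ^ N) ^ φ = ((2 * F * σ / l') ^ φ) ^ N := by
        rw [← Real.rpow_natCast, ← Real.rpow_natCast, ← Real.rpow_mul (by positivity),
          ← Real.rpow_mul (by positivity), mul_comm φ]
      rw [this, ← mul_pow]) (hDn N)
    (fun x hx v hv => (hone x hx).1 v (by rwa [hW.tangent x hx] at hv))
    (by
      intro x hx u hu e' he'
      rw [hW.tangent _ (hfΛ.iterate N hx)] at he'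
      rw [hT x hx] at hu
      rw [hW.tangent x hx]
      exact (hone x hx).2 u hu e' he')
  exact isHolderJetDistribution_of_smallJets hφ0.le hτ hC' hgap

end HolderDistribution

/-! ### Linear algebra of splittings -/

section SplittingAlgebra

variable {V : Type*} [AddCommGroup V] [Module ℝ V]

lemma iSupIndep_three {A B C : Submodule ℝ V} : iSupIndep ![A, B, C] ↔
    Disjoint A (B ⊔ C) ∧ Disjoint B (A ⊔ C) ∧ Disjoint C (A ⊔ B) := by
  have e : ∀ (t : Fin 3 → Submodule ℝ V) (i : Fin 3), ⨆ j, ⨆ (_ : j ≠ i), t j =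
      (⨆ (_ : (0 : Fin 3) ≠ i), t 0) ⊔ (⨆ (_ : (1 : Fin 3) ≠ i), t 1) ⊔
        ⨆ (_ : (2 : Fin 3) ≠ i), t 2 := by
    intro t i
    apply le_antisymm
    · refine iSup_le fun j => ?_
      fin_cases j
      · exact le_sup_of_le_left le_sup_left
      · exact le_sup_of_le_left le_sup_right
      · exact le_sup_right
    · exact sup_le (sup_le (le_iSup (fun j => ⨆ (_ : j ≠ i), t j) 0)
        (le_iSup (fun j => ⨆ (_ : j ≠ i), t j) 1)) (le_iSup (fun j => ⨆ (_ : j ≠ i), t j) 2)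
  rw [iSupIndep_def]
  simp only [e, Fin.forall_fin_succ]
  simp

namespace IsSplitting

variable {T A B C : Submodule ℝ V}

/-- This is the modular law together with the independence of `B` from `A ⊔ C`. -/
lemma sup_inf_sup (h : IsSplitting T A B C) : (B ⊔ A) ⊓ (C ⊔ A) = A := by
  have h1 := (iSupIndep_three.1 h.2).2.1
  rw [sup_comm B A, sup_inf_assoc_of_le B (le_sup_right : A ≤ C ⊔ A), sup_comm C A,
    disjoint_iff.1 h1, sup_bot_eq]

lemma map {V' : Type*} [AddCommGroup V'] [Module ℝ V'] (h : IsSplitting T A B C) (e : V ≃ₗ[ℝ] V') :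
    IsSplitting (T.map (e : V →ₗ[ℝ] V')) (A.map (e : V →ₗ[ℝ] V')) (B.map (e : V →ₗ[ℝ] V'))
      (C.map (e : V →ₗ[ℝ] V')) := by
  obtain ⟨h1, h2⟩ := h
  obtain ⟨hA, hB, hC⟩ := iSupIndep_three.1 h2
  have hd : ∀ {P Q : Submodule ℝ V}, Disjoint P Q →
      Disjoint (P.map (e : V →ₗ[ℝ] V')) (Q.map (e : V →ₗ[ℝ] V')) := fun hPQ => by
    rw [disjoint_iff, ← Submodule.map_inf _ e.injective, disjoint_iff.1 hPQ, Submodule.map_bot]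
  refine ⟨by rw [← Submodule.map_sup, ← Submodule.map_sup, h1], iSupIndep_three.2 ?_⟩
  simp only [← Submodule.map_sup]
  exact ⟨hd hA, hd hB, hd hC⟩

end IsSplitting

end SplittingAlgebra

/-! ### Jets in flattening charts -/

section JetSubspaces

set_option linter.unusedSectionVars false

variable {V : Type*} [NormedAddCommGroup V]

section Normed

variable [NormedSpace ℝ V]

lemma jetSub_sup (A B : Submodule ℝ V) : (k : ℕ) → jetSub (A ⊔ B) k = jetSub A k ⊔ jetSub B k
  | 0 => rfl
  | k + 1 => by
    change (jetSub (A ⊔ B) k).prod (jetSub (A ⊔ B) k) =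
      (jetSub A k).prod (jetSub A k) ⊔ (jetSub B k).prod (jetSub B k)
    rw [jetSub_sup A B k, Submodule.prod_sup_prod]

lemma jetSub_inf (A B : Submodule ℝ V) : (k : ℕ) → jetSub (A ⊓ B) k = jetSub A k ⊓ jetSub B k
  | 0 => rfl
  | k + 1 => by
    change (jetSub (A ⊓ B) k).prod (jetSub (A ⊓ B) k) =
      (jetSub A k).prod (jetSub A k) ⊓ (jetSub B k).prod (jetSub B k)
    rw [jetSub_inf A B k, Submodule.prod_inf_prod]

lemma jetSub_bot : (k : ℕ) → jetSub (⊥ : Submodule ℝ V) k = ⊥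
  | 0 => rfl
  | k + 1 => by
    change (jetSub (⊥ : Submodule ℝ V) k).prod (jetSub (⊥ : Submodule ℝ V) k) = ⊥
    rw [jetSub_bot k]
    exact Submodule.prod_bot

lemma IsSplitting.jetSub {T A B C : Submodule ℝ V} (h : IsSplitting T A B C) (k : ℕ) :
    IsSplitting (jetSub T k) (jetSub A k) (jetSub B k) (jetSub C k) := by
  obtain ⟨h1, h2⟩ := h
  obtain ⟨hA, hB, hC⟩ := iSupIndep_three.1 h2
  have hd : ∀ {P Q : Submodule ℝ V}, Disjoint P Q → Disjoint (_root_.jetSub P k)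
      (_root_.jetSub Q k) := fun hPQ => by
    rw [disjoint_iff, ← jetSub_inf, disjoint_iff.1 hPQ, jetSub_bot]
  refine ⟨by rw [← jetSub_sup, ← jetSub_sup, h1], iSupIndep_three.2 ?_⟩
  simp only [← jetSub_sup]
  exact ⟨hd hA, hd hB, hd hC⟩

lemma jetMap_continuousLinearMap (L : V →L[ℝ] V) : (k : ℕ) → jetMap L k = jetDiag L k
  | 0 => rfl
  | k + 1 => by
    ext1 p
    change ((jetMap L k p.1, fderiv ℝ (jetMap L k) p.1 p.2) : JetSpace V k × JetSpace V k) =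
      (jetDiag L k p.1, jetDiag L k p.2)
    rw [jetMap_continuousLinearMap L k, ContinuousLinearMap.fderiv]

end Normed

variable [InnerProductSpace ℝ V] [FiniteDimensional ℝ V]

lemma isLocalRetraction_starProjection (A : Submodule ℝ V) (n : ℕ) :
    IsLocalRetraction n A.starProjection (A : Set V) univ where
  isOpen := isOpen_univ
  contDiffOn := A.starProjection.contDiff.contDiffOn
  mem y _ := A.starProjection_apply_mem y
  eq_self _ _ hy := Submodule.starProjection_eq_self_iff.2 hy

lemma mem_jetSub_iff_starProjection (A : Submodule ℝ V) (k : ℕ) (ξ v : JetSpace V k) :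
    v ∈ jetSub A k ↔ fderiv ℝ (jetMap A.starProjection k) ξ v = v := by
  rw [jetMap_continuousLinearMap, ContinuousLinearMap.fderiv]
  exact jetDiag_eq_self_iff _ A (fun v => Submodule.starProjection_eq_self_iff.symm) k v

lemma tangentSpaceOf_jetSet_submodule (A : Submodule ℝ V) {k : ℕ} {ξ : JetSpace V k}
    (hξ : ξ ∈ jetSet (A : Set V) k) : tangentSpaceOf (jetSet (A : Set V) k) ξ = jetSub A k := by
  ext v
  rw [(isLocalRetraction_starProjection A (k + 1)).mem_tangentSpaceOf_iff le_rfl hξ (mem_univ _),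
    mem_jetSub_iff_starProjection A k ξ]

namespace Flattens

variable {Φ : OpenPartialHomeomorph V V} {n k : ℕ} {S : Set V} {x : V} {A : Submodule ℝ V}

lemma fderiv_jetMap_symm_apply (h : Flattens n Φ S x A) (hk : k + 1 ≤ n) {ξ : JetSpace V k}
    (hb : jetBase k ξ ∈ Φ.source) (v : JetSpace V k) :
    jetMap Φ.symm k (jetMap Φ k ξ) = ξ ∧
    fderiv ℝ (jetMap Φ.symm k) (jetMap Φ k ξ) (fderiv ℝ (jetMap Φ k) ξ v) = v := by
  have h1 : ∀ j ≤ n, ∀ p : JetSpace V j, jetBase j p ∈ Φ.source →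
      jetMap Φ.symm j (jetMap Φ j p) = p := by
    intro j hj p hp
    rw [← jetMap_comp Φ.open_source Φ.open_target h.contDiffOn h.contDiffOn_symm
      (fun y hy => Φ.map_source hy) j hj p hp]
    have h2 : ContDiffOn ℝ n (Φ.symm ∘ Φ) Φ.source :=
      h.contDiffOn_symm.comp h.contDiffOn fun y hy => Φ.map_source hy
    rw [jetMap_eq_of_eqOn Φ.open_source h2 contDiff_id.contDiffOn (S := univ)
      (fun y hy _ => Φ.left_inv hy) j hj p (by rw [jetSet_univ]; trivial) hp, jetMap_id]
  exact ⟨h1 k (by omega) ξ hb, congrArg Prod.snd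
    (h1 (k + 1) hk ((ξ, v) : JetSpace V k × JetSpace V k) hb)⟩

/-- A flattening chart flattens the tangent spaces of the iterated tangent bundles. -/
lemma tangentSpaceOf_jetSet (h : Flattens n Φ S x A) (hk : k + 1 ≤ n) {ξ : JetSpace V k}
    (hξ : ξ ∈ jetSet S k) (hb : jetBase k ξ ∈ Φ.source) :
    tangentSpaceOf (jetSet S k) ξ =
      (jetSub A k).comap (fderiv ℝ (jetMap Φ k) ξ).toLinearMap := by
  have hm : ∀ y ∈ Φ.source, y ∈ S → Φ y ∈ (A : Set V) := fun y hy hyS => (h.mem_iff y hy).1 hyS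
  have hm' : ∀ y ∈ Φ.target, y ∈ (A : Set V) → Φ.symm y ∈ S := fun y hy hyA =>
    (h.mem_iff _ (Φ.map_target hy)).2 (by rwa [Φ.right_inv hy])
  have hξ' := jetMap_mem_jetSet Φ.open_source h.contDiffOn hm k (by omega) ξ hξ hb
  have hb' : jetBase k (jetMap Φ k ξ) ∈ Φ.target := by
    rw [jetBase_jetMap]; exact Φ.map_source hb
  have h1 := map_tangentSpaceOf_jetSet_le Φ.open_source h.contDiffOn hm hk hξ hb
  have h2 := map_tangentSpaceOf_jetSet_le Φ.open_target h.contDiffOn_symm hm' hk hξ' hb'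
  rw [tangentSpaceOf_jetSet_submodule A hξ'] at h1 h2
  refine le_antisymm (Submodule.map_le_iff_le_comap.1 h1) fun v hv => ?_
  obtain ⟨e1, e2⟩ := h.fderiv_jetMap_symm_apply hk hb v
  have h3 := h2 (Submodule.mem_map_of_mem (show fderiv ℝ (jetMap Φ k) ξ v ∈ jetSub A k from hv))
  rw [e1] at h3
  exact e2 ▸ h3

/-- The derivative of the jet map of a chart is injective, hence invertible in finite dimension. One
equivalence transports all the linear models at once, so a splitting of the models becomes one of
the tangent spaces. -/
lemma exists_linearEquiv (h : Flattens n Φ S x A) (hk : k + 1 ≤ n) {ξ : JetSpace V k}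
    (hb : jetBase k ξ ∈ Φ.source) :
    ∃ e : JetSpace V k ≃ₗ[ℝ] JetSpace V k, ∀ B : Submodule ℝ (JetSpace V k),
      B.comap (fderiv ℝ (jetMap Φ k) ξ).toLinearMap = B.map (e : JetSpace V k →ₗ[ℝ] JetSpace V k) := by
  have : FiniteDimensional ℝ (JetSpace V k) := finiteDimensional_jetSpace k
  have hinj : Function.Injective (fderiv ℝ (jetMap Φ k) ξ).toLinearMap := fun v w hvw => by
    rw [← (h.fderiv_jetMap_symm_apply hk hb v).2, ← (h.fderiv_jetMap_symm_apply hk hb w).2]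
    exact congrArg _ hvw
  refine ⟨(LinearEquiv.ofInjectiveEndo _ hinj).symm, fun B => ?_⟩
  rw [← Submodule.comap_equiv_eq_map_symm]
  rfl

end Flattens

end JetSubspaces

/-! ### A chart adapted to the manifold and its leaves -/

section AdaptedChart

set_option linter.unusedSectionVars false

variable {V : Type*} [NormedAddCommGroup V] [InnerProductSpace ℝ V] [FiniteDimensional ℝ V]

namespace IsLocalRetraction

variable {n : ℕ} {r : V → V} {S U : Set V}

lemma hasStrictFDerivAt (h : IsLocalRetraction n r S U) (hn : 1 ≤ n) {x : V} (hx : x ∈ U) :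
    HasStrictFDerivAt r (fderiv ℝ r x) x :=
  (h.contDiffAt hx).hasStrictFDerivAt (by simp; omega)

lemma fderiv_apply_mem (h : IsLocalRetraction n r S U) (hn : 1 ≤ n) {x : V} (hx : x ∈ U)
    (hxS : x ∈ S) (v : V) : fderiv ℝ r x v ∈ tangentSpaceOf S x :=
  h.fderiv_mem (k := 0) hn (ξ := x) hxS hx v

lemma fderiv_apply_eq_self (h : IsLocalRetraction n r S U) (hn : 1 ≤ n) {x : V} (hx : x ∈ U)
    (hxS : x ∈ S) {v : V} (hv : v ∈ tangentSpaceOf S x) : fderiv ℝ r x v = v :=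
  (h.mem_tangentSpaceOf_iff (k := 0) hn (ξ := x) hxS hx).1 hv

/-- A map whose derivative is the identity and which maps a submanifold into its tangent
space flattens the submanifold. -/
lemma eventually_mem_iff (h : IsLocalRetraction n r S U) (hn : 1 ≤ n) {x : V} (hx : x ∈ U)
    (hxS : x ∈ S) {Ψ : V → V} (hΨ : HasStrictFDerivAt Ψ (ContinuousLinearMap.id ℝ V) x)
    (hm : ∀ᶠ y in 𝓝 x, y ∈ S → Ψ y ∈ tangentSpaceOf S x) :
    ∀ᶠ y in 𝓝 x, y ∈ S ↔ Ψ y ∈ tangentSpaceOf S x := by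
  set E := tangentSpaceOf S x
  have hrx : r x = x := h.eq_self x hx hxS
  set P := E.starProjection
  -- `F` has invertible derivative at `x`, hence is injective nearby. If `Ψ y` lies in the tangent
  -- space, `F` takes the same value at `y` and at `r y`, so `y = r y` lies in `S`. This replaces a
  -- dimension count.
  set F : V → V := fun y => P (Ψ (r y)) + (Ψ y - P (Ψ y))
  set D : V →L[ℝ] V := P.comp (fderiv ℝ r x) + (ContinuousLinearMap.id ℝ V - P)
  have hF : HasStrictFDerivAt F D x := by
    have h1 : HasStrictFDerivAt (fun y => Ψ (r y)) (fderiv ℝ r x) x :=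
      HasStrictFDerivAt.comp x (g := Ψ) (g' := ContinuousLinearMap.id ℝ V) (by rwa [hrx])
        (h.hasStrictFDerivAt hn hx)
    exact (P.hasStrictFDerivAt.comp x h1).add (hΨ.sub (P.hasStrictFDerivAt.comp x hΨ))
  have hinj : Function.Injective D.toLinearMap := by
    rw [← LinearMap.ker_eq_bot, LinearMap.ker_eq_bot']
    intro v hv
    have hv' : P (fderiv ℝ r x v) + (v - P v) = 0 := hv
    rw [Submodule.starProjection_eq_self_iff.2 (h.fderiv_apply_mem hn hx hxS v)] at hv'
    have hvE : v ∈ E := by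
      have : v = P v - fderiv ℝ r x v := by
        rw [eq_sub_iff_add_eq, ← sub_eq_zero, ← hv']; abel
      rw [this]
      exact E.sub_mem (Submodule.starProjection_apply_mem _ _) (h.fderiv_apply_mem hn hx hxS v)
    rwa [h.fderiv_apply_eq_self hn hx hxS hvE, Submodule.starProjection_eq_self_iff.2 hvE, sub_self,
      add_zero] at hv'
  set D' : V ≃L[ℝ] V := (LinearEquiv.ofInjectiveEndo D.toLinearMap hinj).toContinuousLinearEquiv
  have hD : (D' : V →L[ℝ] V) = D := by ext v; rfl
  rw [← hD] at hF
  set e := hF.toOpenPartialHomeomorph F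
  have he : ∀ᶠ y in 𝓝 x, y ∈ e.source :=
    e.open_source.mem_nhds hF.mem_toOpenPartialHomeomorph_source
  have hr : Tendsto r (𝓝 x) (𝓝 x) := by
    have := (h.contDiffAt hx).continuousAt.tendsto
    rwa [hrx] at this
  filter_upwards [hm, hr.eventually hm, he, hr.eventually he, h.isOpen.mem_nhds hx,
    hr (h.isOpen.mem_nhds hx)] with y h1 h2 h3 h4 hyU hrU
  refine ⟨h1, fun hy => ?_⟩
  have hry := h.mem y hyU
  have e1 : F y = F (r y) := by
    change P (Ψ (r y)) + (Ψ y - P (Ψ y)) = P (Ψ (r (r y))) + (Ψ (r y) - P (Ψ (r y)))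
    rw [h.eq_self _ hrU hry, Submodule.starProjection_eq_self_iff.2 hy,
      Submodule.starProjection_eq_self_iff.2 (h2 hry)]
    abel
  have : y = r y := e.injOn h3 h4 e1
  rw [this]; exact hry

end IsLocalRetraction

/-- Projections adapted to a splitting. -/
lemma IsSplitting.exists_projections {T A B C : Submodule ℝ V} (h : IsSplitting T A B C) :
    ∃ PA PB PC PN : V →L[ℝ] V, PA + PB + PC + PN = ContinuousLinearMap.id ℝ V ∧
      (∀ v, PA v ∈ A) ∧ (∀ v, PB v ∈ B) ∧ (∀ v, PC v ∈ C) ∧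
      (∀ v ∈ C ⊔ A, PB v = 0) ∧ (∀ v ∈ B ⊔ A, PC v = 0) ∧ ∀ v ∈ T, PN v = 0 := by
  obtain ⟨h1, h2⟩ := h
  obtain ⟨hA, hB, hC⟩ := iSupIndep_three.1 h2
  obtain ⟨N, hN⟩ := T.exists_isCompl
  have key : ∀ {P Q : Submodule ℝ V}, Disjoint P Q → P ⊔ Q = T → IsCompl P (Q ⊔ N) :=
    fun hd he => hd.isCompl_sup_right_of_isCompl_sup_left (he ▸ hN)
  have cA : IsCompl A (B ⊔ C ⊔ N) := key hA (by rw [← sup_assoc, h1])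
  have cB : IsCompl B (A ⊔ C ⊔ N) := key hB (by rw [← sup_assoc, sup_comm B A, h1])
  have cC : IsCompl C (A ⊔ B ⊔ N) := key hC (by rw [sup_comm, h1])
  have hAT : A ≤ T := h1 ▸ le_sup_of_le_left le_sup_left
  have hBT : B ≤ T := h1 ▸ le_sup_of_le_left le_sup_right
  have hCT : C ≤ T := h1 ▸ le_sup_right
  have zA : ∀ v ∈ B ⊔ C ⊔ N, A.projection _ cA v = 0 := fun v hv =>
    (Submodule.projection_apply_eq_zero_iff cA).2 hv
  have zB : ∀ v ∈ A ⊔ C ⊔ N, B.projection _ cB v = 0 := fun v hv =>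
    (Submodule.projection_apply_eq_zero_iff cB).2 hv
  have zC : ∀ v ∈ A ⊔ B ⊔ N, C.projection _ cC v = 0 := fun v hv =>
    (Submodule.projection_apply_eq_zero_iff cC).2 hv
  have zN : ∀ v ∈ T, N.projection _ hN.symm v = 0 := fun v hv =>
    (Submodule.projection_apply_eq_zero_iff hN.symm).2 hv
  refine ⟨(A.projection _ cA).toContinuousLinearMap, (B.projection _ cB).toContinuousLinearMap,
    (C.projection _ cC).toContinuousLinearMap, (N.projection _ hN.symm).toContinuousLinearMap, ?_,
    Submodule.projection_apply_mem cA, Submodule.projection_apply_mem cB,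
    Submodule.projection_apply_mem cC, fun v hv => zB v (Submodule.mem_sup_left (by rwa [sup_comm A C])),
    fun v hv => zC v (Submodule.mem_sup_left (by rwa [sup_comm A B])), zN⟩
  ext v
  have hv : v ∈ A ⊔ B ⊔ C ⊔ N := by rw [h1, hN.sup_eq_top]; trivial
  obtain ⟨w, hw, d, hd, rfl⟩ := Submodule.mem_sup.1 hv
  obtain ⟨u, hu, c, hc, rfl⟩ := Submodule.mem_sup.1 hw
  obtain ⟨a, ha, b, hb, rfl⟩ := Submodule.mem_sup.1 hu
  have eA := (Submodule.projection_eq_self_iff cA a).2 ha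
  have eB := (Submodule.projection_eq_self_iff cB b).2 hb
  have eC := (Submodule.projection_eq_self_iff cC c).2 hc
  have eN := (Submodule.projection_eq_self_iff hN.symm d).2 hd
  simp only [add_apply, LinearMap.coe_toContinuousLinearMap', map_add, ContinuousLinearMap.id_apply,
    eA, eB, eC, eN]
  rw [zA b (Submodule.mem_sup_left (Submodule.mem_sup_left hb)), zA c (Submodule.mem_sup_left (Submodule.mem_sup_right hc)),
    zA d (Submodule.mem_sup_right hd), zB a (Submodule.mem_sup_left (Submodule.mem_sup_left ha)),
    zB c (Submodule.mem_sup_left (Submodule.mem_sup_right hc)), zB d (Submodule.mem_sup_right hd),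
    zC a (Submodule.mem_sup_left (Submodule.mem_sup_left ha)), zC b (Submodule.mem_sup_left (Submodule.mem_sup_right hb)),
    zC d (Submodule.mem_sup_right hd), zN a (hAT ha), zN b (hBT hb), zN c (hCT hc)]
  abel

/-- A map germ whose derivative is the identity restricts to a change of coordinates. -/
lemma exists_openPartialHomeomorph_of_fderiv_eq_id {n : ℕ} (hn : 1 ≤ n) {Ψ : V → V} {x : V}
    (hc : ContDiffAt ℝ n Ψ x) (hΨ : HasFDerivAt Ψ (ContinuousLinearMap.id ℝ V) x) {p : V → Prop}
    (hp : ∀ᶠ y in 𝓝 x, p y) :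
    ∃ Φ : OpenPartialHomeomorph V V, (∀ y, Φ y = Ψ y) ∧ x ∈ Φ.source ∧
      ContDiffOn ℝ n Φ Φ.source ∧ ContDiffOn ℝ n Φ.symm Φ.target ∧ ∀ y ∈ Φ.source, p y := by
  have hn0 : (n : WithTop ℕ∞) ≠ 0 := by simp; omega
  have hΨ' : HasFDerivAt Ψ (ContinuousLinearEquiv.refl ℝ V : V →L[ℝ] V) x := hΨ
  set e := hc.toOpenPartialHomeomorph Ψ hΨ' hn0
  have hx : x ∈ e.source := hc.mem_toOpenPartialHomeomorph_source hΨ' hn0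
  have hxt : Ψ x ∈ e.target := hc.image_mem_toOpenPartialHomeomorph_target hΨ' hn0
  have hex : e.symm (Ψ x) = x := e.left_inv hx
  have hs : ContDiffAt ℝ n e.symm (Ψ x) :=
    e.contDiffAt_symm (f₀' := ContinuousLinearEquiv.refl ℝ V) hxt (by rw [hex]; exact hΨ')
      (by rw [hex]; exact hc)
  obtain ⟨U, hU, hxU, hcU, hpU⟩ := exists_isOpen_contDiffOn hc hp
  obtain ⟨U', hU', hxU', hcU', -⟩ := exists_isOpen_contDiffOn (p := fun _ => True) hs (by simp)
  have hO : IsOpen (e.source ∩ e ⁻¹' U' ∩ U) := (e.isOpen_inter_preimage hU').inter hU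
  refine ⟨e.restrOpen _ hO, fun _ => rfl, ⟨hx, ⟨hx, hxU'⟩, hxU⟩,
    hcU.mono fun y hy => hy.2.2, hcU'.mono fun y hy => ?_, fun y hy => hpU y hy.2.2⟩
  have h1 : e (e.symm y) ∈ U' := hy.2.1.2
  rwa [e.right_inv hy.1] at h1

/-- A chart which simultaneously flattens a manifold and the submanifolds tangent to the sums of two
summands of a splitting. -/
lemma IsSplitting.exists_flattens {T A B C : Submodule ℝ V} (h : IsSplitting T A B C) {n : ℕ}
    (hn : 1 ≤ n) {M WB WC WA UM UB UC : Set V} {rM rB rC : V → V} {x : V}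
    (hM : IsLocalRetraction n rM M UM) (hB : IsLocalRetraction n rB WB UB)
    (hC : IsLocalRetraction n rC WC UC) (hxM : x ∈ UM) (hxB : x ∈ UB) (hxC : x ∈ UC)
    (hBx : x ∈ WB) (hCx : x ∈ WC) (hBM : WB ⊆ M) (hCM : WC ⊆ M) (hT : tangentSpaceOf M x = T)
    (hTB : tangentSpaceOf WB x = B ⊔ A) (hTC : tangentSpaceOf WC x = C ⊔ A)
    (hA : ∀ᶠ y in 𝓝 x, y ∈ WA ↔ y ∈ WB ∩ WC) :
    ∃ Φ : OpenPartialHomeomorph V V, Flattens n Φ M x T ∧ Flattens n Φ WB x (B ⊔ A) ∧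
      Flattens n Φ WC x (C ⊔ A) ∧ Flattens n Φ WA x A := by
  obtain ⟨PA, PB, PC, PN, hid, mA, mB, mC, zB, zC, zN⟩ := h.exists_projections
  have hMx : x ∈ M := hBM hBx
  have hAT : A ≤ T := h.1 ▸ le_sup_of_le_left le_sup_left
  have hBT : B ≤ T := h.1 ▸ le_sup_of_le_left le_sup_right
  have hCT : C ≤ T := h.1 ▸ le_sup_right
  -- Each correction is projected to a summand that annihilates the tangent space of the retracted
  -- set, so the derivative at `x` is the identity. On each set the term with its own retraction
  -- vanishes, and on the two leaves the `PN` term does too, so `Ψ` maps the set into its tangent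
  -- space.
  set Ψ : V → V := fun y => PA (y - x) + PB (y - rC y) + PC (y - rB y) + PN (y - rM y)
  have hc : ContDiffAt ℝ n Ψ x := by
    have h1 := hM.contDiffAt hxM
    have h2 := hB.contDiffAt hxB
    have h3 := hC.contDiffAt hxC
    fun_prop
  have hΨ : HasStrictFDerivAt Ψ (ContinuousLinearMap.id ℝ V) x := by
    have i0 : HasStrictFDerivAt (fun y : V => y) (ContinuousLinearMap.id ℝ V) x :=
      hasStrictFDerivAt_id x
    have h1 := ((((PA.hasStrictFDerivAt.comp x (i0.sub_const x)).add
      (PB.hasStrictFDerivAt.comp x (i0.sub (hC.hasStrictFDerivAt hn hxC)))).add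
      (PC.hasStrictFDerivAt.comp x (i0.sub (hB.hasStrictFDerivAt hn hxB)))).add
      (PN.hasStrictFDerivAt.comp x (i0.sub (hM.hasStrictFDerivAt hn hxM))))
    refine h1.congr_fderiv ?_
    conv_rhs => rw [← hid]
    ext v
    change PA v + PB (v - fderiv ℝ rC x v) + PC (v - fderiv ℝ rB x v) + PN (v - fderiv ℝ rM x v) =
      PA v + PB v + PC v + PN v
    have e1 := hC.fderiv_apply_mem hn hxC hCx v
    have e2 := hB.fderiv_apply_mem hn hxB hBx v
    have e3 := hM.fderiv_apply_mem hn hxM hMx v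
    rw [hTC] at e1
    rw [hTB] at e2
    rw [hT] at e3
    rw [map_sub, map_sub, map_sub, zB _ e1, zC _ e2, zN _ e3, sub_zero, sub_zero, sub_zero]
  have nM := hM.isOpen.mem_nhds hxM
  have nB := hB.isOpen.mem_nhds hxB
  have nC := hC.isOpen.mem_nhds hxC
  have iM := hM.eventually_mem_iff hn hxM hMx hΨ (by
    filter_upwards [nM] with y hy hyM
    rw [hT]
    change PA (y - x) + PB (y - rC y) + PC (y - rB y) + PN (y - rM y) ∈ T
    rw [hM.eq_self y hy hyM, sub_self, map_zero, add_zero]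
    exact T.add_mem (T.add_mem (hAT (mA _)) (hBT (mB _))) (hCT (mC _)))
  have iB := hB.eventually_mem_iff hn hxB hBx hΨ (by
    filter_upwards [nM, nB] with y hy hy' hyB
    rw [hTB]
    change PA (y - x) + PB (y - rC y) + PC (y - rB y) + PN (y - rM y) ∈ B ⊔ A
    rw [hM.eq_self y hy (hBM hyB), hB.eq_self y hy' hyB, sub_self, map_zero, map_zero, add_zero,
      add_zero, add_comm]
    exact Submodule.add_mem_sup (mB _) (mA _))
  have iC := hC.eventually_mem_iff hn hxC hCx hΨ (by
    filter_upwards [nM, nC] with y hy hy' hyC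
    rw [hTC]
    change PA (y - x) + PB (y - rC y) + PC (y - rB y) + PN (y - rM y) ∈ C ⊔ A
    rw [hM.eq_self y hy (hCM hyC), hC.eq_self y hy' hyC, sub_self, map_zero, map_zero, add_zero,
      add_zero, add_comm]
    exact Submodule.add_mem_sup (mC _) (mA _))
  rw [hT] at iM
  rw [hTB] at iB
  rw [hTC] at iC
  obtain ⟨Φ, hΦ, hx, hc1, hc2, hp⟩ := exists_openPartialHomeomorph_of_fderiv_eq_id hn hc
    hΨ.hasFDerivAt (iM.and (iB.and (iC.and hA)))
  refine ⟨Φ, ⟨hx, hc1, hc2, fun y hy => ?_⟩, ⟨hx, hc1, hc2, fun y hy => ?_⟩,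
    ⟨hx, hc1, hc2, fun y hy => ?_⟩, ⟨hx, hc1, hc2, fun y hy => ?_⟩⟩
  · rw [hΦ]; exact (hp y hy).1
  · rw [hΦ]; exact (hp y hy).2.1
  · rw [hΦ]; exact (hp y hy).2.2.1
  · obtain ⟨-, h2, h3, h4⟩ := hp y hy
    -- The intersection needs no retraction of its own: it is flattened because both leaves are and
    -- `(B ⊔ A) ⊓ (C ⊔ A) = A`.
    rw [hΦ, h4, mem_inter_iff, h2, h3, ← Submodule.mem_inf, h.sup_inf_sup]

/-- The splitting of the tangent spaces of the iterated tangent bundles in an adapted chart. -/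
lemma exists_jet_splitting {T A B C : Submodule ℝ V} (h : IsSplitting T A B C) {k : ℕ}
    {M WB WC WA : Set V} {Φ : OpenPartialHomeomorph V V} {x : V}
    (hM : Flattens (k + 1 : ℕ) Φ M x T) (hB : Flattens (k + 1 : ℕ) Φ WB x (B ⊔ A))
    (hC : Flattens (k + 1 : ℕ) Φ WC x (C ⊔ A)) (hA : Flattens (k + 1 : ℕ) Φ WA x A)
    {ξ : JetSpace V k} (hξ : ξ ∈ jetSet WA k) (hξM : ξ ∈ jetSet M k) (hξB : ξ ∈ jetSet WB k)
    (hξC : ξ ∈ jetSet WC k) (hb : jetBase k ξ = x) :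
    ∃ Fc Fu Fs : Submodule ℝ (JetSpace V k),
      IsSplitting (tangentSpaceOf (jetSet M k) ξ) Fc Fu Fs ∧
      Fu ⊔ Fc = tangentSpaceOf (jetSet WB k) ξ ∧ Fs ⊔ Fc = tangentSpaceOf (jetSet WC k) ξ ∧
      tangentSpaceOf (jetSet WB k) ξ ⊓ tangentSpaceOf (jetSet WC k) ξ = Fc ∧
      Fc = tangentSpaceOf (jetSet WA k) ξ := by
  have hb' : jetBase k ξ ∈ Φ.source := by rw [hb]; exact hM.mem_source
  obtain ⟨e, he⟩ := hM.exists_linearEquiv le_rfl hb'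
  rw [hM.tangentSpaceOf_jetSet le_rfl hξM hb', hB.tangentSpaceOf_jetSet le_rfl hξB hb',
    hC.tangentSpaceOf_jetSet le_rfl hξC hb', hA.tangentSpaceOf_jetSet le_rfl hξ hb']
  have hs := (h.jetSub k).map e
  simp only [he, jetSub_sup, Submodule.map_sup]
  exact ⟨_, _, _, hs, rfl, rfl, hs.sup_inf_sup, rfl⟩

end AdaptedChart

/-! ### The jet splitting, its invariance and its Hölder regularity -/

theorem theoremB1 (N : ℕ) (M Λ : Set (EuclideanSpace ℝ (Fin N)))
    (f g : EuclideanSpace ℝ (Fin N) → EuclideanSpace ℝ (Fin N))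
    (Ec Eu Es : EuclideanSpace ℝ (Fin N) → Submodule ℝ (EuclideanSpace ℝ (Fin N)))
    (Wsc Wuc Wc : EuclideanSpace ℝ (Fin N) → Set (EuclideanSpace ℝ (Fin N)))
    -- the index `i = k + 1` of the jet distributions
    (k : ℕ)
    (hM : IsEmbeddedSubmanifold ∞ M)
    (hfg : IsDiffeoOf M f g)
    (hΛM : Λ ⊆ M) (hΛ : IsCompact Λ) (hinv : f '' Λ = Λ)
    (hsplit : ∀ x ∈ Λ, IsSplitting (tangentSpaceOf M x) (Ec x) (Eu x) (Es x))
    -- the center-stable and the center-unstable manifolds are invariant and of class `C^i`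
    (hWsc : IsInvariantLeafFamily (k + 1) M Λ f (fun x => Es x ⊔ Ec x) Wsc)
    (hWuc : IsInvariantLeafFamily (k + 1) M Λ g (fun x => Eu x ⊔ Ec x) Wuc)
    -- the center manifolds
    (hWc : ∀ x ∈ Λ, ∀ᶠ y in 𝓝 x, y ∈ Wc x ↔ y ∈ Wuc x ∩ Wsc x) :
    -- the splitting of the jets, and its invariance under the jet maps
    (∀ x ∈ Λ, ∀ ξ ∈ jetSet (Wc x) k, jetBase k ξ = x →
      ∃ Fc Fu Fs : Submodule ℝ (JetSpace (EuclideanSpace ℝ (Fin N)) k),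
        IsSplitting (tangentSpaceOf (jetSet M k) ξ) Fc Fu Fs ∧
        Fu ⊔ Fc = tangentSpaceOf (jetSet (Wuc x) k) ξ ∧
        Fs ⊔ Fc = tangentSpaceOf (jetSet (Wsc x) k) ξ ∧
        tangentSpaceOf (jetSet (Wuc x) k) ξ ⊓ tangentSpaceOf (jetSet (Wsc x) k) ξ = Fc ∧
        Fc = tangentSpaceOf (jetSet (Wc x) k) ξ) ∧
    (∀ x ∈ Λ, ∀ ξ ∈ jetSet (Wsc x) k, jetBase k ξ = x →
      jetMap f k ξ ∈ jetSet (Wsc (f x)) k ∧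
      (tangentSpaceOf (jetSet (Wsc x) k) ξ).map (fderiv ℝ (jetMap f k) ξ).toLinearMap ≤
        tangentSpaceOf (jetSet (Wsc (f x)) k) (jetMap f k ξ)) ∧
    (∀ x ∈ Λ, ∀ ξ ∈ jetSet (Wuc x) k, jetBase k ξ = x →
      jetMap g k ξ ∈ jetSet (Wuc (g x)) k ∧
      (tangentSpaceOf (jetSet (Wuc x) k) ξ).map (fderiv ℝ (jetMap g k) ξ).toLinearMap ≤
        tangentSpaceOf (jetSet (Wuc (g x)) k) (jetMap g k ξ)) ∧
    -- Hölder continuity of the center-stable distribution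
    (∀ lsc lu : ℝ, 0 < lsc → lsc < lu →
      HasRates f Λ (fun x => Es x ⊔ Ec x) Eu lsc lu →
      (∃ x ∈ Λ, Eu x ≠ ⊥) →
      (1 ≤ k → lsc ^ (k + 2) < lu) →
      1 ≤ cNorm (k + 4) f Λ →
      IsHolderJetDistribution k Λ Wsc (holderExponent lsc lu (bConst (k + 1) f Λ))) ∧
    -- Hölder continuity of the center-unstable distribution
    (∀ luc ls : ℝ, 0 < luc → luc < ls →
      HasRates g Λ (fun x => Eu x ⊔ Ec x) Es luc ls →
      (∃ x ∈ Λ, Es x ≠ ⊥) →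
      (1 ≤ k → luc ^ (k + 2) < ls) →
      1 ≤ cNorm (k + 4) g Λ →
      IsHolderJetDistribution k Λ Wuc (holderExponent luc ls (bConst (k + 1) g Λ))) := by
  refine ⟨?_, ?_, ?_, ?_, ?_⟩
  · intro x hx ξ hξ hb
    obtain ⟨ΦM, BM, hΦM⟩ := hM x (hΛM hx)
    obtain ⟨_, hs⟩ := hWsc.smooth
    obtain ⟨Φs, Bs, hΦs, -⟩ := hs x hx
    obtain ⟨_, hu⟩ := hWuc.smooth
    obtain ⟨Φu, Bu, hΦu, -⟩ := hu x hx
    obtain ⟨hxM, hrM⟩ := hΦM.isLocalRetraction (m := k + 1) (natCast_le_infty _) (hΛM hx)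
    obtain ⟨hxs, hrs⟩ := hΦs.isLocalRetraction le_rfl (hWsc.mem x hx)
    obtain ⟨hxu, hru⟩ := hΦu.isLocalRetraction le_rfl (hWuc.mem x hx)
    obtain ⟨Φ, h1, h2, h3, h4⟩ := (hsplit x hx).exists_flattens (by omega) hrM hru hrs hxM hxu hxs
      (hWuc.mem x hx) (hWsc.mem x hx) (hWuc.subset x hx) (hWsc.subset x hx) rfl
      (hWuc.tangent x hx) (hWsc.tangent x hx) (hWc x hx)
    -- Jets depend only on the germ of the set at the foot point; this follows by treating the
    -- identity as a map germ from `Wc x` to `S'`.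
    have hmem : ∀ S' : Set (EuclideanSpace ℝ (Fin N)), (∀ᶠ y in 𝓝 x, y ∈ Wc x → y ∈ S') →
        ξ ∈ jetSet S' k := fun S' hS' => by
      have := (jetMap_mem_of_germ (h := id) (n := k + 1) contDiffAt_id hS' le_rfl hξ hb).1
      rwa [jetMap_id] at this
    have hξu := hmem (Wuc x) ((hWc x hx).mono fun y hy h => (hy.1 h).1)
    have hξs := hmem (Wsc x) ((hWc x hx).mono fun y hy h => (hy.1 h).2)
    exact exists_jet_splitting (hsplit x hx) h1 h2 h3 h4 hξ
      (jetSet_mono (hWuc.subset x hx) k hξu) hξu hξs hb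
  · intro x hx ξ hξ hb
    exact jetMap_mem_of_germ (n := k + 1) ((hfg.contDiffAt x (hΛM hx)).of_le (natCast_le_infty _))
      (hWsc.invariant x hx) le_rfl hξ hb
  · intro x hx ξ hξ hb
    exact jetMap_mem_of_germ (n := k + 1)
      ((hfg.contDiffAt_inv x (hΛM hx)).of_le (natCast_le_infty _))
      (hWuc.invariant x hx) le_rfl hξ hb
  · intro lsc lu hl hlu hr hU hk hF
    have hfΛ : MapsTo f Λ Λ := fun x hx => hinv ▸ mem_image_of_mem f hx
    refine isHolderJetDistribution_of_hasRates hM hfg.mapsTo hfg.contDiffAt hΛM hΛ hfΛ hWsc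
      (fun x hx => ?_) hl hlu hr hU hk hF
    rw [← (hsplit x hx).1]
    ac_rfl
  · intro luc ls hl hls hr hU hk hF
    -- Invariance under the inverse uses that `f` maps `Λ` onto itself.
    have hgΛ : MapsTo g Λ Λ := fun x hx => by
      rw [← hinv] at hx
      obtain ⟨y, hy, rfl⟩ := hx
      rwa [hfg.invOn.1 (hΛM hy)]
    refine isHolderJetDistribution_of_hasRates hM hfg.mapsTo_inv hfg.contDiffAt_inv hΛM hΛ hgΛ hWuc
      (fun x hx => ?_) hl hls hr hU hk hF
    rw [← (hsplit x hx).1]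
    ac_rfl
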